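/- Let $d\ge 3$, $e\in SL(d,\mathbb R)$ and $G=ee^t$, and let $\xi(s)=\pi^{-s/2}\Gamma(s/2)\zeta(s)$. For $1\le i\le d-1$ let $P_{\beta_i}\subset SL(d)$ be the maximal parabolic subgroup of block upper triangular matrices with diagonal blocks of sizes $d-i$ and $i$. For $g\in SL(d,\mathbb R)$ with Iwasawa decomposition $g=nak$ ($n$ unit upper triangular, $a=\mathrm{diag}(a_1,\dots,a_d)$ positive, $k$ orthogonal) put $H(g)=(\log a_1,\dots,\log a_d)$ and $\omega_{\beta_i}(H)=H_1+\cdots+H_{d-i}$, and let $$E^{SL(d)}_{\beta_i;s}(g)=\sum_{\gamma\in (P_{\beta_i}\cap SL(d,\mathbb Z))\backslash SL(d,\mathbb Z)}e^{2s\,\omega_{\beta_i}(H(\gamma g))}$$ for $\Re s$ large, and its meromorphic continuation for other $s\in\mathbb C$. (The summand is $\det(MGM^t)^{-s}$ when $g=e$ and $M$ is formed by the last $i$ rows of $\gamma$.) For $\tau=\tau_1+i\tau_2$ in the upper half plane $\mathbb H$ and a real $d\times d$ matrix $X$ let $$\mathcal G(\tau,X)=\sum_{m,n}e^{-\pi\tau_2^{-1}(m+n\tau)X(m+n\bar\tau)^t},$$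 summed over the pairs of linearly independent row vectors $m,n\in\mathbb Z^d$, and let $$I(s,X)=\int_{SL(2,\mathbb Z)\backslash\mathbb H}E^{SL(2)}_s(\tau)\,\mathcal G(\tau,X)\,\frac{d\tau_1d\tau_2}{\tau_2^2},$$ an integral over the standard fundamental domain, where $E^{SL(2)}_s(\tau)=\sum_{\gamma}\mathrm{Im}(\gamma\tau)^s$ is summed over the cosets $\gamma$ of the upper triangular subgroup in $SL(2,\mathbb Z)$ for $\Re s$ large and continued meromorphically in $s$; in particular $E_0^{SL(2)}(\tau)=1$ for all $\tau$. There is a real number $\sigma$, depending only on $d$, such that for $\Re s>\sigma$ the series $E^{SL(2)}_s(\tau)$, $E^{SL(d)}_{\beta_2;s}(e)$ and $E^{SL(d)}_{\beta_{d-2};s}(e)$ converge absolutely, as do $\mathcal G(\tau,uG)$ and $I(0,uG)$ for all $u>0$ and the integral below, the three series have meromorphic continuations in $s$ to $\mathbb C$, and $$\int_0^\infty I(0,uG)\,u^{2s-1}\,du=2\,\xi(2s)\,\xi(2s-1)\,E^{SL(d)}_{\beta_2;s}(e)=2\,\xi(d-2s)\,\xi(d-2s-1)\,E^{SL(d)}_{\beta_{d-2};\frac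 d2-s}(e).$$ Moreover the left side continues to a meromorphic function of $s\in\mathbb C$, and both equalities hold on all of $\mathbb C$ as identities of meromorphic functions. -/

import Mathlib

open scoped MatrixGroups

noncomputable section

namespace NonEpstein

/-! ### Iwasawa decomposition and Eisenstein series of `SL(d)` -/

/-- `a` is the diagonal part of an Iwasawa decomposition `g = n * diag(a) * k`, with `n` unit upper
triangular, `a` positive and `k` orthogonal. -/
def IsIwasawa {d : ℕ} (g : Matrix (Fin d) (Fin d) ℝ) (a : Fin d → ℝ) : Prop :=
  (∀ j, 0 < a j) ∧ ∃ n k : Matrix (Fin d) (Fin d) ℝ,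
    (∀ i, n i i = 1) ∧ (∀ i j, j < i → n i j = 0) ∧
    k ∈ Matrix.orthogonalGroup (Fin d) ℝ ∧ g = n * Matrix.diagonal a * k

theorem exists_isIwasawa {d : ℕ} (g : SL(d, ℝ)) :
    ∃ a, IsIwasawa (g : Matrix (Fin d) (Fin d) ℝ) a := by
  set A : Matrix (Fin d) (Fin d) ℝ := (g : Matrix (Fin d) (Fin d) ℝ) with hA
  have hdet : A.det = 1 := g.2
  have hAu : IsUnit A := by rw [Matrix.isUnit_iff_isUnit_det, hdet]; exact isUnit_one
  have hAtu : IsUnit A.transpose := by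
    rw [Matrix.isUnit_iff_isUnit_det, Matrix.det_transpose, hdet]; exact isUnit_one
  have hP : (A * A.transpose).PosDef := by
    have := Matrix.PosDef.mul_conjTranspose_self A (Matrix.vecMul_injective_iff_isUnit.2 hAu)
    simpa [Matrix.conjTranspose_eq_transpose_of_trivial] using this
  have hS := hP.inv
  set L := LDL.lowerInv hS with hL
  set D := LDL.diagEntries hS with hD
  have hLD : Matrix.diagonal D = L * (A * A.transpose)⁻¹ * L.transpose := by
    have := LDL.diag_eq_lowerInv_conj hS
    simpa [LDL.diag, Matrix.conjTranspose_eq_transpose_of_trivial] using this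
  have hLu : IsUnit L := isUnit_of_invertible _
  have hLtri : ∀ i j, i < j → L i j = 0 := fun i j h => LDL.lowerInv_triangular hS h
  have hLdet : L.det = ∏ i, L i i :=
    Matrix.det_of_isLowerTriangular L (fun i j h => hLtri i j (by simpa using h))
  have hl : ∀ i, L i i ≠ 0 := by
    intro i hi
    have h1 : L.det ≠ 0 := ((Matrix.isUnit_iff_isUnit_det L).1 hLu).ne_zero
    exact h1 (by rw [hLdet]; exact Finset.prod_eq_zero (Finset.mem_univ i) hi)
  have hDpd : (Matrix.diagonal D).PosDef := by
    rw [hLD]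
    have := hS.mul_mul_conjTranspose_same (Matrix.vecMul_injective_iff_isUnit.2 hLu)
    simpa [Matrix.conjTranspose_eq_transpose_of_trivial] using this
  have hDpos : ∀ i, 0 < D i := Matrix.posDef_diagonal_iff.1 hDpd
  let a : Fin d → ℝ := fun i => |L i i| / Real.sqrt (D i)
  have ha : ∀ i, 0 < a i := fun i =>
    div_pos (abs_pos.2 (hl i)) (Real.sqrt_pos.2 (hDpos i))
  let n : Matrix (Fin d) (Fin d) ℝ := L.transpose * Matrix.diagonal (fun i => (L i i)⁻¹)
  have hLdu : IsUnit L.det := (Matrix.isUnit_iff_isUnit_det L).1 hLu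
  have hLtdu : IsUnit L.transpose.det := by rwa [Matrix.det_transpose]
  have hAAu : IsUnit (A * A.transpose).det := by
    simp [hdet]
  have key : n * Matrix.diagonal (fun i => a i ^ 2) * n.transpose = A * A.transpose := by
    have e1 : Matrix.diagonal (fun i => (L i i)⁻¹) * Matrix.diagonal (fun i => a i ^ 2) *
        Matrix.diagonal (fun i => (L i i)⁻¹) = (Matrix.diagonal D)⁻¹ := by
      symm
      apply Matrix.inv_eq_right_inv
      rw [Matrix.diagonal_mul_diagonal, Matrix.diagonal_mul_diagonal,
        Matrix.diagonal_mul_diagonal, ← Matrix.diagonal_one]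
      congr 1
      funext i
      have h2 := Real.sq_sqrt (hDpos i).le
      have h3 := hl i
      have h4 := (hDpos i).ne'
      simp only [a, div_pow, sq_abs, h2]
      field_simp
    have e2 : (Matrix.diagonal D)⁻¹ = L.transpose⁻¹ * (A * A.transpose) * L⁻¹ := by
      rw [hLD, Matrix.mul_inv_rev, Matrix.mul_inv_rev, Matrix.nonsing_inv_nonsing_inv _ hAAu]
      simp only [Matrix.mul_assoc]
    have e3 : n * Matrix.diagonal (fun i => a i ^ 2) * n.transpose =
        L.transpose * (Matrix.diagonal (fun i => (L i i)⁻¹) *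
          Matrix.diagonal (fun i => a i ^ 2) * Matrix.diagonal (fun i => (L i i)⁻¹)) * L := by
      simp only [n, Matrix.transpose_mul, Matrix.diagonal_transpose, Matrix.transpose_transpose,
        Matrix.mul_assoc]
    rw [e3, e1, e2]
    calc L.transpose * (L.transpose⁻¹ * (A * A.transpose) * L⁻¹) * L
        = (L.transpose * L.transpose⁻¹) * (A * A.transpose) * (L⁻¹ * L) := by
          simp only [Matrix.mul_assoc]
      _ = _ := by
          rw [Matrix.mul_nonsing_inv _ hLtdu, Matrix.nonsing_inv_mul _ hLdu]; simp
  let p : Matrix (Fin d) (Fin d) ℝ := n * Matrix.diagonal a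
  have hpp : p * p.transpose = A * A.transpose := by
    rw [← key]
    simp only [p, Matrix.transpose_mul, Matrix.diagonal_transpose, Matrix.mul_assoc]
    rw [← Matrix.mul_assoc (Matrix.diagonal a) (Matrix.diagonal a), Matrix.diagonal_mul_diagonal]
    simp only [sq]
  have hpu : IsUnit p.det := by
    have : p.det * p.det = 1 := by
      have := congrArg Matrix.det hpp
      simpa [Matrix.det_mul, Matrix.det_transpose, hdet] using this
    exact IsUnit.of_mul_eq_one _ this
  have hptu : IsUnit p.transpose.det := by rwa [Matrix.det_transpose]
  refine ⟨a, ha, n, p⁻¹ * A, ?_, ?_, ?_, ?_⟩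
  · intro i
    simp [n, Matrix.mul_diagonal, hl i]
  · intro i j hij
    simp [n, Matrix.mul_diagonal, hLtri j i hij]
  · rw [Matrix.mem_orthogonalGroup_iff, Matrix.transpose_mul,
      Matrix.transpose_nonsing_inv]
    calc p⁻¹ * A * (A.transpose * p.transpose⁻¹)
        = p⁻¹ * (A * A.transpose) * p.transpose⁻¹ := by simp only [Matrix.mul_assoc]
      _ = (p⁻¹ * p) * (p.transpose * p.transpose⁻¹) := by
          rw [← hpp]; simp only [Matrix.mul_assoc]
      _ = 1 := by rw [Matrix.nonsing_inv_mul _ hpu, Matrix.mul_nonsing_inv _ hptu, mul_one]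
  · change A = p * (p⁻¹ * A)
    rw [← Matrix.mul_assoc, Matrix.mul_nonsing_inv _ hpu, Matrix.one_mul]

/-- The logarithm `H(g)` of the diagonal Iwasawa factor of `g`. -/
def iwasawaH {d : ℕ} (g : SL(d, ℝ)) : Fin d → ℝ :=
  fun j => Real.log ((exists_isIwasawa g).choose j)

/-- The standard maximal parabolic subgroup `P_{β_i} ∩ SL(d, ℤ)`: block upper triangular matrices
with diagonal blocks of sizes `d - i` and `i`. -/
def parabolic (d i : ℕ) : Subgroup SL(d, ℤ) where
  carrier := {γ | ∀ j k : Fin d, d ≤ (j : ℕ) + i → (k : ℕ) + i < d → γ j k = 0}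
  one_mem' := by
    intro j k hj hk
    have : j ≠ k := by rintro rfl; omega
    simp [this]
  mul_mem' := by
    intro x y hx hy j k hj hk
    rw [Matrix.SpecialLinearGroup.coe_mul, Matrix.mul_apply]
    refine Finset.sum_eq_zero fun l _ => ?_
    by_cases hl : d ≤ (l : ℕ) + i
    · rw [hy l k hl hk, mul_zero]
    · rw [hx j l hj (by omega), zero_mul]
  inv_mem' := by
    intro x hx j k hj hk
    have hb : Matrix.BlockTriangular (x : Matrix (Fin d) (Fin d) ℤ)
        (fun j : Fin d => if d ≤ (j : ℕ) + i then (1 : ℕ) else 0) := by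
      intro a b hab
      by_cases ha : d ≤ (a : ℕ) + i <;> by_cases hb : d ≤ (b : ℕ) + i <;> simp [ha, hb] at hab
      exact hx a b ha (by omega)
    have hdet : (x : Matrix (Fin d) (Fin d) ℤ).det = 1 := x.2
    have : Invertible (x : Matrix (Fin d) (Fin d) ℤ) :=
      Matrix.invertibleOfIsUnitDet _ (by rw [hdet]; exact isUnit_one)
    have hinv := Matrix.blockTriangular_inv_of_blockTriangular hb
    have hxi : ((x⁻¹ : SL(d, ℤ)) : Matrix (Fin d) (Fin d) ℤ) =
        (x : Matrix (Fin d) (Fin d) ℤ)⁻¹ := by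
      rw [Matrix.SpecialLinearGroup.coe_inv, Matrix.inv_def, hdet]
      simp
    rw [hxi]
    exact hinv (by simp [hj, not_le.2 hk])

/-- The fundamental weight `ω_{β_i}`, as a linear form on trace-zero diagonal matrices. The simple
root `β_i` is `H ↦ H_{d-i} - H_{d-i+1}` (indices from `1`). -/
def fundamentalWeight (d i : ℕ) (H : Fin d → ℝ) : ℝ :=
  ∑ j : Fin d, if (j : ℕ) + i < d then H j else 0

/-- The space of cosets `(P_{β_i} ∩ SL(d, ℤ)) \ SL(d, ℤ)`. -/
abbrev Cosets (d i : ℕ) : Type := Quotient (QuotientGroup.rightRel (parabolic d i))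

/-- The general term `exp (2 s ω_{β_i}(H(γ g)))` of the Eisenstein series; it depends only on the
coset of `γ`, so any representative may be taken. -/
def eisensteinTerm (d i : ℕ) (g : SL(d, ℝ)) (s : ℂ) (c : Cosets d i) : ℂ :=
  Complex.exp (2 * s * (fundamentalWeight d i
    (iwasawaH ((Matrix.SpecialLinearGroup.map (Int.castRingHom ℝ) c.out) * g)) : ℝ))

/-- The maximal parabolic Eisenstein series as a sum over cosets (for `Re s` large). -/
def eisensteinSum (d i : ℕ) (g : SL(d, ℝ)) (s : ℂ) : ℂ :=
  ∑' c : Cosets d i, eisensteinTerm d i g s c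

/-! ### Meromorphic continuation -/

/-- `F` is the meromorphic continuation to `ℂ` of the function `f` given on `Re s > σ`. Normal form
fixes the values of `F` (`0` at a pole, the limit elsewhere), which makes `F` unique. -/
def IsMeromorphicContinuation (σ : ℝ) (f F : ℂ → ℂ) : Prop :=
  MeromorphicNFOn F Set.univ ∧ ∀ s : ℂ, σ < s.re → F s = f s

open Classical in
/-- The meromorphic continuation to `ℂ` of a function given for `Re s` large (`0` if there is
none). -/
def meromorphicContinuation (f : ℂ → ℂ) : ℂ → ℂ :=
  if h : ∃ F : ℂ → ℂ, ∃ σ : ℝ, IsMeromorphicContinuation σ f F then h.choose else 0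

/-- The maximal parabolic Eisenstein series `E^{SL(d)}_{β_i;s}(g)`, for all `s`. -/
def eisenstein (d i : ℕ) (g : SL(d, ℝ)) : ℂ → ℂ :=
  meromorphicContinuation (eisensteinSum d i g)

/-! ### The lattice sum and its integral -/

/-- The general term `Im(γτ)^s` of the classical nonholomorphic Eisenstein series. -/
def eisensteinTermSL2 (τ : UpperHalfPlane) (s : ℂ) (c : Cosets 2 1) : ℂ :=
  ((c.out • τ).im : ℂ) ^ s

/-- The classical nonholomorphic Eisenstein series as a sum (for `Re s` large). -/
def eisensteinSumSL2 (τ : UpperHalfPlane) (s : ℂ) : ℂ :=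
  ∑' c : Cosets 2 1, eisensteinTermSL2 τ s c

/-- The nonholomorphic Eisenstein series `E^{SL(2)}_s(τ)`, for all `s`. -/
def eisensteinSL2 (τ : UpperHalfPlane) : ℂ → ℂ :=
  meromorphicContinuation (eisensteinSumSL2 τ)

/-- Integral `2 × d` matrices of rank `2`. -/
abbrev RankTwo (d : ℕ) : Type :=
  {M : Matrix (Fin 2) (Fin d) ℤ // (M.map (Int.cast : ℤ → ℝ)).rank = 2}

/-- The term `exp (-π τ₂⁻¹ (m + nτ) X (m + n τ̄)ᵗ)` for the matrix with rows `m`, `n`. -/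
def latticeTerm {d : ℕ} (τ : UpperHalfPlane) (X : Matrix (Fin d) (Fin d) ℝ)
    (M : RankTwo d) : ℂ :=
  Complex.exp (-(Real.pi : ℂ) * (τ.im : ℂ)⁻¹ *
    ((fun j => (M.1 0 j : ℂ) + (M.1 1 j : ℂ) * (τ : ℂ)) ⬝ᵥ
      (X.map Complex.ofReal).mulVec
        (fun j => (M.1 0 j : ℂ) + (M.1 1 j : ℂ) * (starRingEnd ℂ) (τ : ℂ))))

/-- The lattice sum `𝒢(τ, X)` over integral `2 × d` matrices of rank `2`. -/
def latticeSum {d : ℕ} (τ : UpperHalfPlane) (X : Matrix (Fin d) (Fin d) ℝ) : ℂ :=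
  ∑' M : RankTwo d, latticeTerm τ X M

/-- `I(s, X)`, the integral of `E^{SL(2)}_s(τ) 𝒢(τ, X)` over the standard fundamental domain of
`SL(2, ℤ)` with respect to `dτ₁ dτ₂ / τ₂²` (the volume of the upper half plane). -/
def thetaIntegral {d : ℕ} (s : ℂ) (X : Matrix (Fin d) (Fin d) ℝ) : ℂ :=
  ∫ τ in ModularGroup.fd, eisensteinSL2 τ s * latticeSum τ X

/-- The Mellin transform `∫_0^∞ I(0, u G) u^{2s-1} du`. -/
def thetaMellin {d : ℕ} (G : Matrix (Fin d) (Fin d) ℝ) (s : ℂ) : ℂ :=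
  mellin (fun u : ℝ => thetaIntegral 0 (u • G)) (2 * s)

end NonEpstein

end

open scoped MatrixGroups

noncomputable section

namespace NonEpstein

/-! ### Sums over `ℤ^ι` -/

section Lattice

variable {ι : Type*} [Fintype ι]

/-! The function `Φ(u) = I(0, uG)` (`thetaPhi`) is computed in two ways. Since `E_0 = 1`, it is the
integral over the modular domain of the rank-two part of a theta series.

Unfolding gives the first identity. A rank-two integral matrix is uniquely an element of `SL(2, ℤ)`
times a Hermite normal form times the last two rows of a coset representative for `P_{β_2}`. The sum
over `SL(2, ℤ)` opens the fundamental domain to the whole half plane, twice because of `±1`, and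
there each term integrates to `exp(-2πuδ)/(uδ)` with `δ² = det(M G Mᵗ)` (`lintegral_exp_form`,
`hasSum_thetaPhi`). In the Mellin transform the Hermite forms contribute `2 ζ(2s) ζ(2s-1)`, the
cosets contribute the Eisenstein series, and the duplication formula turns the gamma factors into
those of `ξ(2s) ξ(2s-1)` (`mellin_thetaPhi`).

Poisson summation gives the continuation and the second identity. The full theta series in `2d`
variables satisfies `θ_G(u) = u^{-d} θ_{G*}(1/u)`, where `G*` is the dual form (`thetaAll_inv`).
Ranks zero and one have to be removed. Rank one is a sum over cusps which diverges when integrated,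
but the difference of the two sides is integrable and unfolds to elementary powers of `u`
(`integral_cusp_kernel`). Thus `Φ_G(u) = u^{-d} Φ_{G*}(1/u)` up to four powers of `u`
(`thetaPhi_inv_of_pos`). As `Φ` decays exponentially, Riemann's splitting at `u = 1` continues the
Mellin transform to a function `thetaLambda` with possible poles only at `0, 1, d-1, d`, invariant
under `(G, w) ↦ (G*, d - w)`.

Finally, inverse transposition followed by reversal of the coordinates identifies the `β_{d-2}`
series of `G` with the `β_2` series of `G*` (`eisensteinTerm_eq_dual`), so the invariance is the
second equality. The identity theorem spreads both equalities over `ℂ` and makes the continuations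
independent of choices. The same theta method for binary forms continues `E^{SL(2)}_s` and gives its
value at `s = 0`. -/

/-- The coordinates of a point of the lattice `ℤ^ι ⊆ ℝ^ι`. -/
def latticeEquiv (ι : Type*) [Fintype ι] :
    Submodule.span ℤ (Set.range (Pi.basisFun ℝ ι)) ≃ₗ[ℤ] (ι → ℤ) :=
  ((Pi.basisFun ℝ ι).restrictScalars ℤ).equivFun

lemma latticeEquiv_apply_cast (x : Submodule.span ℤ (Set.range (Pi.basisFun ℝ ι))) (i : ι) :
    ((latticeEquiv ι x i : ℤ) : ℝ) = (x : ι → ℝ) i := by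
  have := (Pi.basisFun ℝ ι).restrictScalars_repr_apply ℤ x i
  simpa [latticeEquiv] using this

lemma norm_intCast (m : ι → ℤ) : ‖(fun i => (m i : ℝ))‖ = ‖m‖ := by
  simp only [Pi.norm_def, NNReal.coe_inj]
  congr 1

lemma summable_norm_rpow_int (r : ℝ) (hr : r < -(Fintype.card ι : ℝ)) :
    Summable fun m : ι → ℤ => ‖m‖ ^ r := by
  have hfin : Module.finrank ℤ (Submodule.span ℤ (Set.range (Pi.basisFun ℝ ι))) =
      Fintype.card ι := by
    rw [(latticeEquiv ι).finrank_eq, Module.finrank_fintype_fun_eq_card]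
  have h := ZLattice.summable_norm_rpow (Submodule.span ℤ (Set.range (Pi.basisFun ℝ ι))) r
    (by rw [hfin]; exact hr)
  rw [← (latticeEquiv ι).toEquiv.summable_iff]
  refine h.congr fun x => ?_
  have : ‖x‖ = ‖latticeEquiv ι x‖ := by
    rw [← norm_intCast]
    change ‖(x : ι → ℝ)‖ = _
    congr 1
    funext i
    rw [latticeEquiv_apply_cast x i]
  rw [this]
  rfl

/-- One term of the exponential series bounds the Gaussian by a multiple of `‖m‖ ^ (-2N)`, which is
summable as soon as `2N` exceeds the rank. -/
lemma summable_exp_neg_mul_norm_sq {c : ℝ} (hc : 0 < c) :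
    Summable fun m : ι → ℤ => Real.exp (-c * ‖m‖ ^ 2) := by
  obtain ⟨N, hN⟩ : ∃ N : ℕ, (Fintype.card ι : ℝ) < 2 * N := by
    refine ⟨Fintype.card ι + 1, ?_⟩
    push_cast
    have : (0 : ℝ) ≤ Fintype.card ι := by positivity
    linarith
  have h := (summable_norm_rpow_int (ι := ι) (-(2 * N : ℝ)) (by linarith)).mul_left
    (c⁻¹ ^ N * (N.factorial : ℝ))
  refine Summable.of_norm_bounded_eventually (g := _) h ?_
  filter_upwards [(Set.finite_singleton (0 : ι → ℤ)).compl_mem_cofinite] with m hm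
  have hm0 : 0 < ‖m‖ := norm_pos_iff.2 hm
  rw [Real.norm_eq_abs, Real.abs_exp, neg_mul, Real.exp_neg, Real.rpow_neg hm0.le]
  have hpos : 0 < c * ‖m‖ ^ 2 := by positivity
  have h1 := Real.pow_div_factorial_le_exp (c * ‖m‖ ^ 2) hpos.le N
  have h2 : ‖m‖ ^ (2 * N : ℝ) = (‖m‖ ^ 2) ^ N := by
    rw [← pow_mul, ← Real.rpow_natCast]; norm_num
  rw [h2]
  have h3 : 0 < (c * ‖m‖ ^ 2) ^ N / (N.factorial : ℝ) := by positivity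
  refine (inv_anti₀ h3 h1).trans (le_of_eq ?_)
  rw [mul_pow, inv_pow]
  field_simp

/-- A sum over `ℤ^ι` of translates is summable locally uniformly for a Gaussian. -/
lemma gaussian_translate_le {c : ℝ} (hc : 0 < c) {R : ℝ} {x : ι → ℝ} (hx : ‖x‖ ≤ R) (m : ι → ℤ) :
    Real.exp (-c * ‖x + (fun i => (m i : ℝ))‖ ^ 2) ≤
      Real.exp (c * R ^ 2) * Real.exp (-(c / 2) * ‖m‖ ^ 2) := by
  rw [← Real.exp_add, Real.exp_le_exp]
  have hm : ‖m‖ = ‖(fun i => (m i : ℝ))‖ := (norm_intCast m).symm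
  set v : ι → ℝ := fun i => (m i : ℝ)
  have h1 : ‖v‖ ≤ ‖x + v‖ + R := by
    calc ‖v‖ = ‖(x + v) - x‖ := by simp
      _ ≤ ‖x + v‖ + ‖x‖ := norm_sub_le _ _
      _ ≤ _ := by linarith
  rw [hm]
  have h0 := norm_nonneg v
  have h2 : ‖v‖ ^ 2 ≤ 2 * ‖x + v‖ ^ 2 + 2 * R ^ 2 := by
    nlinarith [sq_nonneg (‖x + v‖ - R), norm_nonneg (x + v)]
  nlinarith

end Lattice

/-! ### Poisson summation -/

section Poisson

open MeasureTheory

variable {ι : Type*} [Fintype ι]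

/-- The box `(0, 1]^ι` is the one over which Fourier coefficients on the torus are integrated; it
differs from the fundamental domain `[0, 1)^ι` by a null set. -/
lemma integral_eq_tsum_unit_box {f : (ι → ℝ) → ℂ} (hf : Integrable f) :
    ∫ x, f x = ∑' m : ι → ℤ, ∫ x in {x : ι → ℝ | ∀ i, x i ∈ Set.Ioc (0 : ℝ) (0 + 1)},
      f (x + fun i => (m i : ℝ)) := by
  have hD := ZSpan.isAddFundamentalDomain' (Pi.basisFun ℝ ι) (volume : Measure (ι → ℝ))
  have hcount : Countable (Submodule.span ℤ (Set.range (Pi.basisFun ℝ ι))).toAddSubgroup :=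
    (latticeEquiv ι).toEquiv.injective.countable
  rw [hD.integral_eq_tsum'' f hf]
  refine ((latticeEquiv ι).symm.toEquiv.tsum_eq (fun g : Submodule.span ℤ
    (Set.range (Pi.basisFun ℝ ι)) => ∫ x in ZSpan.fundamentalDomain (Pi.basisFun ℝ ι),
      f ((g : ι → ℝ) + x))).symm.trans ?_
  congr 1
  funext m
  have hbox : (ZSpan.fundamentalDomain (Pi.basisFun ℝ ι) : Set (ι → ℝ)) =ᵐ[volume]
      {x : ι → ℝ | ∀ i, x i ∈ Set.Ioc (0 : ℝ) (0 + 1)} := by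
    rw [ZSpan.fundamentalDomain_pi_basisFun]
    have h1 := Measure.univ_pi_Ico_ae_eq_Icc (μ := fun _ : ι => (volume : Measure ℝ))
      (f := fun _ => 0) (g := fun _ => 1)
    have h2 := Measure.univ_pi_Ioc_ae_eq_Icc (μ := fun _ : ι => (volume : Measure ℝ))
      (f := fun _ => 0) (g := fun _ => 1)
    have h3 : {x : ι → ℝ | ∀ i, x i ∈ Set.Ioc (0 : ℝ) (0 + 1)} =
        Set.pi Set.univ fun _ => Set.Ioc (0 : ℝ) 1 := by
      ext x; simp [Set.mem_pi]
    rw [h3]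
    exact h1.trans h2.symm
  rw [setIntegral_congr_set hbox]
  congr 1
  funext x
  congr 1
  rw [add_comm]
  congr 1
  funext i
  rw [← latticeEquiv_apply_cast]
  simp

/-- The character `x ↦ exp (-2πi n·x)`. -/
def latticeChar (n : ι → ℤ) (x : ι → ℝ) : ℂ :=
  Complex.exp (-2 * Real.pi * Complex.I * (∑ i, n i * x i : ℂ))

lemma latticeChar_eq_mFourier (n : ι → ℤ) (x : ι → ℝ) :
    UnitAddTorus.mFourier (-n) (fun i => (x i : UnitAddCircle)) = latticeChar n x := by
  simp only [UnitAddTorus.mFourier, ContinuousMap.coe_mk, fourier_coe_apply, latticeChar]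
  rw [← Complex.exp_sum]
  congr 1
  rw [Finset.mul_sum]
  refine Finset.sum_congr rfl fun i _ => ?_
  simp only [Pi.neg_apply]
  push_cast
  ring

lemma norm_latticeChar (n : ι → ℤ) (x : ι → ℝ) : ‖latticeChar n x‖ = 1 := by
  have : latticeChar n x = Complex.exp (((-2 * Real.pi * ∑ i, n i * x i : ℝ) : ℂ) * Complex.I) := by
    rw [latticeChar]; congr 1; push_cast; ring
  rw [this, Complex.norm_exp_ofReal_mul_I]

lemma continuous_latticeChar (n : ι → ℤ) : Continuous (latticeChar n) := by
  unfold latticeChar; fun_prop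

lemma latticeChar_add_int (n : ι → ℤ) (x : ι → ℝ) (m : ι → ℤ) :
    latticeChar n (x + fun i => (m i : ℝ)) = latticeChar n x := by
  have : -2 * Real.pi * Complex.I * (∑ i, n i * ((x + fun i => (m i : ℝ)) i : ℝ) : ℂ) =
      -2 * Real.pi * Complex.I * (∑ i, n i * x i : ℂ) +
        ((-∑ i, n i * m i : ℤ) : ℂ) * (2 * Real.pi * Complex.I) := by
    simp only [Pi.add_apply]
    push_cast
    rw [Finset.sum_congr rfl fun i _ => mul_add _ _ _, Finset.sum_add_distrib]
    ring
  rw [latticeChar, this, Complex.exp_add, Complex.exp_int_mul_two_pi_mul_I, mul_one, latticeChar]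

/-- **Poisson summation** on `ℝ^ι`. -/
theorem hasSum_poisson {f : (ι → ℝ) → ℂ} (hc : Continuous f) (hi : Integrable f)
    (hb : ∀ R : ℝ, ∃ u : (ι → ℤ) → ℝ, Summable u ∧
      ∀ m : ι → ℤ, ∀ x : ι → ℝ, ‖x‖ ≤ R → ‖f (x + fun i => (m i : ℝ))‖ ≤ u m)
    (hs : Summable fun n : ι → ℤ => ∫ x, latticeChar n x * f x) :
    HasSum (fun n : ι → ℤ => ∫ x, latticeChar n x * f x) (∑' m : ι → ℤ, f fun i => (m i : ℝ)) := by
  -- The periodisation of `f` is continuous by the Weierstrass test on balls, so it descends to the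
  -- torus. Unfolding the box shows that its Fourier coefficients are the given integrals, and the
  -- Fourier series is then evaluated at `0`.
  let P : (ι → ℝ) → ℂ := fun x => ∑' m : ι → ℤ, f (x + fun i => (m i : ℝ))
  have hP : Continuous P := by
    rw [continuous_iff_continuousAt]
    intro x
    obtain ⟨u, hu, hfu⟩ := hb (‖x‖ + 1)
    have : ContinuousOn P (Metric.ball 0 (‖x‖ + 1)) := by
      refine continuousOn_tsum (fun m => ?_) hu fun m y hy => hfu m y ?_
      · exact (hc.comp (continuous_id.add continuous_const)).continuousOn
      · exact (by simpa using hy : ‖y‖ < ‖x‖ + 1).le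
    exact this.continuousAt (Metric.isOpen_ball.mem_nhds (by simp))
  let π : (ι → ℝ) → UnitAddTorus ι := fun x i => (x i : UnitAddCircle)
  have hπ : IsOpenQuotientMap π := by
    refine IsOpenQuotientMap.piMap fun i => ?_
    exact ⟨QuotientAddGroup.mk_surjective, continuous_quotient_mk',
      QuotientAddGroup.isOpenMap_coe⟩
  have hper : ∀ x y, π x = π y → P x = P y := by
    intro x y hxy
    have : ∀ i, ∃ k : ℤ, (k : ℝ) = y i - x i := by
      intro i
      have := congrFun hxy i
      rw [QuotientAddGroup.eq] at this
      obtain ⟨k, hk⟩ := AddSubgroup.mem_zmultiples_iff.1 this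
      exact ⟨k, by simpa [neg_add_eq_sub] using hk⟩
    choose k hk using this
    have hy : y = x + fun i => (k i : ℝ) := by funext i; simp [hk]
    simp only [P]
    rw [← (Equiv.addLeft k).tsum_eq]
    congr 1
    funext m
    rw [hy, add_assoc]
    congr 2
    funext i
    simp
  let F : C(UnitAddTorus ι, ℂ) := ⟨Function.extend π P 0, by
    rw [hπ.isQuotientMap.continuous_iff]
    convert hP using 1
    funext x
    exact Function.FactorsThrough.extend_apply (fun a b h => hper a b h) _ x⟩
  have hFπ : ∀ x, F (π x) = P x := fun x =>
    Function.FactorsThrough.extend_apply (fun a b h => hper a b h) _ x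
  have hcoef : ∀ n, UnitAddTorus.mFourierCoeff F n = ∫ x, latticeChar n x * f x := by
    intro n
    rw [UnitAddTorus.mFourierCoeff_eq_integral F n 0]
    have hgi : Integrable fun x => latticeChar n x * f x := by
      refine hi.bdd_mul (c := 1) (continuous_latticeChar n).aestronglyMeasurable ?_
      exact Filter.Eventually.of_forall fun x => (norm_latticeChar n x).le
    rw [integral_eq_tsum_unit_box hgi]
    have e1 : ∀ x : ι → ℝ, UnitAddTorus.mFourier (-n) (fun i => (x i : UnitAddCircle)) •
        F (fun i => (x i : UnitAddCircle)) =
        ∑' m : ι → ℤ, latticeChar n (x + fun i => (m i : ℝ)) * f (x + fun i => (m i : ℝ)) := by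
      intro x
      rw [latticeChar_eq_mFourier]
      change _ • F (π x) = _
      rw [hFπ, smul_eq_mul]
      simp only [latticeChar_add_int, P, tsum_mul_left]
    simp_rw [e1]
    simp only [Pi.zero_apply]
    obtain ⟨u, hu, hfu⟩ := hb 1
    have hbox : volume {x : ι → ℝ | ∀ i, x i ∈ Set.Ioc (0 : ℝ) (0 + 1)} < ⊤ := by
      have : {x : ι → ℝ | ∀ i, x i ∈ Set.Ioc (0 : ℝ) (0 + 1)} ⊆ Metric.closedBall 0 1 := by
        intro x hx
        rw [mem_closedBall_zero_iff, pi_norm_le_iff_of_nonneg zero_le_one]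
        intro i
        have := hx i
        rw [Real.norm_eq_abs, abs_le]
        constructor <;> linarith [this.1, this.2]
      exact (measure_mono this).trans_lt measure_closedBall_lt_top
    have hmeas : MeasurableSet {x : ι → ℝ | ∀ i, x i ∈ Set.Ioc (0 : ℝ) (0 + 1)} := by
      have : {x : ι → ℝ | ∀ i, x i ∈ Set.Ioc (0 : ℝ) (0 + 1)} =
        Set.pi Set.univ fun _ => Set.Ioc (0 : ℝ) (0 + 1) := by ext x; simp [Set.mem_pi]
      rw [this]
      exact MeasurableSet.univ_pi fun _ => measurableSet_Ioc
    have hle : ∀ m : ι → ℤ, ∀ x ∈ {x : ι → ℝ | ∀ i, x i ∈ Set.Ioc (0 : ℝ) (0 + 1)},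
        ‖latticeChar n (x + fun i => (m i : ℝ)) * f (x + fun i => (m i : ℝ))‖ ≤ u m := by
      intro m x hx
      rw [norm_mul, norm_latticeChar, one_mul]
      refine hfu m x ?_
      rw [pi_norm_le_iff_of_nonneg zero_le_one]
      intro i
      have := hx i
      rw [Real.norm_eq_abs, abs_le]
      constructor <;> linarith [this.1, this.2]
    have hint : ∀ m : ι → ℤ, IntegrableOn (fun x : ι → ℝ =>
        latticeChar n (x + fun i => (m i : ℝ)) * f (x + fun i => (m i : ℝ)))
        {x : ι → ℝ | ∀ i, x i ∈ Set.Ioc (0 : ℝ) (0 + 1)} := fun m =>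
      (hgi.comp_add_right (fun i => (m i : ℝ))).integrableOn
    refine (integral_tsum_of_summable_integral_norm hint ?_).symm
    refine Summable.of_nonneg_of_le (fun m => integral_nonneg fun _ => norm_nonneg _)
      (fun m => ?_) (hu.mul_right
        (volume.real {x : ι → ℝ | ∀ i, x i ∈ Set.Ioc (0 : ℝ) (0 + 1)}))
    have := norm_setIntegral_le_of_norm_le_const (f := fun x : ι → ℝ =>
      ‖latticeChar n (x + fun i => (m i : ℝ)) * f (x + fun i => (m i : ℝ))‖) hbox
      (C := u m) (fun x hx => by rw [norm_norm]; exact hle m x hx)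
    refine (le_abs_self _).trans this
  have hsum : Summable (UnitAddTorus.mFourierCoeff F) := by
    rw [show UnitAddTorus.mFourierCoeff F = _ from funext hcoef]; exact hs
  have := UnitAddTorus.hasSum_mFourier_series_apply_of_summable hsum (π 0)
  rw [hFπ] at this
  simp only [P, zero_add] at this
  convert! this using 1
  funext n
  rw [hcoef]
  have := latticeChar_eq_mFourier (-n) 0
  rw [neg_neg] at this
  have h2 : UnitAddTorus.mFourier n (π 0) = 1 := by
    change UnitAddTorus.mFourier n (fun i => ((0 : ι → ℝ) i : UnitAddCircle)) = 1
    rw [this]; simp [latticeChar]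
  rw [h2]; simp

end Poisson

/-! ### Theta series of unimodular positive definite forms -/

section Gram

open MeasureTheory Matrix

variable {ι : Type*} [Fintype ι]

/-- The quadratic form of a matrix at an integral vector. -/
def intForm (X : Matrix ι ι ℝ) (m : ι → ℤ) : ℝ :=
  (fun i => (m i : ℝ)) ⬝ᵥ X *ᵥ fun i => (m i : ℝ)

/-- The theta series `∑ exp (-π t X[m])`. -/
def gaussSum (X : Matrix ι ι ℝ) (t : ℝ) : ℝ :=
  ∑' m : ι → ℤ, Real.exp (-Real.pi * t * intForm X m)

lemma dotProduct_transpose_mul_mulVec (B : Matrix ι ι ℝ) (x : ι → ℝ) :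
    x ⬝ᵥ (Bᵀ * B) *ᵥ x = ∑ i, (B *ᵥ x) i ^ 2 := by
  rw [← Matrix.mulVec_mulVec, Matrix.dotProduct_mulVec, Matrix.vecMul_transpose]
  simp [dotProduct, sq]

variable [DecidableEq ι]

/-- Gram matrices of unimodular lattices. -/
def IsGram (X : Matrix ι ι ℝ) : Prop := ∃ B : Matrix ι ι ℝ, B.det = 1 ∧ X = Bᵀ * B

lemma IsGram.inv {X : Matrix ι ι ℝ} (hX : IsGram X) : IsGram X⁻¹ := by
  obtain ⟨B, hB, rfl⟩ := hX
  refine ⟨(B⁻¹)ᵀ, ?_, ?_⟩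
  · rw [Matrix.det_transpose, Matrix.det_nonsing_inv, hB]; simp
  · rw [Matrix.mul_inv_rev, Matrix.transpose_transpose, Matrix.transpose_nonsing_inv]

lemma IsGram.det {X : Matrix ι ι ℝ} (hX : IsGram X) : X.det = 1 := by
  obtain ⟨B, hB, rfl⟩ := hX
  simp [hB]

lemma IsGram.transpose {X : Matrix ι ι ℝ} (hX : IsGram X) : Xᵀ = X := by
  obtain ⟨B, hB, rfl⟩ := hX
  simp

/-- For `X = BᵀB` the form is the squared Euclidean norm of `Bx`, which dominates the sup norm, and
`‖x‖ ≤ ‖B⁻¹‖ ‖Bx‖`. The `+ 1` keeps the constant positive when `ι` is empty. -/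
lemma IsGram.exists_lower_bound {X : Matrix ι ι ℝ} (hX : IsGram X) :
    ∃ c : ℝ, 0 < c ∧ ∀ x : ι → ℝ, c * ‖x‖ ^ 2 ≤ x ⬝ᵥ X *ᵥ x := by
  obtain ⟨B, hB, rfl⟩ := hX
  let T := LinearMap.toContinuousLinearMap (Matrix.mulVecLin B⁻¹)
  refine ⟨((‖T‖ + 1) ^ 2)⁻¹, by positivity, fun x => ?_⟩
  rw [dotProduct_transpose_mul_mulVec]
  have h1 : T (B *ᵥ x) = x := by
    change B⁻¹ *ᵥ (B *ᵥ x) = x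
    rw [Matrix.mulVec_mulVec, Matrix.nonsing_inv_mul _ (by rw [hB]; exact isUnit_one),
      Matrix.one_mulVec]
  have h2 : ‖x‖ ≤ (‖T‖ + 1) * ‖B *ᵥ x‖ := by
    calc ‖x‖ = ‖T (B *ᵥ x)‖ := by rw [h1]
      _ ≤ ‖T‖ * ‖B *ᵥ x‖ := T.le_opNorm _
      _ ≤ _ := by gcongr; linarith
  have h3 : ‖B *ᵥ x‖ ^ 2 ≤ ∑ i, (B *ᵥ x) i ^ 2 := by
    have : ‖B *ᵥ x‖ ≤ Real.sqrt (∑ i, (B *ᵥ x) i ^ 2) := by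
      rw [pi_norm_le_iff_of_nonneg (Real.sqrt_nonneg _)]
      intro i
      rw [Real.norm_eq_abs]
      refine Real.abs_le_sqrt ?_
      exact Finset.single_le_sum (f := fun i => (B *ᵥ x) i ^ 2) (fun j _ => sq_nonneg _)
        (Finset.mem_univ i)
    calc ‖B *ᵥ x‖ ^ 2 ≤ Real.sqrt (∑ i, (B *ᵥ x) i ^ 2) ^ 2 := by gcongr
      _ = _ := Real.sq_sqrt (Finset.sum_nonneg fun _ _ => sq_nonneg _)
  rw [inv_mul_le_iff₀ (by positivity)]
  calc ‖x‖ ^ 2 ≤ ((‖T‖ + 1) * ‖B *ᵥ x‖) ^ 2 := by gcongr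
    _ = (‖T‖ + 1) ^ 2 * ‖B *ᵥ x‖ ^ 2 := by ring
    _ ≤ _ := by gcongr

lemma IsGram.exists_intForm_lower_bound {X : Matrix ι ι ℝ} (hX : IsGram X) :
    ∃ c : ℝ, 0 < c ∧ ∀ m : ι → ℤ, c * ‖m‖ ^ 2 ≤ intForm X m := by
  obtain ⟨c, hc, h⟩ := hX.exists_lower_bound
  refine ⟨c, hc, fun m => ?_⟩
  have := h (fun i => (m i : ℝ))
  rwa [norm_intCast] at this

lemma IsGram.intForm_pos {X : Matrix ι ι ℝ} (hX : IsGram X) {m : ι → ℤ} (hm : m ≠ 0) :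
    0 < intForm X m := by
  obtain ⟨c, hc, h⟩ := hX.exists_intForm_lower_bound
  have : 0 < ‖m‖ := norm_pos_iff.2 hm
  exact lt_of_lt_of_le (by positivity) (h m)

lemma IsGram.intForm_nonneg {X : Matrix ι ι ℝ} (hX : IsGram X) (m : ι → ℤ) :
    0 ≤ intForm X m := by
  obtain ⟨c, hc, h⟩ := hX.exists_intForm_lower_bound
  exact le_trans (by positivity) (h m)

lemma IsGram.summable_exp {X : Matrix ι ι ℝ} (hX : IsGram X) {t : ℝ} (ht : 0 < t) :
    Summable fun m : ι → ℤ => Real.exp (-Real.pi * t * intForm X m) := by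
  obtain ⟨c, hc, h⟩ := hX.exists_intForm_lower_bound
  refine Summable.of_nonneg_of_le (fun _ => (Real.exp_pos _).le) (fun m => ?_)
    (summable_exp_neg_mul_norm_sq (ι := ι) (c := Real.pi * t * c) (by positivity))
  rw [Real.exp_le_exp]
  have := mul_le_mul_of_nonneg_left (h m) (by positivity : 0 ≤ Real.pi * t)
  linarith

/-- The substitution `y = Ax` turns the frequency `n` into `w = A⁻ᵀ n` and leaves the standard
Gaussian, which is its own Fourier transform. -/
lemma integral_latticeChar_mul_gaussian {A : Matrix ι ι ℝ} (hA : A.det ≠ 0) (n : ι → ℤ) :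
    ∫ x : ι → ℝ, latticeChar n x * Complex.exp (-(Real.pi : ℂ) * ∑ i, ((A *ᵥ x) i : ℂ) ^ 2) =
      ((|A.det|⁻¹ : ℝ) : ℂ) * Real.exp (-Real.pi * ∑ i, ((A⁻¹)ᵀ *ᵥ fun i => (n i : ℝ)) i ^ 2) := by
  set w : ι → ℝ := (A⁻¹)ᵀ *ᵥ fun i => (n i : ℝ) with hw
  let g : (ι → ℝ) → ℂ := fun y =>
    Complex.exp (-(Real.pi : ℂ) * ∑ i, (y i : ℂ) ^ 2 + ∑ i, (-2 * Real.pi * Complex.I * w i) * y i)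
  have e1 : ∀ x : ι → ℝ, latticeChar n x *
      Complex.exp (-(Real.pi : ℂ) * ∑ i, ((A *ᵥ x) i : ℂ) ^ 2) = g (Matrix.toLin' A x) := by
    intro x
    simp only [g, latticeChar, Matrix.toLin'_apply]
    rw [← Complex.exp_add, add_comm]
    congr 2
    have h : ∑ i, w i * (A *ᵥ x) i = ∑ i, (n i : ℝ) * x i := by
      change w ⬝ᵥ A *ᵥ x = (fun i => (n i : ℝ)) ⬝ᵥ x
      rw [hw, Matrix.mulVec_transpose, ← Matrix.dotProduct_mulVec, Matrix.mulVec_mulVec,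
        Matrix.nonsing_inv_mul _ (isUnit_iff_ne_zero.2 hA), Matrix.one_mulVec]
    have h' : (∑ i, (w i : ℂ) * ((A *ᵥ x) i : ℂ)) = ∑ i, (n i : ℂ) * x i := by
      exact_mod_cast congrArg (Complex.ofReal) h
    rw [← h', Finset.mul_sum]
    refine Finset.sum_congr rfl fun i _ => by ring
  simp_rw [e1]
  have hdet : LinearMap.det (Matrix.toLin' A) ≠ 0 := by rwa [LinearMap.det_toLin']
  have hcv : ∫ x : ι → ℝ, g (Matrix.toLin' A x) = (|A.det|⁻¹ : ℝ) • ∫ y, g y := by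
    have hmap := Real.map_linearMap_volume_pi_eq_smul_volume_pi hdet
    have hemb : MeasurableEmbedding (Matrix.toLin' A : (ι → ℝ) → (ι → ℝ)) := by
      have := (LinearEquiv.ofIsUnitDet (f := Matrix.toLin' A)
        (v := Pi.basisFun ℝ ι) (v' := Pi.basisFun ℝ ι) (by
          rw [← LinearMap.det_toLin (Pi.basisFun ℝ ι), Matrix.toLin_toMatrix]
          exact isUnit_iff_ne_zero.2 hdet)).toContinuousLinearEquiv.toHomeomorph.measurableEmbedding
      exact this
    rw [← hemb.integral_map g, hmap, integral_smul_measure, LinearMap.det_toLin',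
      ENNReal.toReal_ofReal (abs_nonneg _), abs_inv]
  rw [hcv]
  have := GaussianFourier.integral_cexp_neg_mul_sum_add (ι := ι) (b := (Real.pi : ℂ))
    (by simpa using Real.pi_pos) (fun i => -2 * Real.pi * Complex.I * w i)
  simp only [g]
  rw [this, div_self (by exact_mod_cast Real.pi_ne_zero), Complex.one_cpow, one_mul]
  rw [Complex.real_smul]
  congr 1
  push_cast
  congr 1
  rw [Finset.sum_div, Finset.mul_sum]
  refine Finset.sum_congr rfl fun i _ => ?_
  have hpi : (Real.pi : ℂ) ≠ 0 := by exact_mod_cast Real.pi_ne_zero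
  rw [mul_pow, mul_pow, mul_pow, Complex.I_sq]
  field_simp
  ring

/-- The inversion formula for theta series of unimodular forms. -/
theorem IsGram.gaussSum_inv {X : Matrix ι ι ℝ} (hX : IsGram X) {t : ℝ} (ht : 0 < t) :
    gaussSum X t = t ^ (-(Fintype.card ι : ℝ) / 2) * gaussSum X⁻¹ t⁻¹ := by
  obtain ⟨c, hc, hlow⟩ := hX.exists_lower_bound
  have hXi := hX.inv
  obtain ⟨B, hB, hXB⟩ := id hX
  -- Now `tX = AᵀA`. Poisson summation for `exp(-π|Ax|²)` produces the dual form `t⁻¹X⁻¹` and the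
  -- factor `|det A|⁻¹ = t^(-card ι / 2)`.
  set A : Matrix ι ι ℝ := Real.sqrt t • B with hAdef
  have hsq : Real.sqrt t ^ 2 = t := Real.sq_sqrt ht.le
  have hs0 : 0 < Real.sqrt t := Real.sqrt_pos.2 ht
  have hdet : A.det = Real.sqrt t ^ Fintype.card ι := by
    rw [hAdef, Matrix.det_smul, hB, mul_one]
  have hdetpos : 0 < A.det := by rw [hdet]; positivity
  have hA : A.det ≠ 0 := hdetpos.ne'
  have hform : ∀ x : ι → ℝ, ∑ i, (A *ᵥ x) i ^ 2 = t * (x ⬝ᵥ X *ᵥ x) := by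
    intro x
    rw [hXB, dotProduct_transpose_mul_mulVec, Finset.mul_sum]
    refine Finset.sum_congr rfl fun i _ => ?_
    rw [hAdef, Matrix.smul_mulVec, Pi.smul_apply, smul_eq_mul, mul_pow, hsq]
  have hAinv : A⁻¹ = (Real.sqrt t)⁻¹ • B⁻¹ := by
    refine Matrix.inv_eq_right_inv ?_
    rw [hAdef, Matrix.smul_mul, Matrix.mul_smul, smul_smul, mul_inv_cancel₀ hs0.ne',
      Matrix.mul_nonsing_inv _ (by rw [hB]; exact isUnit_one), one_smul]
  have hform' : ∀ n : ι → ℤ, ∑ i, ((A⁻¹)ᵀ *ᵥ fun i => (n i : ℝ)) i ^ 2 =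
      t⁻¹ * intForm X⁻¹ n := by
    intro n
    have h1 : X⁻¹ = ((B⁻¹)ᵀ)ᵀ * (B⁻¹)ᵀ := by
      rw [hXB, Matrix.mul_inv_rev, Matrix.transpose_transpose, Matrix.transpose_nonsing_inv]
    rw [intForm, h1, dotProduct_transpose_mul_mulVec, Finset.mul_sum]
    refine Finset.sum_congr rfl fun i _ => ?_
    rw [hAinv, Matrix.transpose_smul, Matrix.smul_mulVec, Pi.smul_apply, smul_eq_mul, mul_pow,
      inv_pow, hsq]
  let f : (ι → ℝ) → ℂ := fun x =>
    Complex.exp (-(Real.pi : ℂ) * ∑ i, ((A *ᵥ x) i : ℂ) ^ 2)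
  have hf : ∀ x, f x = (Real.exp (-Real.pi * (t * (x ⬝ᵥ X *ᵥ x))) : ℂ) := by
    intro x
    rw [← hform]; simp [f]
  have hfn : ∀ x, ‖f x‖ ≤ Real.exp (-(Real.pi * t * c) * ‖x‖ ^ 2) := by
    intro x
    rw [hf, Complex.norm_real, Real.norm_eq_abs, Real.abs_exp, Real.exp_le_exp]
    have := mul_le_mul_of_nonneg_left (hlow x) (by positivity : 0 ≤ Real.pi * t)
    linarith
  have hcont : Continuous f := by
    have : Continuous fun x : ι → ℝ => A *ᵥ x := Continuous.matrix_mulVec continuous_const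
      continuous_id
    have h2 : ∀ i, Continuous fun x : ι → ℝ => (A *ᵥ x) i := fun i =>
      (continuous_apply i).comp this
    simp only [f]
    fun_prop
  have hcp : 0 < Real.pi * t * c := by positivity
  have hint : Integrable f := by
    -- The integrable majorant is a Euclidean Gaussian. Its constant comes from `∑ x_i² ≤ card ι *
    -- ‖x‖²`, with `+ 1` against division by zero.
    have hK : (0 : ℝ) < Real.pi * t * c / (Fintype.card ι + 1) := by positivity
    have h1 := (GaussianFourier.integrable_cexp_neg_mul_sum_add (ι := ι)
      (b := ((Real.pi * t * c / (Fintype.card ι + 1) : ℝ) : ℂ))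
      (by rw [Complex.ofReal_re]; exact hK) (fun _ => 0)).norm
    refine h1.mono' hcont.aestronglyMeasurable (Filter.Eventually.of_forall fun x => ?_)
    refine (hfn x).trans ?_
    have e : -(((Real.pi * t * c / (Fintype.card ι + 1) : ℝ) : ℂ)) * ∑ i, (x i : ℂ) ^ 2 +
        ∑ i, 0 * (x i : ℂ) =
        ((-(Real.pi * t * c / (Fintype.card ι + 1)) * ∑ i, x i ^ 2 : ℝ) : ℂ) := by
      push_cast; simp
    rw [e, ← Complex.ofReal_exp, Complex.norm_real, Real.norm_eq_abs, Real.abs_exp,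
      Real.exp_le_exp]
    have h3 : ∑ i, x i ^ 2 ≤ (Fintype.card ι + 1) * ‖x‖ ^ 2 := by
      calc ∑ i, x i ^ 2 ≤ ∑ _i : ι, ‖x‖ ^ 2 := by
            refine Finset.sum_le_sum fun i _ => ?_
            rw [← sq_abs]
            have := norm_le_pi_norm x i
            rw [Real.norm_eq_abs] at this
            gcongr
        _ = Fintype.card ι * ‖x‖ ^ 2 := by simp
        _ ≤ _ := by nlinarith [sq_nonneg ‖x‖]
    have h4 := mul_le_mul_of_nonneg_left h3 hK.le
    have h5 : Real.pi * t * c / (Fintype.card ι + 1) * ((Fintype.card ι + 1) * ‖x‖ ^ 2) =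
        Real.pi * t * c * ‖x‖ ^ 2 := by
      field_simp
    linarith
  have key := hasSum_poisson hcont hint (fun R => ?_) ?_
  · have h1 := key.tsum_eq
    simp only [f] at h1
    simp_rw [integral_latticeChar_mul_gaussian hA, hform'] at h1
    have h2 : ∀ m : ι → ℤ, Complex.exp (-(Real.pi : ℂ) *
        ∑ i, ((A *ᵥ fun i => (m i : ℝ)) i : ℂ) ^ 2) =
        (Real.exp (-Real.pi * t * intForm X m) : ℂ) := by
      intro m
      have := hf (fun i => (m i : ℝ))
      simp only [f] at this
      rw [this, intForm, mul_assoc]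
    simp_rw [h2] at h1
    rw [tsum_mul_left] at h1
    have h3 : |A.det|⁻¹ * ∑' n : ι → ℤ, Real.exp (-Real.pi * (t⁻¹ * intForm X⁻¹ n)) =
        ∑' m : ι → ℤ, Real.exp (-Real.pi * t * intForm X m) := by
      exact_mod_cast h1
    rw [gaussSum, ← h3, gaussSum]
    congr 1
    · rw [abs_of_pos hdetpos, hdet, neg_div, Real.rpow_neg ht.le, Real.sqrt_eq_rpow,
        ← Real.rpow_natCast, ← Real.rpow_mul ht.le, one_div_mul_eq_div]
    · simp_rw [mul_assoc]
  · refine ⟨fun m => Real.exp (Real.pi * t * c * R ^ 2) *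
      Real.exp (-(Real.pi * t * c / 2) * ‖m‖ ^ 2), ?_, fun m x hx => ?_⟩
    · exact (summable_exp_neg_mul_norm_sq (by positivity)).mul_left _
    · exact (hfn _).trans (gaussian_translate_le hcp hx m)
  · simp only [f]
    simp_rw [integral_latticeChar_mul_gaussian hA, hform']
    refine Summable.mul_left _ ?_
    have := hXi.summable_exp (inv_pos.2 ht)
    exact_mod_cast (this.congr fun m => by rw [mul_assoc])

end Gram

/-! ### Cosets of maximal parabolic subgroups and integral matrices -/

section Cosets

open Matrix

variable {d i : ℕ}

/-- The last `i` indices in `Fin d`. -/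
def botIdx (hi : i ≤ d) (j : Fin i) : Fin d := ⟨d - i + j, by omega⟩

lemma botIdx_injective (hi : i ≤ d) : Function.Injective (botIdx hi) := by
  intro a b h
  simp only [botIdx, Fin.mk.injEq] at h
  exact Fin.ext (by omega)

lemma exists_botIdx (hi : i ≤ d) {k : Fin d} (hk : d ≤ (k : ℕ) + i) : ∃ j, botIdx hi j = k :=
  ⟨⟨k - (d - i), by omega⟩, Fin.ext (by simp only [botIdx]; omega)⟩

lemma le_botIdx (hi : i ≤ d) (j : Fin i) : d ≤ (botIdx hi j : ℕ) + i := by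
  simp only [botIdx]; omega

/-- The last `i` rows of a matrix. -/
def botRows {R : Type*} (hi : i ≤ d) (A : Matrix (Fin d) (Fin d) R) : Matrix (Fin i) (Fin d) R :=
  A.submatrix (botIdx hi) id

lemma botRows_mul {R : Type*} [CommRing R] (hi : i ≤ d) (A B : Matrix (Fin d) (Fin d) R) :
    botRows hi (A * B) = botRows hi A * B := by
  ext j k; simp [botRows, Matrix.mul_apply]

/-- The bottom right block of a matrix. -/
def botBlock {R : Type*} (hi : i ≤ d) (A : Matrix (Fin d) (Fin d) R) : Matrix (Fin i) (Fin i) R :=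
  A.submatrix (botIdx hi) (botIdx hi)

/-- The matrix `A` is block upper triangular with diagonal blocks of sizes `d - i`, `i`. -/
def BlockUpper {R : Type*} [Zero R] (i : ℕ) (A : Matrix (Fin d) (Fin d) R) : Prop :=
  ∀ j k : Fin d, d ≤ (j : ℕ) + i → (k : ℕ) + i < d → A j k = 0

lemma sum_botIdx {R : Type*} [AddCommMonoid R] (hi : i ≤ d) (f : Fin d → R)
    (hf : ∀ k : Fin d, (k : ℕ) + i < d → f k = 0) : ∑ k, f k = ∑ j, f (botIdx hi j) := by
  rw [← Finset.sum_image (s := Finset.univ) (g := botIdx hi) (f := f)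
    fun a _ b _ h => botIdx_injective hi h]
  refine (Finset.sum_subset (Finset.subset_univ _) fun k _ hk => hf k ?_).symm
  by_contra h
  exact hk (Finset.mem_image.2 (by
    obtain ⟨j, hj⟩ := exists_botIdx hi (not_lt.1 h)
    exact ⟨j, Finset.mem_univ _, hj⟩))

/-- The last rows of `A` vanish to the left of the corner block, so only the last rows of `B`
contribute. A change of coset representative therefore acts on the last rows through `botBlock`. -/
lemma BlockUpper.botRows_mul {R : Type*} [CommRing R] (hi : i ≤ d)
    {A : Matrix (Fin d) (Fin d) R} (hA : BlockUpper i A) (B : Matrix (Fin d) (Fin d) R) :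
    botRows hi (A * B) = botBlock hi A * botRows hi B := by
  ext j k
  simp only [botRows, botBlock, Matrix.mul_apply, Matrix.submatrix_apply, id]
  exact sum_botIdx hi _ fun l hl => by rw [hA _ _ (le_botIdx hi j) hl, zero_mul]

lemma BlockUpper.botBlock_mul {R : Type*} [CommRing R] (hi : i ≤ d)
    {A : Matrix (Fin d) (Fin d) R} (hA : BlockUpper i A) (B : Matrix (Fin d) (Fin d) R) :
    botBlock hi (A * B) = botBlock hi A * botBlock hi B := by
  ext j k
  simp only [botBlock, Matrix.mul_apply, Matrix.submatrix_apply]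
  exact sum_botIdx hi _ fun l hl => by rw [hA _ _ (le_botIdx hi j) hl, zero_mul]

lemma botBlock_one {R : Type*} [CommRing R] (hi : i ≤ d) :
    botBlock hi (1 : Matrix (Fin d) (Fin d) R) = 1 := by
  rw [botBlock, Matrix.submatrix_one _ (botIdx_injective hi)]

/-- The corner block of `p⁻¹` inverts that of `p` over `ℤ`, so the determinant is `±1`. Hence Gram
determinants do not depend on the coset representative. -/
lemma sq_det_botBlock (hi : i ≤ d) {p : SL(d, ℤ)} (hp : p ∈ parabolic d i) :
    (botBlock hi (p : Matrix (Fin d) (Fin d) ℤ)).det ^ 2 = 1 := by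
  have h1 : BlockUpper i (p : Matrix (Fin d) (Fin d) ℤ) := hp
  have h := h1.botBlock_mul hi ((p⁻¹ : SL(d, ℤ)) : Matrix (Fin d) (Fin d) ℤ)
  rw [← Matrix.SpecialLinearGroup.coe_mul, mul_inv_cancel, Matrix.SpecialLinearGroup.coe_one,
    botBlock_one] at h
  have h2 := congrArg Matrix.det h
  rw [Matrix.det_one, Matrix.det_mul] at h2
  rcases Int.isUnit_iff.1 (IsUnit.of_mul_eq_one _ h2.symm) with h3 | h3 <;> rw [h3] <;> norm_num

/-- After right multiplication by `γ⁻¹` the right side is `K` times the last rows of the identity,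
which vanish left of the corner. The corresponding columns of `γ' * γ⁻¹` are thus killed by the
nonsingular `K'`. -/
lemma mul_inv_mem_parabolic (hi : i ≤ d) {γ γ' : SL(d, ℤ)} {K K' : Matrix (Fin i) (Fin i) ℤ}
    (hK' : K'.det ≠ 0)
    (h : K' * botRows hi (γ' : Matrix (Fin d) (Fin d) ℤ) =
      K * botRows hi (γ : Matrix (Fin d) (Fin d) ℤ)) :
    γ' * γ⁻¹ ∈ parabolic d i := by
  have h1 := congrArg (· * ((γ⁻¹ : SL(d, ℤ)) : Matrix (Fin d) (Fin d) ℤ)) h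
  simp only [Matrix.mul_assoc, ← botRows_mul, ← Matrix.SpecialLinearGroup.coe_mul,
    mul_inv_cancel] at h1
  intro j k hj hk
  obtain ⟨j', rfl⟩ := exists_botIdx hi hj
  have h2 : K' *ᵥ (fun l => ((γ' * γ⁻¹ : SL(d, ℤ)) : Matrix (Fin d) (Fin d) ℤ) (botIdx hi l) k) =
      0 := by
    funext l
    have := congrFun (congrFun h1 l) k
    rw [Matrix.mul_apply] at this
    rw [Matrix.mulVec, dotProduct]
    refine this.trans ?_
    rw [Matrix.mul_apply]
    refine Finset.sum_eq_zero fun r _ => ?_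
    have : botIdx hi r ≠ k := by
      intro hr; have := le_botIdx hi r; rw [hr] at this; omega
    simp [botRows, this]
  exact congrFun (Matrix.eq_zero_of_mulVec_eq_zero hK' h2) j'

/-- The last `i` rows of the chosen representative of a coset. -/
def cosetRows (hi : i ≤ d) (c : Cosets d i) : Matrix (Fin i) (Fin d) ℤ :=
  botRows hi (c.out : Matrix (Fin d) (Fin d) ℤ)

/-- This is the uniqueness of the primitive factor: a common product puts both representatives in
one coset, after which the inverse of the representative recovers `h`. -/
lemma cosetRows_mul_injective (hi : i ≤ d) {c c' : Cosets d i} {h h' : Matrix (Fin i) (Fin i) ℤ}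
    (hh : h.det ≠ 0) (heq : h * cosetRows hi c = h' * cosetRows hi c') : c = c' ∧ h = h' := by
  have hc : c = c' := by
    rw [← Quotient.out_eq c, ← Quotient.out_eq c']
    symm
    exact Quotient.sound (QuotientGroup.rightRel_apply.2 (mul_inv_mem_parabolic hi hh heq))
  subst hc
  refine ⟨rfl, ?_⟩
  have h1 := congrArg (· * ((c.out⁻¹ : SL(d, ℤ)) : Matrix (Fin d) (Fin d) ℤ)) heq
  simp only [Matrix.mul_assoc, cosetRows, ← botRows_mul, ← Matrix.SpecialLinearGroup.coe_mul,
    mul_inv_cancel] at h1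
  ext a b
  have := congrFun (congrFun h1 a) (botIdx hi b)
  simpa [Matrix.mul_apply, botRows, Matrix.one_apply, (botIdx_injective hi).eq_iff] using this

lemma exists_out_eq_mul (γ : SL(d, ℤ)) : ∃ p ∈ parabolic d i,
    (Quotient.mk (QuotientGroup.rightRel (parabolic d i)) γ).out = p * γ := by
  have h2 := QuotientGroup.rightRel_apply.1 (Quotient.exact
    (Quotient.out_eq (Quotient.mk (QuotientGroup.rightRel (parabolic d i)) γ)).symm)
  exact ⟨_, h2, by group⟩

/-- Smith normal form provides a basis of `ℤ^d` in which the row lattice is spanned by multiples of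
at most `i` basis vectors. With these placed among the last `i` rows, the basis is the matrix
sought, up to the sign of its determinant. -/
lemma exists_eq_mul_botRows (hi : i < d) (M : Matrix (Fin i) (Fin d) ℤ) :
    ∃ (γ : SL(d, ℤ)) (h : Matrix (Fin i) (Fin i) ℤ),
      M = h * botRows hi.le (γ : Matrix (Fin d) (Fin d) ℤ) := by
  let m : Fin i → Fin d → ℤ := fun r k => M r k
  set N : Submodule ℤ (Fin d → ℤ) := Submodule.span ℤ (Set.range m) with hN
  obtain ⟨n, S⟩ := Submodule.smithNormalForm (Pi.basisFun ℤ (Fin d)) N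
  have hn : n ≤ i := by
    have h1 : Module.finrank ℤ N = n := by
      rw [Module.finrank_eq_card_basis S.bN, Fintype.card_fin]
    have h2 := finrank_range_le_card (R := ℤ) m
    rw [Fintype.card_fin] at h2
    rw [← h1]; exact h2
  let g : Fin n → Fin d := fun j => botIdx hi.le (Fin.castLE hn j)
  have hg : Function.Injective g := (botIdx_injective hi.le).comp (Fin.castLE_injective hn)
  -- The permutation `e` brings the basis vectors selected by the Smith form to positions among the
  -- last `i`.
  obtain ⟨e, he⟩ : ∃ e : Fin d ≃ Fin d, ∀ j, e (g j) = S.f j := by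
    rcases isEmpty_or_nonempty (Fin n) with hne | hne
    · exact ⟨Equiv.refl _, fun j => (hne.false j).elim⟩
    obtain ⟨e, he⟩ := Set.MapsTo.exists_equiv_extend_of_card_eq (α := Fin d) (β := Fin d)
      (s := Set.range g) (t := Finset.univ) (f := fun k => S.f (Function.invFun g k)) (by simp)
      (fun k _ => by simp) (by
        rintro _ ⟨a, rfl⟩ _ ⟨b, rfl⟩ hab
        simp only [Function.leftInverse_invFun hg _] at hab
        rw [S.f.injective hab])
    refine ⟨e.trans (Equiv.subtypeUnivEquiv (by simp)), fun j => ?_⟩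
    have := he (g j) ⟨j, rfl⟩
    simp only [Function.leftInverse_invFun hg _] at this
    simpa using this
  let a : Fin d → Fin d → ℤ := fun k => S.bM (e k)
  let A : Matrix (Fin d) (Fin d) ℤ := Matrix.of a
  have hAdet : IsUnit A.det := by
    have := (Pi.basisFun ℤ (Fin d)).isUnit_det (S.bM.reindex e.symm)
    rw [Module.Basis.det_apply] at this
    convert! this using 1
    rw [← Matrix.det_transpose]
    congr 1
    ext k l
    simp [A, a, Module.Basis.toMatrix_apply]
  have hrows : ∀ r : Fin i, ∃ v : Fin i → ℤ, m r = ∑ l, v l • a (botIdx hi.le l) := by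
    intro r
    have hr : m r ∈ N := Submodule.subset_span ⟨r, rfl⟩
    set q := S.bN.repr ⟨m r, hr⟩ with hq
    have h2 : m r = ∑ j, (q j * S.a j) • a (g j) := by
      have := congrArg (Subtype.val) (S.bN.sum_repr ⟨m r, hr⟩)
      rw [AddSubmonoidClass.coe_finsetSum] at this
      refine this.symm.trans (Finset.sum_congr rfl fun j _ => ?_)
      rw [Submodule.coe_smul, S.snf j, smul_smul]
      simp only [a, he]
      rfl
    clear_value q
    refine ⟨fun l => ∑ j : Fin n, if Fin.castLE hn j = l then q j * S.a j else 0, ?_⟩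
    rw [h2]
    simp_rw [Finset.sum_smul]
    rw [Finset.sum_comm]
    refine Finset.sum_congr rfl fun j _ => ?_
    rw [Finset.sum_eq_single (Fin.castLE hn j)]
    · simp [g]
    · intro b _ hb; simp [hb.symm]
    · simp
  choose v hv using hrows
  have key : ∀ A' : Matrix (Fin d) (Fin d) ℤ, A'.det = 1 →
      (∀ l k, A' (botIdx hi.le l) k = a (botIdx hi.le l) k) →
      ∃ (γ : SL(d, ℤ)) (h : Matrix (Fin i) (Fin i) ℤ),
      M = h * botRows hi.le (γ : Matrix (Fin d) (Fin d) ℤ) := by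
    intro A' hA' hl
    refine ⟨⟨A', hA'⟩, Matrix.of v, ?_⟩
    ext r k
    have := congrFun (hv r) k
    rw [Matrix.mul_apply]
    refine this.trans ?_
    simp [botRows, hl]
  rcases Int.isUnit_iff.1 hAdet with h1 | h1
  · exact key A h1 fun _ _ => rfl
  -- If the determinant is `-1`, the first row changes sign. Because `i < d`, it is not one of the
  -- last `i` rows.
  · let k0 : Fin d := ⟨0, by omega⟩
    refine key (A.updateRow k0 ((-1 : ℤ) • a k0)) ?_ fun l k => ?_
    · rw [Matrix.det_updateRow_smul, show A.updateRow k0 (a k0) = A from A.updateRow_eq_self k0, h1]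
      norm_num
    · rw [Matrix.updateRow_ne]
      · rfl
      intro h
      have := congrArg Fin.val h
      simp only [botIdx, k0] at this
      omega

lemma exists_eq_mul_cosetRows (hi : i < d) (M : Matrix (Fin i) (Fin d) ℤ) :
    ∃ (c : Cosets d i) (h : Matrix (Fin i) (Fin i) ℤ), M = h * cosetRows hi.le c := by
  obtain ⟨γ, h, rfl⟩ := exists_eq_mul_botRows hi M
  obtain ⟨p, hp, hpγ⟩ := exists_out_eq_mul (i := i) γ
  have hγ : γ = p⁻¹ * (Quotient.mk (QuotientGroup.rightRel (parabolic d i)) γ).out := by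
    rw [hpγ]; group
  have hp' : BlockUpper i ((p⁻¹ : SL(d, ℤ)) : Matrix (Fin d) (Fin d) ℤ) :=
    (parabolic d i).inv_mem hp
  refine ⟨Quotient.mk _ γ, h * botBlock hi.le ((p⁻¹ : SL(d, ℤ)) : Matrix (Fin d) (Fin d) ℤ), ?_⟩
  conv_lhs => rw [hγ, Matrix.SpecialLinearGroup.coe_mul, hp'.botRows_mul hi.le]
  rw [cosetRows, Matrix.mul_assoc]

end Cosets

/-! ### Integral matrices with two rows: factorisation in ranks two and one. -/

section RankTwo

open Matrix

variable {d : ℕ}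

lemma rank_eq_two_iff_linearIndependent (M : Matrix (Fin 2) (Fin d) ℝ) :
    M.rank = 2 ↔ LinearIndependent ℝ M.row := by
  rw [linearIndependent_iff_card_eq_finrank_span, Matrix.rank_eq_finrank_span_row,
    Fintype.card_fin, Set.finrank, eq_comm]

/-- If all minors vanish, each column `j` supplies the relation with coefficients `M 1 j`, `-M 0 j`
between the rows; independence makes all of them trivial, so the matrix is zero, which is absurd. -/
lemma rank_eq_two_iff_exists_minor (M : Matrix (Fin 2) (Fin d) ℤ) :
    (M.map (Int.cast : ℤ → ℝ)).rank = 2 ↔ ∃ j k, M 0 j * M 1 k - M 0 k * M 1 j ≠ 0 := by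
  rw [rank_eq_two_iff_linearIndependent, Fintype.linearIndependent_iff]
  have hsum : ∀ g : Fin 2 → ℝ, ∑ i, g i • (M.map (Int.cast : ℤ → ℝ)).row i = 0 ↔
      ∀ k, g 0 * M 0 k + g 1 * M 1 k = 0 := by
    intro g
    rw [funext_iff]
    simp [Fin.sum_univ_two, Matrix.row]
  simp_rw [hsum]
  constructor
  · intro h
    by_contra! hcon
    have h0 : ∀ j, M 1 j = 0 ∧ M 0 j = 0 := by
      intro j
      have := h ![(M 1 j : ℝ), -(M 0 j : ℝ)] (fun k => by
        have e : ((M 0 j * M 1 k - M 0 k * M 1 j : ℤ) : ℝ) = 0 := by exact_mod_cast hcon j k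
        push_cast at e
        simp only [Matrix.cons_val_zero, Matrix.cons_val_one]
        linarith)
      have h1 := this 0
      have h2 := this 1
      simp only [Matrix.cons_val_zero, Matrix.cons_val_one, neg_eq_zero] at h1 h2
      exact ⟨by exact_mod_cast h1, by exact_mod_cast h2⟩
    have := h (fun _ => 1) (fun k => by simp [h0 k]) 0
    norm_num at this
  · rintro ⟨j, k, hjk⟩ g hg
    have hjk' : (M 0 j * M 1 k - M 0 k * M 1 j : ℝ) ≠ 0 := by exact_mod_cast hjk
    have h1 := hg j
    have h2 := hg k
    have e0 : g 0 * (M 0 j * M 1 k - M 0 k * M 1 j : ℝ) = 0 := by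
      linear_combination (M 1 k : ℝ) * h1 - (M 1 j : ℝ) * h2
    have e1 : g 1 * (M 0 j * M 1 k - M 0 k * M 1 j : ℝ) = 0 := by
      linear_combination (M 0 j : ℝ) * h2 - (M 0 k : ℝ) * h1
    intro i
    fin_cases i
    · exact (mul_eq_zero.1 e0).resolve_right hjk'
    · exact (mul_eq_zero.1 e1).resolve_right hjk'

/-- The last rows of a unimodular matrix are independent, so the product has rank two precisely when
`h` is invertible over `ℝ`. -/
lemma rank_mul_cosetRows (hd : 2 < d) (h : Matrix (Fin 2) (Fin 2) ℤ) (c : Cosets d 2) :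
    ((h * cosetRows hd.le c).map (Int.cast : ℤ → ℝ)).rank = 2 ↔ h.det ≠ 0 := by
  have hB : LinearIndependent ℝ ((cosetRows hd.le c).map (Int.cast : ℤ → ℝ)).row := by
    have h1 : IsUnit ((c.out : Matrix (Fin d) (Fin d) ℤ).map (Int.cast : ℤ → ℝ)) := by
      rw [Matrix.isUnit_iff_isUnit_det]
      have := (Int.castRingHom ℝ).map_det (c.out : Matrix (Fin d) (Fin d) ℤ)
      have h2 : (c.out : Matrix (Fin d) (Fin d) ℤ).det = 1 := c.out.2
      rw [h2, map_one] at this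
      change IsUnit (((Int.castRingHom ℝ).mapMatrix (c.out : Matrix (Fin d) (Fin d) ℤ)).det)
      rw [← this]; exact isUnit_one
    have h3 := Matrix.linearIndependent_rows_of_isUnit h1
    exact h3.comp _ (botIdx_injective hd.le)
  have hmap : (h * cosetRows hd.le c).map (Int.cast : ℤ → ℝ) =
      h.map (Int.cast : ℤ → ℝ) * (cosetRows hd.le c).map (Int.cast : ℤ → ℝ) :=
    Matrix.map_mul (f := Int.castRingHom ℝ)
  have hdet : (h.map (Int.cast : ℤ → ℝ)).det = (h.det : ℝ) :=
    ((Int.castRingHom ℝ).map_det h).symm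
  constructor
  · intro hr h0
    rw [rank_eq_two_iff_linearIndependent] at hr
    obtain ⟨v, hv0, hv⟩ := Matrix.exists_vecMul_eq_zero_iff.2 (hdet.trans (by rw [h0]; simp))
    refine hv0 (funext fun i => ?_)
    have h4 : v ᵥ* ((h * cosetRows hd.le c).map (Int.cast : ℤ → ℝ)) = 0 := by
      rw [hmap, ← Matrix.vecMul_vecMul, hv, Matrix.zero_vecMul]
    rw [Fintype.linearIndependent_iff] at hr
    refine hr v ?_ i
    rw [Matrix.vecMul_eq_sum] at h4
    exact h4
  · intro h0
    rw [hmap, Matrix.rank_mul_eq_right_of_isUnit_det _ _ (by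
      rw [hdet]; exact isUnit_iff_ne_zero.2 (by exact_mod_cast h0)),
      rank_eq_two_iff_linearIndependent]
    exact hB

/-- Integral matrices of rank two are uniquely products of a nonsingular matrix and a primitive
matrix from a system of coset representatives. -/
def rankTwoEquiv (hd : 2 < d) :
    {h : Matrix (Fin 2) (Fin 2) ℤ // h.det ≠ 0} × Cosets d 2 ≃ RankTwo d :=
  Equiv.ofBijective (fun x => ⟨x.1.1 * cosetRows hd.le x.2, (rank_mul_cosetRows hd _ _).2 x.1.2⟩) <|
    by
    constructor
    · rintro ⟨⟨h, hh⟩, c⟩ ⟨⟨h', hh'⟩, c'⟩ heq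
      have := cosetRows_mul_injective hd.le hh (congrArg Subtype.val heq)
      exact Prod.ext (Subtype.ext this.2) this.1
    · rintro ⟨M, hM⟩
      obtain ⟨c, h, rfl⟩ := exists_eq_mul_cosetRows hd M
      exact ⟨⟨⟨h, (rank_mul_cosetRows hd h c).1 hM⟩, c⟩, rfl⟩

/-- The indices of nonsingular integral `2 × 2` matrices in Hermite normal form. -/
abbrev HermiteIndex : Type := ℕ+ × (Σ n : ℕ+, Fin n) × ℤˣ

/-- The Hermite normal form with a given index. -/
def hermiteMatrix (x : HermiteIndex) : Matrix (Fin 2) (Fin 2) ℤ :=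
  !![((x.1 : ℕ) : ℤ), ((x.2.1.2 : ℕ) : ℤ); 0, (x.2.2 : ℤ) * ((x.2.1.1 : ℕ) : ℤ)]

lemma det_hermiteMatrix (x : HermiteIndex) :
    (hermiteMatrix x).det = (x.2.2 : ℤ) * (((x.1 : ℕ) : ℤ) * ((x.2.1.1 : ℕ) : ℤ)) := by
  rw [hermiteMatrix, Matrix.det_fin_two_of]; ring

lemma det_hermiteMatrix_ne_zero (x : HermiteIndex) : (hermiteMatrix x).det ≠ 0 := by
  rw [det_hermiteMatrix]
  have h1 : ((x.1 : ℕ) : ℤ) ≠ 0 := by exact_mod_cast x.1.ne_zero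
  have h2 : ((x.2.1.1 : ℕ) : ℤ) ≠ 0 := by exact_mod_cast x.2.1.1.ne_zero
  exact mul_ne_zero x.2.2.ne_zero (mul_ne_zero h1 h2)

/-- The first column and positivity force `γ` to be unipotent, and then the two residues in `[0, n)`
differ by a multiple of `n`. The unit in the index is needed because `SL(2, ℤ)` preserves the sign
of the determinant. -/
lemma hermiteMatrix_injective {γ : SL(2, ℤ)} {x y : HermiteIndex}
    (h : (γ : Matrix (Fin 2) (Fin 2) ℤ) * hermiteMatrix x = hermiteMatrix y) :
    γ = 1 ∧ x = y := by
  obtain ⟨a, ⟨n, b⟩, ε⟩ := x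
  obtain ⟨a', ⟨n', b'⟩, ε'⟩ := y
  have e00 := congrFun (congrFun h 0) 0
  have e01 := congrFun (congrFun h 0) 1
  have e10 := congrFun (congrFun h 1) 0
  have e11 := congrFun (congrFun h 1) 1
  simp only [hermiteMatrix, Matrix.mul_apply, Fin.sum_univ_two, Matrix.of_apply, Matrix.cons_val',
    Matrix.cons_val_zero, Matrix.cons_val_one, Matrix.cons_val_fin_one, mul_zero, add_zero]
    at e00 e01 e10 e11
  have hdet : γ 0 0 * γ 1 1 - γ 0 1 * γ 1 0 = 1 := by
    rw [← Matrix.det_fin_two]; exact γ.2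
  have ha : (0 : ℤ) < (a : ℕ) := by exact_mod_cast a.pos
  have ha' : (0 : ℤ) < (a' : ℕ) := by exact_mod_cast a'.pos
  have hn : (0 : ℤ) < (n : ℕ) := by exact_mod_cast n.pos
  have hn' : (0 : ℤ) < (n' : ℕ) := by exact_mod_cast n'.pos
  have hb : ((b : ℕ) : ℤ) < (n : ℕ) := by exact_mod_cast b.2
  have hb' : ((b' : ℕ) : ℤ) < (n' : ℕ) := by exact_mod_cast b'.2
  have hc : γ 1 0 = 0 := by
    rcases mul_eq_zero.1 e10 with h | h
    · exact h
    · omega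
  rw [hc] at hdet e11
  rw [mul_zero, sub_zero] at hdet
  have h00 : γ 0 0 = 1 := by
    rcases Int.isUnit_iff.1 (IsUnit.of_mul_eq_one _ hdet) with h | h
    · exact h
    · rw [h] at e00; omega
  have h11 : γ 1 1 = 1 := by rw [h00] at hdet; omega
  rw [h00, one_mul] at e00
  rw [h11] at e11
  rw [h00] at e01
  have haa : a = a' := by exact_mod_cast e00
  have hε : ε = ε' ∧ n = n' := by
    have e : (ε : ℤ) * (n : ℕ) = (ε' : ℤ) * (n' : ℕ) := by linarith
    rcases Int.units_eq_one_or ε with h1 | h1 <;> rcases Int.units_eq_one_or ε' with h2 | h2 <;>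
      simp only [h1, h2, Units.val_one, Units.val_neg] at e ⊢
    · exact ⟨trivial, by exact_mod_cast (by linarith : ((n : ℕ) : ℤ) = (n' : ℕ))⟩
    · omega
    · omega
    · exact ⟨trivial, by exact_mod_cast (by linarith : ((n : ℕ) : ℤ) = (n' : ℕ))⟩
  obtain ⟨rfl, rfl⟩ := hε
  subst haa
  have hk : γ 0 1 = 0 := by
    have hbn : (0 : ℤ) ≤ (b : ℕ) := by positivity
    have hbn' : (0 : ℤ) ≤ (b' : ℕ) := by positivity
    have h1 : γ 0 1 * (ε : ℤ) = 0 := by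
      have e : (γ 0 1 * (ε : ℤ)) * (n : ℕ) = (b' : ℕ) - (b : ℕ) := by linarith
      by_contra h0
      rcases lt_or_gt_of_ne h0 with h2 | h2
      · nlinarith
      · nlinarith
    exact (mul_eq_zero.1 h1).resolve_right ε.ne_zero
  rw [hk] at e01
  have hbb : b = b' := by
    apply Fin.ext
    have : ((b : ℕ) : ℤ) = (b' : ℕ) := by linarith
    exact_mod_cast this
  subst hbb
  refine ⟨?_, rfl⟩
  ext i j
  fin_cases i <;> fin_cases j <;> simp [h00, h11, hk, hc]

/-- The first column of `h` is its gcd times a primitive vector, which is completed to `γ`; a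
unipotent matrix then reduces the upper right entry modulo the lower right one. -/
lemma exists_eq_mul_hermiteMatrix {h : Matrix (Fin 2) (Fin 2) ℤ} (hh : h.det ≠ 0) :
    ∃ (γ : SL(2, ℤ)) (x : HermiteIndex),
      (γ : Matrix (Fin 2) (Fin 2) ℤ) * hermiteMatrix x = h := by
  set g : ℕ := Int.gcd (h 0 0) (h 1 0) with hg
  have hdet := Matrix.det_fin_two h
  have hgpos : 0 < g := by
    rw [hg, Int.gcd_pos_iff]
    by_contra hcon
    push Not at hcon
    apply hh; rw [hdet, hcon.1, hcon.2]; ring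
  obtain ⟨u, v, huv, h0, h1⟩ := Int.exists_gcd_one (m := h 0 0) (n := h 1 0) hgpos
  rw [← hg] at h0 h1
  clear_value g
  have hco : IsCoprime u v := Int.isCoprime_iff_gcd_eq_one.2 huv
  obtain ⟨γ, hγ0, hγ1⟩ := hco.exists_SL2_col 0
  have hγdet : γ 0 0 * γ 1 1 - γ 0 1 * γ 1 0 = 1 := by
    rw [← Matrix.det_fin_two]; exact γ.2
  rw [← hγ0] at h0
  rw [← hγ1] at h1
  -- The matrix `γ⁻¹ * h` is upper triangular, with first row `g, y` and second row `0, δ`.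
  set y : ℤ := γ 1 1 * h 0 1 - γ 0 1 * h 1 1 with hy
  set δ : ℤ := -γ 1 0 * h 0 1 + γ 0 0 * h 1 1 with hδ
  have hδ0 : δ ≠ 0 := by
    intro h2
    apply hh
    linear_combination hdet + h 1 1 * h0 - h 0 1 * h1 + (g : ℤ) * h2 - (g : ℤ) * hδ
  obtain ⟨ε, hε⟩ : ∃ ε : ℤˣ, (ε : ℤ) * δ.natAbs = δ := by
    rcases le_total 0 δ with h2 | h2
    · exact ⟨1, by simp [abs_of_nonneg h2]⟩
    · exact ⟨-1, by simp [abs_of_nonpos h2]⟩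
  have hr0 := Int.emod_nonneg y hδ0
  have hr1 := Int.emod_lt_abs y hδ0
  have hdiv := Int.mul_ediv_add_emod y δ
  let n : ℕ+ := ⟨δ.natAbs, Int.natAbs_pos.2 hδ0⟩
  let b : Fin n := ⟨(y % δ).toNat, by
    change _ < δ.natAbs
    rw [Int.abs_eq_natAbs] at hr1
    omega⟩
  have hb : ((b : ℕ) : ℤ) = y % δ := Int.toNat_of_nonneg hr0
  have hTdet : (!![1, y / δ; 0, 1] : Matrix (Fin 2) (Fin 2) ℤ).det = 1 := by
    rw [Matrix.det_fin_two_of]; ring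
  let T : SL(2, ℤ) := ⟨!![1, y / δ; 0, 1], hTdet⟩
  have hT : (T : Matrix (Fin 2) (Fin 2) ℤ) = !![1, y / δ; 0, 1] := rfl
  refine ⟨γ * T, ⟨⟨g, hgpos⟩, ⟨n, b⟩, ε⟩, ?_⟩
  have hH : hermiteMatrix ⟨⟨g, hgpos⟩, ⟨n, b⟩, ε⟩ = !![(g : ℤ), y % δ; 0, δ] := by
    rw [hermiteMatrix]
    change !![(g : ℤ), ((b : ℕ) : ℤ); 0, (ε : ℤ) * (δ.natAbs : ℤ)] = _
    rw [hb, hε]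
  rw [hH, Matrix.SpecialLinearGroup.coe_mul, hT]
  ext i j
  fin_cases i <;> fin_cases j <;> simp [Matrix.mul_apply, Fin.sum_univ_two]
  · exact h0.symm
  · have e : y % δ = y - δ * (y / δ) := by linarith
    rw [e]
    linear_combination h 0 1 * hγdet + γ 0 0 * hy + γ 0 1 * hδ
  · exact h1.symm
  · have e : y % δ = y - δ * (y / δ) := by linarith
    rw [e]
    linear_combination h 1 1 * hγdet + γ 1 0 * hy + γ 1 1 * hδ

/-- Nonsingular integral matrices are uniquely products of an element of `SL(2, ℤ)` and a matrix in
Hermite normal form. -/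
def hermiteEquiv : SL(2, ℤ) × HermiteIndex ≃ {h : Matrix (Fin 2) (Fin 2) ℤ // h.det ≠ 0} :=
  Equiv.ofBijective (fun x => ⟨(x.1 : Matrix (Fin 2) (Fin 2) ℤ) * hermiteMatrix x.2, by
    rw [Matrix.det_mul, x.1.2, one_mul]; exact det_hermiteMatrix_ne_zero x.2⟩) <| by
  constructor
  · rintro ⟨γ, x⟩ ⟨γ', x'⟩ heq
    have h1 : (γ : Matrix (Fin 2) (Fin 2) ℤ) * hermiteMatrix x =
      (γ' : Matrix (Fin 2) (Fin 2) ℤ) * hermiteMatrix x' := congrArg Subtype.val heq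
    have h2 : ((γ'⁻¹ * γ : SL(2, ℤ)) : Matrix (Fin 2) (Fin 2) ℤ) * hermiteMatrix x =
        hermiteMatrix x' := by
      rw [Matrix.SpecialLinearGroup.coe_mul, Matrix.mul_assoc, h1, ← Matrix.mul_assoc,
        ← Matrix.SpecialLinearGroup.coe_mul, inv_mul_cancel, Matrix.SpecialLinearGroup.coe_one,
        Matrix.one_mul]
    obtain ⟨h3, h4⟩ := hermiteMatrix_injective h2
    exact Prod.ext (inv_mul_eq_one.1 h3).symm h4
  · rintro ⟨h, hh⟩
    obtain ⟨γ, x, hx⟩ := exists_eq_mul_hermiteMatrix hh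
    exact ⟨(γ, x), Subtype.ext hx⟩

/-- Integral `2 × d` matrices of rank one. -/
abbrev RankOne (d : ℕ) : Type :=
  {M : Matrix (Fin 2) (Fin d) ℤ // (M.map (Int.cast : ℤ → ℝ)).rank ≠ 2 ∧ M ≠ 0}

/-- The primitive vector attached to a cusp: the bottom row of a representative, reversed. -/
def cuspVec (c : Cosets 2 1) : Fin 2 → ℤ := ![c.out 1 1, c.out 1 0]

lemma cosetRows_two_one (c : Cosets 2 1) (k : Fin 2) :
    cosetRows one_le_two c 0 k = c.out 1 k := rfl

/-- This is `cosetRows_mul_injective` for `d = 2` and `i = 1`, with the two coordinates exchanged.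
-/
lemma smul_cuspVec_injective {c c' : Cosets 2 1} {a a' : ℤ} (ha : a ≠ 0)
    (h : ∀ r, cuspVec c r * a = cuspVec c' r * a') : c = c' ∧ a = a' := by
  have := cosetRows_mul_injective (i := 1) (d := 2) one_le_two (c := c) (c' := c')
    (h := !![a]) (h' := !![a']) (by simpa using ha) (by
      ext r k
      have h0 := h 0
      have h1 := h 1
      simp only [cuspVec, Matrix.cons_val_zero, Matrix.cons_val_one] at h0 h1
      fin_cases r
      fin_cases k <;> simp [Matrix.mul_apply, cosetRows_two_one] <;> linarith)
  refine ⟨this.1, ?_⟩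
  simpa using congrFun (congrFun this.2 0) 0

lemma exists_eq_smul_cuspVec (v : Fin 2 → ℤ) : ∃ (c : Cosets 2 1) (a : ℤ),
    ∀ r, v r = cuspVec c r * a := by
  obtain ⟨c, h, hh⟩ := exists_eq_mul_cosetRows (i := 1) (d := 2) one_lt_two !![v 1, v 0]
  refine ⟨c, h 0 0, fun r => ?_⟩
  have h0 := congrFun (congrFun hh 0) 0
  have h1 := congrFun (congrFun hh 0) 1
  simp [Matrix.mul_apply, cosetRows_two_one] at h0 h1
  fin_cases r <;> simp [cuspVec, h0, h1, mul_comm]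

lemma cuspVec_det (c : Cosets 2 1) : c.out 0 0 * cuspVec c 0 - c.out 0 1 * cuspVec c 1 = 1 := by
  simp only [cuspVec, Matrix.cons_val_zero, Matrix.cons_val_one]
  rw [← Matrix.det_fin_two]; exact c.out.2

/-- Integral matrices of rank one are uniquely products of a primitive column, up to sign, and a
nonzero row. -/
def rankOneEquiv (d : ℕ) : Cosets 2 1 × {m : Fin d → ℤ // m ≠ 0} ≃ RankOne d :=
  Equiv.ofBijective (fun x => ⟨Matrix.of fun r k => cuspVec x.1 r * x.2.1 k, by
    constructor
    · rw [Ne, rank_eq_two_iff_exists_minor]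
      rintro ⟨j, k, hjk⟩
      exact hjk (by simp only [Matrix.of_apply]; ring)
    · intro h
      apply x.2.2
      funext k
      have h0 := congrFun (congrFun h 0) k
      have h1 := congrFun (congrFun h 1) k
      simp only [Matrix.of_apply, Matrix.zero_apply] at h0 h1
      rw [Pi.zero_apply]
      linear_combination (-x.2.1 k) * cuspVec_det x.1 + x.1.out 0 0 * h0 - x.1.out 0 1 * h1⟩) <| by
  constructor
  · rintro ⟨c, m, hm⟩ ⟨c', m', hm'⟩ heq
    have h1 : ∀ r k, cuspVec c r * m k = cuspVec c' r * m' k := fun r k =>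
      congrFun (congrFun (congrArg Subtype.val heq) r) k
    obtain ⟨k, hk⟩ := Function.ne_iff.1 hm
    have hc := (smul_cuspVec_injective hk fun r => h1 r k).1
    subst hc
    have : m = m' := by
      funext k
      -- A nonzero multiplier is required for `smul_cuspVec_injective`, so a vanishing `m k` is
      -- treated from the side of `m'`.
      by_cases hk : m k = 0
      · by_contra hne
        rw [hk] at hne
        exact hne (smul_cuspVec_injective (Ne.symm hne) fun r => (h1 r k).symm.trans (by
          rw [hk])).2.symm
      · exact (smul_cuspVec_injective hk fun r => h1 r k).2
    subst this
    rfl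
  · rintro ⟨M, hM, hM0⟩
    rw [Ne, rank_eq_two_iff_exists_minor] at hM
    push Not at hM
    obtain ⟨j, hj⟩ : ∃ j, M 0 j ≠ 0 ∨ M 1 j ≠ 0 := by
      by_contra! hcon
      apply hM0
      ext r k
      fin_cases r
      · exact (hcon k).1
      · exact (hcon k).2
    obtain ⟨c, a, hca⟩ := exists_eq_smul_cuspVec (fun r => M r j)
    have ha : a ≠ 0 := by
      rintro rfl
      have h0 := hca 0
      have h1 := hca 1
      simp only [mul_zero] at h0 h1
      exact hj.elim (fun h => h h0) (fun h => h h1)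
    -- Every column is proportional to column `j`, because all minors vanish.
    have hcross : ∀ k, cuspVec c 0 * M 1 k = cuspVec c 1 * M 0 k := by
      intro k
      have h2 := hM j k
      have h0 := hca 0
      have h1 := hca 1
      refine mul_left_cancel₀ ha ?_
      linear_combination h2 - M 1 k * h0 + M 0 k * h1
    have hdet := cuspVec_det c
    -- By the determinant condition, the functional `v ↦ c.out 0 0 * v 0 - c.out 0 1 * v 1` is `1`
    -- on `cuspVec c`. Applied to the columns of `M` it recovers the row factor.
    have hMm : ∀ r k, cuspVec c r * (c.out 0 0 * M 0 k - c.out 0 1 * M 1 k) = M r k := by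
      intro r k
      have := hcross k
      fin_cases r
      · change cuspVec c 0 * (c.out 0 0 * M 0 k - c.out 0 1 * M 1 k) = M 0 k
        linear_combination M 0 k * hdet - c.out 0 1 * this
      · change cuspVec c 1 * (c.out 0 0 * M 0 k - c.out 0 1 * M 1 k) = M 1 k
        linear_combination M 1 k * hdet - c.out 0 0 * this
    refine ⟨⟨c, ⟨fun k => c.out 0 0 * M 0 k - c.out 0 1 * M 1 k, ?_⟩⟩, ?_⟩
    · intro h
      apply hM0
      ext r k
      rw [← hMm r k, show c.out 0 0 * M 0 k - c.out 0 1 * M 1 k = 0 from congrFun h k, mul_zero]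
      rfl
    · apply Subtype.ext
      ext r k
      exact hMm r k

end RankTwo

/-! ### Integration on the upper half plane and unfolding -/

section Unfolding

open MeasureTheory UpperHalfPlane ModularGroup
open scoped ENNReal

instance countable_SL (d : ℕ) : Countable SL(d, ℤ) :=
  Function.Injective.countable (f := fun (γ : SL(d, ℤ)) (i j : Fin d) => γ i j) fun a b h => by
    ext i j; exact congrFun (congrFun h i) j

instance countable_cosets (d i : ℕ) : Countable (Cosets d i) :=
  inferInstanceAs (Countable (Quotient _))

lemma lintegral_upperHalfPlane {g : ℝ → ℝ → ℝ≥0∞} (hg : Measurable (Function.uncurry g)) :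
    ∫⁻ τ : ℍ, g τ.re τ.im =
      ∫⁻ y in Set.Ioi (0 : ℝ), (∫⁻ x, g x y) * ENNReal.ofReal (1 / y ^ 2) := by
  have hmeas : Measurable fun z : ℍ => (((1 / NNReal.mk z.im z.im_pos.le : NNReal) ^ 2 : NNReal) : ℝ≥0∞) := by
    refine measurable_coe_nnreal_ennreal.comp (Measurable.pow_const ?_ 2)
    refine measurable_const.div ?_
    exact Measurable.subtype_mk (Complex.measurable_im.comp measurable_coe)
  have hre : Measurable fun z : ℍ => z.re := Complex.measurable_re.comp measurable_coe
  have him : Measurable fun z : ℍ => z.im := Complex.measurable_im.comp measurable_coe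
  have hgm : Measurable fun z : ℍ => g z.re z.im := hg.comp (hre.prodMk him)
  have hF : Measurable fun p : ℝ × ℝ => g p.1 p.2 * ENNReal.ofReal (1 / p.2 ^ 2) :=
    hg.mul (by fun_prop)
  rw [volume_def, lintegral_withDensity_eq_lintegral_mul _ hmeas hgm]
  have e1 : ∀ z : ℍ, ((fun z : ℍ => (((1 / NNReal.mk z.im z.im_pos.le : NNReal) ^ 2 : NNReal) : ℝ≥0∞)) *
      fun z : ℍ => g z.re z.im) z =
      (fun w : ℂ => g w.re w.im * ENNReal.ofReal (1 / w.im ^ 2)) (z : ℂ) := by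
    intro z
    simp only [Pi.mul_apply, coe_re, coe_im]
    rw [mul_comm]
    congr 1
    rw [ENNReal.ofReal, ENNReal.coe_inj]
    ext
    rw [Real.coe_toNNReal _ (by positivity)]
    simp
  simp_rw [e1]
  have h2 : ∫⁻ z : ℍ, (fun w : ℂ => g w.re w.im * ENNReal.ofReal (1 / w.im ^ 2)) (z : ℂ)
      ∂(volume.comap UpperHalfPlane.coe) = ∫⁻ w in Set.range UpperHalfPlane.coe,
        g w.re w.im * ENNReal.ofReal (1 / w.im ^ 2) := by
    rw [← measurableEmbedding_coe.map_comap, measurableEmbedding_coe.lintegral_map]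
  rw [h2]
  have hrange : Set.range UpperHalfPlane.coe = {w : ℂ | 0 < w.im} := by
    ext w
    constructor
    · rintro ⟨z, rfl⟩; exact z.im_pos
    · intro hw; exact ⟨⟨w, hw⟩, rfl⟩
  rw [hrange]
  have hset : MeasurableSet {w : ℂ | 0 < w.im} := measurableSet_lt measurable_const Complex.measurable_im
  have hFi : Measurable (Set.indicator {w : ℂ | 0 < w.im}
      fun w => g w.re w.im * ENNReal.ofReal (1 / w.im ^ 2)) :=
    (hF.comp (Complex.measurable_re.prodMk Complex.measurable_im)).indicator hset
  rw [← lintegral_indicator hset,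
    ← Complex.volume_preserving_equiv_real_prod.symm.lintegral_comp hFi,
    Measure.volume_eq_prod, lintegral_prod_symm']
  · rw [← lintegral_indicator measurableSet_Ioi]
    refine lintegral_congr fun y => ?_
    by_cases hy : 0 < y
    · have hgy : Measurable fun x => g x y := hg.comp (by fun_prop : Measurable fun x : ℝ => (x, y))
      rw [Set.indicator_of_mem (by exact hy), ← lintegral_mul_const _ hgy]
      refine lintegral_congr fun x => ?_
      rw [Set.indicator_of_mem (by simpa using hy)]
      simp
    · rw [Set.indicator_of_notMem (by exact hy)]
      rw [lintegral_eq_zero_iff']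
      · refine Filter.Eventually.of_forall fun x => ?_
        exact Set.indicator_of_notMem (by simpa using hy) _
      · refine Measurable.aemeasurable ?_
        exact hFi.comp (Complex.measurableEquivRealProd.symm.measurable.comp (by fun_prop))
  · exact hFi.comp Complex.measurableEquivRealProd.symm.measurable

lemma measurePreserving_SL2Z_smul (γ : SL(2, ℤ)) :
    MeasurePreserving (fun τ : ℍ => γ • τ) volume volume := by
  have h := measurePreserving_smul
    (((Matrix.SpecialLinearGroup.map (Int.castRingHom ℝ) γ : SL(2, ℝ)) : GL (Fin 2) ℝ)) (volume : Measure ℍ)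
  exact h

/-- A horizontal line meets the boundary of the domain in at most four points. -/
lemma volume_fd_diff_fdo : volume (fd \ fdo) = 0 := by
  let g : ℝ → ℝ → ℝ≥0∞ := fun x y =>
    Set.indicator {p : ℝ × ℝ | p.1 = 1 / 2 ∨ p.1 = -(1 / 2) ∨ p.1 ^ 2 + p.2 ^ 2 = 1} 1 (x, y)
  have hS : MeasurableSet {p : ℝ × ℝ | p.1 = 1 / 2 ∨ p.1 = -(1 / 2) ∨ p.1 ^ 2 + p.2 ^ 2 = 1} := by
    refine (measurableSet_eq_fun measurable_fst measurable_const).union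
      ((measurableSet_eq_fun measurable_fst measurable_const).union
        (measurableSet_eq_fun (by fun_prop) measurable_const))
  have hg : Measurable (Function.uncurry g) := measurable_one.indicator hS
  have h0 : ∫⁻ τ : ℍ, g τ.re τ.im = 0 := by
    rw [lintegral_upperHalfPlane hg]
    refine (lintegral_congr fun y => ?_).trans lintegral_zero
    have : ∫⁻ x, g x y = 0 := by
      have h1 : ∀ x, g x y = Set.indicator {x : ℝ | x = 1 / 2 ∨ x = -(1 / 2) ∨ x ^ 2 + y ^ 2 = 1} 1 x :=
        fun x => rfl
      simp_rw [h1]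
      have hfin : Set.Finite {x : ℝ | x = 1 / 2 ∨ x = -(1 / 2) ∨ x ^ 2 + y ^ 2 = 1} := by
        refine (Set.toFinite ({1 / 2, -(1 / 2), Real.sqrt (1 - y ^ 2), -Real.sqrt (1 - y ^ 2)} : Set ℝ)).subset ?_
        rintro x (hx | hx | hx)
        · simp [hx]
        · simp [hx]
        · have h2 : |x| = Real.sqrt (1 - y ^ 2) := by
            rw [← Real.sqrt_sq_eq_abs]; congr 1; linarith
          rcases abs_choice x with h3 | h3
          · rw [h3] at h2; simp [h2]
          · rw [h3] at h2; simp [← h2]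
      rw [lintegral_indicator_one hfin.measurableSet, hfin.measure_zero]
    rw [this, zero_mul]
  have hre : Measurable fun z : ℍ => z.re := Complex.measurable_re.comp measurable_coe
  have him : Measurable fun z : ℍ => z.im := Complex.measurable_im.comp measurable_coe
  rw [← nonpos_iff_eq_zero, ← h0]
  calc volume (fd \ fdo) = ∫⁻ τ : ℍ, Set.indicator (fd \ fdo) 1 τ := by
        rw [lintegral_indicator_one (isClosed_fd.measurableSet.diff isOpen_fdo.measurableSet)]
    _ ≤ _ := by
        refine lintegral_mono fun τ => ?_
        by_cases hτ : τ ∈ fd \ fdo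
        · rw [Set.indicator_of_mem hτ]
          have : g τ.re τ.im = 1 := by
            refine Set.indicator_of_mem ?_ _
            obtain ⟨⟨h1, h2⟩, h3⟩ := hτ
            simp only [fdo, Set.mem_ofPred_eq, not_and_or, not_lt] at h3
            rcases h3 with h3 | h3
            · right; right
              have := le_antisymm h3 h1
              rw [Complex.normSq_apply] at this
              simp only [coe_re, coe_im] at this
              linarith
            · have := le_antisymm h2 h3
              rcases abs_choice τ.re with h4 | h4
              · left; exact h4.symm.trans this
              · right; left; change τ.re = _; linarith
          rw [this]; rfl
        · rw [Set.indicator_of_notMem hτ]; exact bot_le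

/-- Off the translates of the boundary an orbit meets `fd` in one point, reached by `γ₀` and by
`-γ₀` only; hence the value `2`. -/
lemma tsum_indicator_fd_ae : ∀ᵐ τ : ℍ, ∑' γ : SL(2, ℤ), Set.indicator fd (1 : ℍ → ℝ≥0∞) (γ • τ) = 2 := by
  have hnull : ∀ᵐ τ : ℍ, ∀ γ : SL(2, ℤ), γ • τ ∉ fd \ fdo := by
    rw [ae_all_iff]
    intro γ
    have h1 : ∀ᵐ τ : ℍ, τ ∉ fd \ fdo := measure_eq_zero_iff_ae_notMem.1 volume_fd_diff_fdo
    exact (measurePreserving_SL2Z_smul γ).quasiMeasurePreserving.ae (p := (· ∉ fd \ fdo)) h1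
  filter_upwards [hnull] with τ hτ
  obtain ⟨γ₀, h0⟩ := exists_smul_mem_fd τ
  have h0' : γ₀ • τ ∈ fdo := by
    by_contra h; exact hτ γ₀ ⟨h0, h⟩
  have hne : γ₀ ≠ -γ₀ := by
    intro h
    have h00 := congrArg (fun g : SL(2, ℤ) => g 0 0) h
    have h01 := congrArg (fun g : SL(2, ℤ) => g 0 1) h
    have hdet : γ₀ 0 0 * γ₀ 1 1 - γ₀ 0 1 * γ₀ 1 0 = 1 := by
      rw [← Matrix.det_fin_two]; exact γ₀.2
    simp only [Matrix.SpecialLinearGroup.coe_neg, Matrix.neg_apply] at h00 h01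
    rw [show γ₀ 0 0 = 0 by omega, show γ₀ 0 1 = 0 by omega] at hdet
    simp at hdet
  rw [tsum_eq_sum (s := {γ₀, -γ₀})]
  · rw [Finset.sum_pair hne, SL_neg_smul, Set.indicator_of_mem h0]
    simp [one_add_one_eq_two]
  · intro γ hγ
    refine Set.indicator_of_notMem ?_ _
    intro hmem
    apply hγ
    have h1 : (γ * γ₀⁻¹) • (γ₀ • τ) ∈ fd := by rwa [mul_smul, inv_smul_smul]
    rcases eq_one_or_neg_one_of_mem_fdo_mem_fd h0' h1 with h2 | h2
    · simp [mul_inv_eq_one.1 h2]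
    · have : γ = -γ₀ := by
        have := mul_inv_eq_iff_eq_mul.1 h2
        rw [this, neg_one_mul]
      simp [this]

/-- **Unfolding** over `SL(2, ℤ)`. -/
theorem lintegral_fd_tsum {f : ℍ → ℝ≥0∞} (hf : Measurable f) :
    ∫⁻ τ in fd, ∑' γ : SL(2, ℤ), f (γ • τ) = 2 * ∫⁻ τ : ℍ, f τ := by
  have hmeas : ∀ γ : SL(2, ℤ), Measurable fun τ : ℍ => γ • τ := fun γ =>
    (measurePreserving_SL2Z_smul γ).measurable
  have hfd : MeasurableSet fd := isClosed_fd.measurableSet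
  have hfm : ∀ γ : SL(2, ℤ), Measurable fun τ : ℍ => f (γ • τ) := fun γ => hf.comp (hmeas γ)
  have hind : ∀ γ : SL(2, ℤ), Measurable fun τ : ℍ =>
      f τ * Set.indicator fd (1 : ℍ → ℝ≥0∞) (γ⁻¹ • τ) := fun γ =>
    hf.mul ((measurable_one.indicator hfd).comp (hmeas _))
  rw [lintegral_tsum fun γ => (hfm γ).aemeasurable]
  have h1 : ∀ γ : SL(2, ℤ), ∫⁻ τ in fd, f (γ • τ) =
      ∫⁻ τ : ℍ, f τ * Set.indicator fd (1 : ℍ → ℝ≥0∞) (γ⁻¹ • τ) := by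
    intro γ
    rw [← lintegral_indicator hfd, ← (measurePreserving_SL2Z_smul γ).lintegral_comp
      (f := fun τ => f τ * Set.indicator fd (1 : ℍ → ℝ≥0∞) (γ⁻¹ • τ))
      (hind γ)]
    refine lintegral_congr fun τ => ?_
    rw [inv_smul_smul]
    by_cases hτ : τ ∈ fd <;> simp [hτ]
  simp_rw [h1]
  rw [← lintegral_tsum fun γ => (hind γ).aemeasurable]
  simp_rw [ENNReal.tsum_mul_left]
  rw [← lintegral_const_mul _ hf]
  refine lintegral_congr_ae ?_
  filter_upwards [tsum_indicator_fd_ae] with τ hτ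
  have := (Equiv.inv SL(2, ℤ)).tsum_eq (fun γ => Set.indicator fd (1 : ℍ → ℝ≥0∞) (γ • τ))
  simp only [Equiv.inv_apply] at this
  rw [this, hτ, mul_comm]

end Unfolding

/-! ### Unfolding over the cusps and finiteness of the volume. -/

section Strip

open MeasureTheory UpperHalfPlane ModularGroup
open scoped ENNReal

/-- Elements of `SL(d, ℤ)` as products of an element of the parabolic and a representative. -/
def cosetProdEquiv (d i : ℕ) : Cosets d i × parabolic d i ≃ SL(d, ℤ) :=
  Equiv.ofBijective (fun x => (x.2 : SL(d, ℤ)) * x.1.out) <| by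
    constructor
    · rintro ⟨c, p⟩ ⟨c', p'⟩ h
      simp only at h
      have hc : c = c' := by
        rw [← Quotient.out_eq c, ← Quotient.out_eq c']
        refine Quotient.sound (QuotientGroup.rightRel_apply.2 ?_)
        have : c'.out * c.out⁻¹ = (p' : SL(d, ℤ))⁻¹ * p := by
          rw [eq_inv_mul_iff_mul_eq, ← mul_assoc, ← h]; group
        rw [this]
        exact (parabolic d i).mul_mem ((parabolic d i).inv_mem p'.2) p.2
      subst hc
      exact Prod.ext rfl (Subtype.ext (mul_right_cancel h))
    · intro γ
      obtain ⟨p, hp, hpγ⟩ := exists_out_eq_mul (i := i) γ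
      exact ⟨⟨Quotient.mk _ γ, ⟨p⁻¹, (parabolic d i).inv_mem hp⟩⟩, by simp [hpγ]⟩

/-- The matrix `ε T^n`, up to sign of `n`. -/
def borelElt (x : ℤˣ × ℤ) : parabolic 2 1 :=
  ⟨⟨!![(x.1 : ℤ), x.2; 0, (x.1 : ℤ)], by
    rw [Matrix.det_fin_two_of, mul_zero, sub_zero]
    rcases Int.units_eq_one_or x.1 with h | h <;> simp [h]⟩, by
    intro j k hj hk
    have hj1 : j = 1 := by ext; simp; omega
    have hk0 : k = 0 := by ext; simp; omega
    subst hj1; subst hk0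
    rfl⟩

/-- The Borel subgroup of `SL(2, ℤ)`. -/
def borelEquiv : ℤˣ × ℤ ≃ parabolic 2 1 :=
  Equiv.ofBijective borelElt <| by
    constructor
    · rintro ⟨ε, n⟩ ⟨ε', n'⟩ h
      have h1 : !![(ε : ℤ), n; 0, (ε : ℤ)] = !![(ε' : ℤ), n'; 0, (ε' : ℤ)] :=
        congrArg (fun p : parabolic 2 1 => ((p : SL(2, ℤ)) : Matrix (Fin 2) (Fin 2) ℤ)) h
      have h2 := congrFun (congrFun h1 0) 0
      have h3 := congrFun (congrFun h1 0) 1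
      simp at h2 h3
      exact Prod.ext (Units.ext h2) h3
    · rintro ⟨p, hp⟩
      have hc : p 1 0 = 0 := hp 1 0 (by simp) (by simp)
      have hdet : p 0 0 * p 1 1 - p 0 1 * p 1 0 = 1 := by
        rw [← Matrix.det_fin_two]; exact p.2
      rw [hc, mul_zero, sub_zero] at hdet
      have hu : IsUnit (p 0 0) := IsUnit.of_mul_eq_one _ hdet
      refine ⟨(hu.unit, p 0 1), ?_⟩
      apply Subtype.ext
      ext i j
      have h11 : p 1 1 = p 0 0 := by
        rcases Int.isUnit_iff.1 hu with h | h <;> rw [h] at hdet ⊢ <;> omega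
      fin_cases i <;> fin_cases j <;> simp [borelElt, hc, h11]

lemma borelElt_smul_re (ε : ℤˣ) (n : ℤ) (τ : ℍ) :
    ((borelElt (ε, n) : SL(2, ℤ)) • τ).re = τ.re + ε * n := by
  rw [← coe_re, specialLinearGroup_apply]
  rcases Int.units_eq_one_or ε with h | h
  · simp [borelElt, h]
  · simp [borelElt, h, div_neg, add_comm]

lemma borelElt_smul_im (ε : ℤˣ) (n : ℤ) (τ : ℍ) :
    ((borelElt (ε, n) : SL(2, ℤ)) • τ).im = τ.im := by
  rw [← coe_im, specialLinearGroup_apply]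
  rcases Int.units_eq_one_or ε with h | h
  · simp [borelElt, h]
  · simp [borelElt, h, div_neg]

lemma tsum_indicator_Ico_add_int (x : ℝ) :
    ∑' n : ℤ, Set.indicator (Set.Ico (0 : ℝ) 1) (1 : ℝ → ℝ≥0∞) (x + n) = 1 := by
  rw [tsum_eq_single (-⌊x⌋)]
  · rw [Set.indicator_of_mem]
    · rfl
    · push_cast
      constructor
      · linarith [Int.floor_le x]
      · linarith [Int.lt_floor_add_one x]
  · intro n hn
    refine Set.indicator_of_notMem ?_ _
    rintro ⟨h1, h2⟩
    apply hn
    have : ⌊x⌋ = -n := by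
      rw [Int.floor_eq_iff]; push_cast; constructor <;> linarith
    omega

/-- **Unfolding** of sums over cusps. -/
theorem lintegral_fd_tsum_cosets {k : ℝ → ℝ≥0∞} (hk : Measurable k) :
    ∫⁻ τ in fd, ∑' c : Cosets 2 1, k (c.out • τ).im =
      ∫⁻ y in Set.Ioi (0 : ℝ), k y * ENNReal.ofReal (1 / y ^ 2) := by
  -- The function `g` restricts `k` to a strip of width one. Integer translations tile the half
  -- plane by such strips, once for each sign in the Borel subgroup, and this factor `2` cancels the
  -- one in `lintegral_fd_tsum`.
  let g : ℝ → ℝ → ℝ≥0∞ := fun x y => Set.indicator (Set.Ico (0 : ℝ) 1) (1 : ℝ → ℝ≥0∞) x * k y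
  have hg : Measurable (Function.uncurry g) :=
    ((measurable_one.indicator measurableSet_Ico).comp measurable_fst).mul (hk.comp measurable_snd)
  have hre : Measurable fun z : ℍ => z.re := Complex.measurable_re.comp measurable_coe
  have him : Measurable fun z : ℍ => z.im := Complex.measurable_im.comp measurable_coe
  have hf : Measurable fun τ : ℍ => g τ.re τ.im := hg.comp (hre.prodMk him)
  have h1 := lintegral_fd_tsum hf
  have h2 : ∀ τ : ℍ, ∑' γ : SL(2, ℤ), g (γ • τ).re (γ • τ).im =
      2 * ∑' c : Cosets 2 1, k (c.out • τ).im := by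
    intro τ
    rw [← (cosetProdEquiv 2 1).tsum_eq, ENNReal.tsum_prod', ← ENNReal.tsum_mul_left]
    refine tsum_congr fun c => ?_
    rw [← borelEquiv.tsum_eq, ENNReal.tsum_prod']
    have h3 : ∀ (ε : ℤˣ) (n : ℤ),
        g (cosetProdEquiv 2 1 (c, borelEquiv (ε, n)) • τ).re
          (cosetProdEquiv 2 1 (c, borelEquiv (ε, n)) • τ).im =
        Set.indicator (Set.Ico (0 : ℝ) 1) (1 : ℝ → ℝ≥0∞) ((c.out • τ).re + ((ε : ℤ) * n : ℤ)) *
          k (c.out • τ).im := by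
      intro ε n
      have : cosetProdEquiv 2 1 (c, borelEquiv (ε, n)) • τ =
          (borelElt (ε, n) : SL(2, ℤ)) • (c.out • τ) := by
        rw [← mul_smul]; rfl
      rw [this, borelElt_smul_re, borelElt_smul_im]
      push_cast
      rfl
    simp_rw [h3, ENNReal.tsum_mul_right]
    have h4 : ∀ ε : ℤˣ, ∑' n : ℤ, Set.indicator (Set.Ico (0 : ℝ) 1) (1 : ℝ → ℝ≥0∞)
        ((c.out • τ).re + ((ε : ℤ) * n : ℤ)) = 1 := by
      intro ε
      have := (Units.mulLeft ε).tsum_eq (fun n : ℤ =>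
        Set.indicator (Set.Ico (0 : ℝ) 1) (1 : ℝ → ℝ≥0∞) ((c.out • τ).re + n))
      rw [tsum_indicator_Ico_add_int] at this
      exact this
    simp_rw [h4]
    rw [tsum_fintype]
    simp
  simp_rw [h2] at h1
  rw [lintegral_const_mul' _ _ (by norm_num)] at h1
  have h5 := (ENNReal.mul_right_inj (by norm_num) (by norm_num)).1 h1
  rw [h5, lintegral_upperHalfPlane hg]
  refine lintegral_congr fun y => ?_
  congr 1
  simp only [g]
  rw [lintegral_mul_const _ (measurable_one.indicator measurableSet_Ico),
    lintegral_indicator_one measurableSet_Ico]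
  simp

/-- The domain lies in `|x| ≤ 1`, `y > 1/2`, where `dx dy / y²` has finite mass. -/
lemma volume_fd_lt_top : volume fd < ⊤ := by
  let g : ℝ → ℝ → ℝ≥0∞ := fun x y =>
    Set.indicator (Set.Icc (-1 : ℝ) 1) (1 : ℝ → ℝ≥0∞) x *
      Set.indicator (Set.Ioi (1 / 2 : ℝ)) (1 : ℝ → ℝ≥0∞) y
  have hg : Measurable (Function.uncurry g) :=
    ((measurable_one.indicator measurableSet_Icc).comp measurable_fst).mul
      ((measurable_one.indicator measurableSet_Ioi).comp measurable_snd)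
  calc volume fd = ∫⁻ τ : ℍ, Set.indicator fd 1 τ := by
        rw [lintegral_indicator_one isClosed_fd.measurableSet]
    _ ≤ ∫⁻ τ : ℍ, g τ.re τ.im := by
        refine lintegral_mono fun τ => ?_
        by_cases hτ : τ ∈ fd
        · rw [Set.indicator_of_mem hτ]
          have h1 : τ.re ∈ Set.Icc (-1 : ℝ) 1 := by
            have := abs_le.1 hτ.2
            constructor <;> linarith [this.1, this.2]
          have h2 : τ.im ∈ Set.Ioi (1 / 2 : ℝ) := by
            have := three_le_four_mul_im_sq_of_mem_fd hτ
            have h3 := τ.im_pos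
            rw [Set.mem_Ioi]
            nlinarith
          simp only [g]
          rw [Set.indicator_of_mem h1, Set.indicator_of_mem h2]
          simp
        · rw [Set.indicator_of_notMem hτ]; exact bot_le
    _ = ∫⁻ y in Set.Ioi (0 : ℝ), (∫⁻ x, g x y) * ENNReal.ofReal (1 / y ^ 2) :=
        lintegral_upperHalfPlane hg
    _ ≤ ∫⁻ y in Set.Ioi (1 / 2 : ℝ), 2 * ENNReal.ofReal (1 / y ^ 2) := by
        rw [← lintegral_indicator measurableSet_Ioi, ← lintegral_indicator measurableSet_Ioi]
        refine lintegral_mono fun y => ?_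
        by_cases hy : 1 / 2 < y
        · have hy0 : (0 : ℝ) < y := by linarith
          rw [Set.indicator_of_mem (by exact hy0), Set.indicator_of_mem (by exact hy)]
          gcongr
          simp only [g]
          rw [lintegral_mul_const _ (measurable_one.indicator measurableSet_Icc),
            lintegral_indicator_one measurableSet_Icc, Set.indicator_of_mem (by exact hy)]
          simp only [Real.volume_Icc, Pi.one_apply, mul_one]
          norm_num
        · have h1 : ∀ x, g x y = 0 := fun x => by
            simp only [g]
            rw [Set.indicator_of_notMem (by exact hy : y ∉ Set.Ioi (1 / 2 : ℝ)), mul_zero]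
          simp [h1, Set.indicator_apply]
    _ < ⊤ := by
        have h1 : IntegrableOn (fun y : ℝ => 1 / y ^ 2) (Set.Ioi (1 / 2)) := by
          have := integrableOn_Ioi_rpow_of_lt (a := (-2 : ℝ)) (by norm_num) (c := 1 / 2) (by norm_num)
          refine this.congr_fun (fun y hy => ?_) measurableSet_Ioi
          have hy0 : (0 : ℝ) < y := lt_trans (by norm_num) hy
          simp only
          rw [Real.rpow_neg hy0.le, one_div]
          norm_cast
        rw [lintegral_const_mul' _ _ (by norm_num)]
        refine ENNReal.mul_lt_top (by norm_num) ?_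
        have h2 := h1.2
        rw [hasFiniteIntegral_iff_ofReal (Filter.Eventually.of_forall fun y => by positivity)] at h2
        exact h2

end Strip

/-! ### Bessel integrals and exponentials of binary forms on the half plane. -/

section BesselIntegral

open MeasureTheory UpperHalfPlane
open scoped ENNReal

/-- The Bessel-type integral `∫ y^{-3/2} exp (-a/y - b y) dy`. -/
lemma lintegral_rpow_mul_exp {a b : ℝ} (ha : 0 < a) (hb : 0 < b) :
    ∫⁻ y in Set.Ioi (0 : ℝ), ENNReal.ofReal (y ^ (-(3 / 2) : ℝ) * Real.exp (-a / y - b * y)) =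
      ENNReal.ofReal (Real.sqrt (Real.pi / a) * Real.exp (-2 * Real.sqrt (a * b))) := by
  set p := Real.sqrt a with hp
  set q := Real.sqrt b with hq
  have hp0 : 0 < p := Real.sqrt_pos.2 ha
  have hq0 : 0 < q := Real.sqrt_pos.2 hb
  have hpa : p ^ 2 = a := Real.sq_sqrt ha.le
  have hqb : q ^ 2 = b := Real.sq_sqrt hb.le
  let E : ℝ → ℝ := fun y => Real.exp (-a / y - b * y)
  have hEm : Measurable E := by fun_prop
  -- the symmetry `y ↦ (a / b) / y`
  have hsymm : ∫⁻ y in Set.Ioi (0 : ℝ), ENNReal.ofReal (q / Real.sqrt y * E y) =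
      ∫⁻ y in Set.Ioi (0 : ℝ), ENNReal.ofReal (p / (y * Real.sqrt y) * E y) := by
    have himg : (fun z : ℝ => (a / b) / z) '' Set.Ioi 0 = Set.Ioi 0 := by
      ext y
      constructor
      · rintro ⟨z, hz, rfl⟩
        have hz : 0 < z := hz
        exact (by positivity : 0 < a / b / z)
      · intro hy
        have hy : 0 < y := hy
        exact ⟨a / b / y, (by positivity : 0 < a / b / y), by field_simp⟩
    have := lintegral_image_eq_lintegral_abs_deriv_mul (s := Set.Ioi (0 : ℝ))
      (f := fun z : ℝ => (a / b) / z) (f' := fun z => -(a / b) / z ^ 2) measurableSet_Ioi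
      (fun z hz => by
        have hz : z ≠ 0 := ne_of_gt hz
        have := ((hasDerivAt_id z).inv hz).const_mul (a / b)
        refine (this.congr_deriv ?_).hasDerivWithinAt
        simp only [id]; ring)
      (fun x hx y hy hxy => by
        have hx : 0 < x := hx
        have hy : 0 < y := hy
        have hab : a / b ≠ 0 := by positivity
        simp only at hxy
        field_simp at hxy
        linarith)
      (fun y => ENNReal.ofReal (q / Real.sqrt y * E y))
    rw [himg] at this
    rw [this]
    refine setLIntegral_congr_fun measurableSet_Ioi fun z hz => ?_
    have hz : 0 < z := hz
    have hzs : 0 < Real.sqrt z := Real.sqrt_pos.2 hz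
    rw [← ENNReal.ofReal_mul (abs_nonneg _)]
    congr 1
    have hE : E (a / b / z) = E z := by
      simp only [E]; congr 1; field_simp; ring
    rw [hE, abs_div, abs_neg, abs_of_pos (by positivity : 0 < a / b),
      abs_of_pos (by positivity : 0 < z ^ 2), Real.sqrt_div (by positivity), Real.sqrt_div ha.le,
      ← hp, ← hq, ← hpa, ← hqb]
    have hzz : Real.sqrt z ^ 2 = z := Real.sq_sqrt hz.le
    set r := Real.sqrt z
    rw [← hzz]
    field_simp
  -- The map `w` is a bijection from `(0, ∞)` onto `ℝ` with `w² = by + a/y - 2√(ab)` and `w' = (q/√y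
  -- + p/(y√y))/2`. In the variable `w` the sum of the two integrals related by `hsymm` is a
  -- Gaussian integral.
  let w : ℝ → ℝ := fun y => q * Real.sqrt y - p / Real.sqrt y
  have hw : w '' Set.Ioi 0 = Set.univ := by
    rw [Set.eq_univ_iff_forall]
    intro v
    have hdisc : v ^ 2 < v ^ 2 + 4 * p * q := by nlinarith [mul_pos hp0 hq0]
    set D := Real.sqrt (v ^ 2 + 4 * p * q) with hD
    have hD2 : D ^ 2 = v ^ 2 + 4 * p * q := Real.sq_sqrt (by nlinarith [sq_nonneg v])
    have hDv : |v| < D := by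
      rw [← Real.sqrt_sq_eq_abs]; exact Real.sqrt_lt_sqrt (sq_nonneg v) hdisc
    have hr : 0 < (v + D) / (2 * q) := by
      have := neg_abs_le v
      apply div_pos <;> linarith
    -- The value of `√y` is the positive root of `q r² - v r - p = 0`.
    refine ⟨((v + D) / (2 * q)) ^ 2, by exact pow_pos hr 2, ?_⟩
    simp only [w]
    rw [Real.sqrt_sq hr.le]
    have hvD : v + D ≠ 0 := by
      have := neg_abs_le v
      linarith
    field_simp
    linear_combination hD2
  have hE1 : ∫⁻ y in Set.Ioi (0 : ℝ),
      ENNReal.ofReal ((q / Real.sqrt y + p / (y * Real.sqrt y)) * E y) =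
      ENNReal.ofReal (2 * Real.sqrt Real.pi * Real.exp (-2 * (p * q))) := by
    have := lintegral_image_eq_lintegral_abs_deriv_mul (s := Set.Ioi (0 : ℝ))
      (f := w) (f' := fun y => (q / Real.sqrt y + p / (y * Real.sqrt y)) / 2) measurableSet_Ioi
      (fun y hy => by
        have hy : 0 < y := hy
        have hys : 0 < Real.sqrt y := Real.sqrt_pos.2 hy
        have h1 := Real.hasDerivAt_sqrt hy.ne'
        have h2 := (h1.const_mul q).sub ((h1.inv hys.ne').const_mul p)
        refine (h2.congr_deriv ?_).hasDerivWithinAt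
        rw [Real.sq_sqrt hy.le]
        field_simp
        ring)
      (fun x hx y hy hxy => by
        have hx : 0 < x := hx
        have hy : 0 < y := hy
        have hxs : 0 < Real.sqrt x := Real.sqrt_pos.2 hx
        have hys : 0 < Real.sqrt y := Real.sqrt_pos.2 hy
        simp only [w] at hxy
        have h3 : (Real.sqrt x - Real.sqrt y) * (q + p / (Real.sqrt x * Real.sqrt y)) = 0 := by
          field_simp
          field_simp at hxy
          linarith
        have h4 : 0 < q + p / (Real.sqrt x * Real.sqrt y) := by positivity
        have h5 := (mul_eq_zero.1 h3).resolve_right h4.ne'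
        exact (Real.sqrt_inj hx.le hy.le).1 (by linarith))
      (fun v => ENNReal.ofReal (2 * Real.exp (-2 * (p * q)) * Real.exp (-1 * v ^ 2)))
    rw [hw, Measure.restrict_univ] at this
    have hgauss := integral_gaussian 1
    rw [div_one] at hgauss
    have h6 : ∫⁻ v : ℝ, ENNReal.ofReal (2 * Real.exp (-2 * (p * q)) * Real.exp (-1 * v ^ 2)) =
        ENNReal.ofReal (2 * Real.sqrt Real.pi * Real.exp (-2 * (p * q))) := by
      rw [← ofReal_integral_eq_lintegral_ofReal
        ((integrable_exp_neg_mul_sq zero_lt_one).const_mul _)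
        (Filter.Eventually.of_forall fun v => by positivity), integral_const_mul, hgauss]
      congr 1; ring
    rw [← h6, this]
    refine setLIntegral_congr_fun measurableSet_Ioi fun y hy => ?_
    have hy : 0 < y := hy
    have hys : 0 < Real.sqrt y := Real.sqrt_pos.2 hy
    have hyy : Real.sqrt y ^ 2 = y := Real.sq_sqrt hy.le
    rw [← ENNReal.ofReal_mul (abs_nonneg _)]
    congr 1
    rw [abs_of_pos (by positivity)]
    have h7 : E y = Real.exp (-2 * (p * q)) * Real.exp (-1 * w y ^ 2) := by
      rw [← Real.exp_add]
      simp only [E, w]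
      congr 1
      rw [← hpa, ← hqb]
      set r := Real.sqrt y
      rw [← hyy]
      field_simp
      ring
    rw [h7]; ring
  -- The symmetry makes the two summands equal, so each is half of the Gaussian integral.
  have hsplit : ∫⁻ y in Set.Ioi (0 : ℝ),
      ENNReal.ofReal ((q / Real.sqrt y + p / (y * Real.sqrt y)) * E y) =
      2 * ∫⁻ y in Set.Ioi (0 : ℝ), ENNReal.ofReal (p / (y * Real.sqrt y) * E y) := by
    rw [two_mul]
    nth_rewrite 1 [← hsymm]
    rw [← lintegral_add_left (by fun_prop)]
    refine setLIntegral_congr_fun measurableSet_Ioi fun y hy => ?_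
    have hy : 0 < y := hy
    have hE0 : 0 < E y := Real.exp_pos _
    rw [← ENNReal.ofReal_add (by positivity) (by positivity), add_mul]
  have hfin : 2 * ENNReal.ofReal p * ∫⁻ y in Set.Ioi (0 : ℝ),
      ENNReal.ofReal (y ^ (-(3 / 2) : ℝ) * E y) =
      2 * ENNReal.ofReal p *
        ENNReal.ofReal (Real.sqrt (Real.pi / a) * Real.exp (-2 * Real.sqrt (a * b))) := by
    rw [mul_assoc, ← lintegral_const_mul _ (by fun_prop)]
    have h8 : ∫⁻ y in Set.Ioi (0 : ℝ), ENNReal.ofReal p * ENNReal.ofReal (y ^ (-(3 / 2) : ℝ) * E y) =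
        ∫⁻ y in Set.Ioi (0 : ℝ), ENNReal.ofReal (p / (y * Real.sqrt y) * E y) := by
      refine setLIntegral_congr_fun measurableSet_Ioi fun y hy => ?_
      have hy : 0 < y := hy
      rw [← ENNReal.ofReal_mul hp0.le]
      congr 1
      have : y ^ (-(3 / 2) : ℝ) = (y * Real.sqrt y)⁻¹ := by
        rw [Real.rpow_neg hy.le, Real.sqrt_eq_rpow]
        congr 1
        nth_rewrite 2 [← Real.rpow_one y]
        rw [← Real.rpow_add hy]
        norm_num
      rw [this]; ring
    rw [h8, ← hsplit, hE1, Real.sqrt_div Real.pi_pos.le, Real.sqrt_mul ha.le, ← hp, ← hq,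
      mul_assoc 2 (ENNReal.ofReal p), ← ENNReal.ofReal_mul hp0.le, ← ENNReal.ofReal_ofNat,
      ← ENNReal.ofReal_mul (by norm_num)]
    congr 1
    field_simp
  refine (ENNReal.mul_right_inj ?_ ?_).1 hfin
  · exact mul_ne_zero (by norm_num) (by simpa using hp0)
  · exact ENNReal.mul_ne_top (by norm_num) ENNReal.ofReal_ne_top

/-- The integral over the upper half plane of the exponential of a positive definite binary form. -/
theorem lintegral_exp_form {A B C D : ℝ} (hC : 0 < C) (hD : 0 < D) (hABC : A * C - B ^ 2 = D) :
    ∫⁻ τ : ℍ, ENNReal.ofReal (Real.exp (-Real.pi * (τ.im⁻¹ *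
      (A + 2 * B * τ.re + C * (τ.re ^ 2 + τ.im ^ 2))))) =
      ENNReal.ofReal (Real.exp (-2 * Real.pi * Real.sqrt D) / Real.sqrt D) := by
  rw [lintegral_upperHalfPlane (g := fun x y => ENNReal.ofReal (Real.exp (-Real.pi * (y⁻¹ *
      (A + 2 * B * x + C * (x ^ 2 + y ^ 2)))))) (by
        simp only [Function.uncurry_def]
        fun_prop)]
  -- Completing the square at `x = -B/C` leaves a Gaussian in `x`. Its factor `√(y/C)` together with
  -- the weight `y⁻²` yields the power `y^(-3/2)` of `lintegral_rpow_mul_exp`.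
  have hinner : ∀ y : ℝ, 0 < y → ∫⁻ x : ℝ, ENNReal.ofReal (Real.exp (-Real.pi * (y⁻¹ *
      (A + 2 * B * x + C * (x ^ 2 + y ^ 2))))) =
      ENNReal.ofReal (Real.exp (-(Real.pi * D / C) / y - Real.pi * C * y) * Real.sqrt (y / C)) := by
    intro y hy
    have h1 : ∀ x : ℝ, Real.exp (-Real.pi * (y⁻¹ * (A + 2 * B * x + C * (x ^ 2 + y ^ 2)))) =
        Real.exp (-(Real.pi * D / C) / y - Real.pi * C * y) *
          Real.exp (-(Real.pi * C / y) * (x + B / C) ^ 2) := by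
      intro x
      rw [← Real.exp_add]
      congr 1
      rw [← hABC]
      field_simp
      ring
    have hpos : 0 < Real.pi * C / y := by positivity
    have hint : Integrable fun x : ℝ => Real.exp (-(Real.pi * C / y) * (x + B / C) ^ 2) :=
      (integrable_exp_neg_mul_sq hpos).comp_add_right (B / C)
    simp_rw [h1]
    rw [← ofReal_integral_eq_lintegral_ofReal (hint.const_mul _)
      (Filter.Eventually.of_forall fun x => by positivity), integral_const_mul,
      integral_add_right_eq_self (fun x => Real.exp (-(Real.pi * C / y) * x ^ 2)),
      integral_gaussian]
    congr 3
    field_simp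
  have h2 : ∫⁻ y in Set.Ioi (0 : ℝ), (∫⁻ x : ℝ, ENNReal.ofReal (Real.exp (-Real.pi * (y⁻¹ *
      (A + 2 * B * x + C * (x ^ 2 + y ^ 2)))))) * ENNReal.ofReal (1 / y ^ 2) =
      ∫⁻ y in Set.Ioi (0 : ℝ), ENNReal.ofReal (Real.sqrt C)⁻¹ *
        ENNReal.ofReal (y ^ (-(3 / 2) : ℝ) * Real.exp (-(Real.pi * D / C) / y - Real.pi * C * y)) := by
    refine setLIntegral_congr_fun measurableSet_Ioi fun y hy => ?_
    have hy : 0 < y := hy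
    have hCs : 0 < Real.sqrt C := Real.sqrt_pos.2 hC
    rw [hinner y hy, ← ENNReal.ofReal_mul (by positivity), ← ENNReal.ofReal_mul (by positivity)]
    congr 1
    have h3 : y ^ (-(3 / 2) : ℝ) = Real.sqrt y / y ^ 2 := by
      rw [Real.sqrt_eq_rpow, ← Real.rpow_natCast, ← Real.rpow_sub hy]
      norm_num
    rw [h3, Real.sqrt_div hy.le]
    ring
  rw [h2, lintegral_const_mul _ (by fun_prop),
    lintegral_rpow_mul_exp (by positivity) (by positivity), ← ENNReal.ofReal_mul (by positivity)]
  congr 1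
  have h4 : Real.sqrt (Real.pi * D / C * (Real.pi * C)) = Real.pi * Real.sqrt D := by
    rw [show Real.pi * D / C * (Real.pi * C) = Real.pi ^ 2 * D by field_simp,
      Real.sqrt_mul (by positivity), Real.sqrt_sq Real.pi_pos.le]
  have h5 : Real.sqrt (Real.pi / (Real.pi * D / C)) = Real.sqrt C / Real.sqrt D := by
    rw [← Real.sqrt_div hC.le]; congr 1; field_simp
  have hCs : 0 < Real.sqrt C := Real.sqrt_pos.2 hC
  rw [h4, h5, mul_assoc]
  field_simp

end BesselIntegral

/-! ### Binary forms attached to points of the upper half plane -/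

section BinForm

open Matrix UpperHalfPlane
open scoped Kronecker

variable {d : ℕ}

/-- The value at `τ` of the binary hermitian form attached to a symmetric matrix. -/
def binForm (τ : ℍ) (S : Matrix (Fin 2) (Fin 2) ℝ) : ℝ :=
  τ.im⁻¹ * (S 0 0 + 2 * S 0 1 * τ.re + S 1 1 * (τ.re ^ 2 + τ.im ^ 2))

/-- The unimodular binary form with root `τ`. -/
def tauGram (τ : ℍ) : Matrix (Fin 2) (Fin 2) ℝ :=
  !![τ.im⁻¹, τ.im⁻¹ * τ.re; τ.im⁻¹ * τ.re, τ.im⁻¹ * (τ.re ^ 2 + τ.im ^ 2)]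

lemma isGram_tauGram (τ : ℍ) : IsGram (tauGram τ) := by
  have hy := τ.im_pos
  have hs : 0 < Real.sqrt τ.im := Real.sqrt_pos.2 hy
  have hs2 : Real.sqrt τ.im ^ 2 = τ.im := Real.sq_sqrt hy.le
  refine ⟨!![(Real.sqrt τ.im)⁻¹, (Real.sqrt τ.im)⁻¹ * τ.re; 0, Real.sqrt τ.im], ?_, ?_⟩
  · rw [Matrix.det_fin_two_of]; field_simp; ring
  · ext i j
    fin_cases i <;> fin_cases j <;> simp [tauGram, Matrix.mul_apply, Fin.sum_univ_two] <;>
      field_simp <;> simp only [hs2, show Real.sqrt τ.im ^ 4 = (Real.sqrt τ.im ^ 2) ^ 2 by ring] <;>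
      field_simp

/-- The Gram matrix of the rows of an integral matrix. -/
def rowGram {i : ℕ} (X : Matrix (Fin d) (Fin d) ℝ) (M : Matrix (Fin i) (Fin d) ℤ) :
    Matrix (Fin i) (Fin i) ℝ :=
  M.map (Int.cast : ℤ → ℝ) * X * (M.map (Int.cast : ℤ → ℝ))ᵀ

lemma rowGram_mul {i : ℕ} (X : Matrix (Fin d) (Fin d) ℝ) (h : Matrix (Fin i) (Fin i) ℤ)
    (M : Matrix (Fin i) (Fin d) ℤ) : rowGram X (h * M) =
      h.map (Int.cast : ℤ → ℝ) * rowGram X M * (h.map (Int.cast : ℤ → ℝ))ᵀ := by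
  have hmap : (h * M).map (Int.cast : ℤ → ℝ) =
      h.map (Int.cast : ℤ → ℝ) * M.map (Int.cast : ℤ → ℝ) := Matrix.map_mul (f := Int.castRingHom ℝ)
  simp only [rowGram, hmap, Matrix.transpose_mul, Matrix.mul_assoc]

lemma det_map_intCast {i : ℕ} (h : Matrix (Fin i) (Fin i) ℤ) :
    (h.map (Int.cast : ℤ → ℝ)).det = (h.det : ℝ) := ((Int.castRingHom ℝ).map_det h).symm

lemma det_rowGram_mul {i : ℕ} (X : Matrix (Fin d) (Fin d) ℝ) (h : Matrix (Fin i) (Fin i) ℤ)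
    (M : Matrix (Fin i) (Fin d) ℤ) :
    (rowGram X (h * M)).det = (h.det : ℝ) ^ 2 * (rowGram X M).det := by
  rw [rowGram_mul, Matrix.det_mul, Matrix.det_mul, Matrix.det_transpose, det_map_intCast]; ring

lemma rowGram_apply {i : ℕ} (X : Matrix (Fin d) (Fin d) ℝ) (M : Matrix (Fin i) (Fin d) ℤ)
    (a b : Fin i) : rowGram X M a b = ∑ j, ∑ k, (M a j : ℝ) * X j k * M b k := by
  rw [rowGram, Matrix.mul_apply, Finset.sum_comm]
  refine Finset.sum_congr rfl fun k _ => ?_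
  rw [Matrix.mul_apply, Finset.sum_mul]
  rfl

lemma rowGram_symm {i : ℕ} {X : Matrix (Fin d) (Fin d) ℝ} (hX : Xᵀ = X)
    (M : Matrix (Fin i) (Fin d) ℤ) : (rowGram X M)ᵀ = rowGram X M := by
  simp only [rowGram, Matrix.transpose_mul, Matrix.transpose_transpose, hX, Matrix.mul_assoc]

lemma rowGram_smul {i : ℕ} (u : ℝ) (X : Matrix (Fin d) (Fin d) ℝ)
    (M : Matrix (Fin i) (Fin d) ℤ) : rowGram (u • X) M = u • rowGram X M := by
  simp [rowGram]

lemma binForm_smul (τ : ℍ) (u : ℝ) (S : Matrix (Fin 2) (Fin 2) ℝ) :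
    binForm τ (u • S) = u * binForm τ S := by
  simp only [binForm, Matrix.smul_apply, smul_eq_mul]; ring

/-- The term of the lattice sum at a matrix. -/
def latExp (τ : ℍ) (X : Matrix (Fin d) (Fin d) ℝ) (M : Matrix (Fin 2) (Fin d) ℤ) : ℝ :=
  Real.exp (-Real.pi * binForm τ (rowGram X M))

/-- The symmetry of `X` merges the two cross terms into `2 * τ.re`, so the exponent is real. -/
lemma latticeTerm_eq {X : Matrix (Fin d) (Fin d) ℝ} (hX : Xᵀ = X) (τ : ℍ) (M : RankTwo d) :
    latticeTerm τ X M = (latExp τ X M.1 : ℂ) := by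
  rw [latticeTerm, latExp, Complex.ofReal_exp]
  congr 1
  have hs : rowGram X M.1 1 0 = rowGram X M.1 0 1 := by
    have := congrFun (congrFun (rowGram_symm hX M.1) 0) 1
    exact this
  have h1 : ∀ a b : Fin 2, (rowGram X M.1 a b : ℂ) =
      ∑ j, ∑ k, (M.1 a j : ℂ) * (X j k : ℂ) * M.1 b k := by
    intro a b
    rw [rowGram_apply]; push_cast; rfl
  have h2 : ((fun j => (M.1 0 j : ℂ) + (M.1 1 j : ℂ) * (τ : ℂ)) ⬝ᵥ
      (X.map Complex.ofReal).mulVec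
        (fun j => (M.1 0 j : ℂ) + (M.1 1 j : ℂ) * (starRingEnd ℂ) (τ : ℂ))) =
      rowGram X M.1 0 0 + rowGram X M.1 0 1 * (starRingEnd ℂ) (τ : ℂ) +
        rowGram X M.1 1 0 * τ + rowGram X M.1 1 1 * ((τ : ℂ) * (starRingEnd ℂ) (τ : ℂ)) := by
    simp only [h1, dotProduct, Matrix.mulVec, Finset.sum_mul, Finset.mul_sum, Matrix.map_apply,
      ← Finset.sum_add_distrib]
    refine Finset.sum_congr rfl fun j _ => Finset.sum_congr rfl fun k _ => ?_
    ring
  rw [h2, hs]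
  have h3 : (τ : ℂ) * (starRingEnd ℂ) (τ : ℂ) = ((τ.re ^ 2 + τ.im ^ 2 : ℝ) : ℂ) := by
    rw [Complex.mul_conj, Complex.normSq_apply]; simp only [coe_re, coe_im]; push_cast; ring
  have h4 : (τ : ℂ) + (starRingEnd ℂ) (τ : ℂ) = ((2 * τ.re : ℝ) : ℂ) := by
    rw [Complex.add_conj]; simp
  rw [h3, binForm]
  push_cast at h4 ⊢
  linear_combination (-(Real.pi : ℂ) * (τ.im : ℂ)⁻¹ * rowGram X M.1 0 1) * h4

/-- The anti-automorphism of `SL(2, ℤ)` that describes the action on pairs of rows. -/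
def flipSL (γ : SL(2, ℤ)) : SL(2, ℤ) :=
  ⟨!![γ 1 1, γ 0 1; γ 1 0, γ 0 0], by
    have hdet : γ 0 0 * γ 1 1 - γ 0 1 * γ 1 0 = 1 := by
      rw [← Matrix.det_fin_two]; exact γ.2
    rw [Matrix.det_fin_two_of]; linarith⟩

lemma coe_flipSL (γ : SL(2, ℤ)) :
    (flipSL γ : Matrix (Fin 2) (Fin 2) ℤ) = !![γ 1 1, γ 0 1; γ 1 0, γ 0 0] := rfl

lemma flipSL_involutive : Function.Involutive flipSL := by
  intro γ
  ext i j
  fin_cases i <;> fin_cases j <;> simp [coe_flipSL]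

lemma im_SL2Z_smul (γ : SL(2, ℤ)) (τ : ℍ) : (γ • τ).im =
    τ.im / ((γ 1 0 * τ.re + γ 1 1) ^ 2 + (γ 1 0 * τ.im) ^ 2) := by
  rw [ModularGroup.im_smul_eq_div_normSq, ModularGroup.denom_apply, Complex.normSq_apply]
  simp [sq]

lemma re_normSq_SL2Z_smul (γ : SL(2, ℤ)) (τ : ℍ) :
    (γ • τ).re * ((γ 1 0 * τ.re + γ 1 1) ^ 2 + (γ 1 0 * τ.im) ^ 2) =
      (γ 0 0 * τ.re + γ 0 1) * (γ 1 0 * τ.re + γ 1 1) + γ 0 0 * γ 1 0 * τ.im ^ 2 := by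
  have h : ((γ • τ : ℍ) : ℂ) * ((γ 1 0 : ℂ) * τ + γ 1 1) = (γ 0 0 : ℂ) * τ + γ 0 1 := by
    have hne : ((γ 1 0 : ℂ) * τ + γ 1 1) ≠ 0 := by
      have := denom_ne_zero γ τ
      rwa [ModularGroup.denom_apply] at this
    rw [specialLinearGroup_apply]
    simp only [eq_intCast]
    push_cast
    exact div_mul_cancel₀ _ hne
  obtain ⟨z, hz⟩ : ∃ z : ℍ, z = γ • τ := ⟨_, rfl⟩
  rw [← hz] at h ⊢
  have h1 := congrArg Complex.re h
  have h2 := congrArg Complex.im h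
  simp at h1 h2
  linear_combination (γ 1 0 * τ.re + γ 1 1 : ℝ) * h1 + (γ 1 0 * τ.im : ℝ) * h2

lemma denom_sq_pos (γ : SL(2, ℤ)) (τ : ℍ) :
    0 < (γ 1 0 * τ.re + γ 1 1 : ℝ) ^ 2 + (γ 1 0 * τ.im) ^ 2 := by
  have h := im_SL2Z_smul γ τ
  have h1 := (γ • τ).im_pos
  rw [h] at h1
  exact (div_pos_iff_of_pos_left τ.im_pos).1 h1

/-- For `γ` with rows `(a, b)` and `(c, e)`, one has `m(cτ + e) + n(aτ + b) = (em + bn) + (cm +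
an)τ`, while the factor `|cτ + e|²` is absorbed by the imaginary part. The new pair of rows is the
one given by `flipSL γ`. -/
lemma binForm_SL2Z_smul (γ : SL(2, ℤ)) (τ : ℍ) {S : Matrix (Fin 2) (Fin 2) ℝ} (hS : Sᵀ = S) :
    binForm (γ • τ) S = binForm τ ((flipSL γ : Matrix (Fin 2) (Fin 2) ℤ).map (Int.cast : ℤ → ℝ) *
      S * ((flipSL γ : Matrix (Fin 2) (Fin 2) ℤ).map (Int.cast : ℤ → ℝ))ᵀ) := by
  have hs : S 1 0 = S 0 1 := congrFun (congrFun hS 0) 1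
  have hdet : (γ 0 0 * γ 1 1 - γ 0 1 * γ 1 0 : ℝ) = 1 := by
    have : γ 0 0 * γ 1 1 - γ 0 1 * γ 1 0 = 1 := by
      rw [← Matrix.det_fin_two]; exact γ.2
    exact_mod_cast this
  have hN := denom_sq_pos γ τ
  have him := im_SL2Z_smul γ τ
  have hre := re_normSq_SL2Z_smul γ τ
  have hy := τ.im_pos
  simp only [binForm, Matrix.mul_apply, Fin.sum_univ_two, Matrix.transpose_apply, Matrix.map_apply,
    coe_flipSL, Matrix.of_apply, Matrix.cons_val', Matrix.cons_val_zero, Matrix.cons_val_one,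
    Matrix.cons_val_fin_one, hs]
  set N := (γ 1 0 * τ.re + γ 1 1 : ℝ) ^ 2 + (γ 1 0 * τ.im) ^ 2 with hNdef
  set a : ℝ := ((γ 0 0 : ℤ) : ℝ)
  set b : ℝ := ((γ 0 1 : ℤ) : ℝ)
  set c : ℝ := ((γ 1 0 : ℤ) : ℝ)
  set e : ℝ := ((γ 1 1 : ℤ) : ℝ)
  set x := τ.re
  set y := τ.im
  set X := (γ • τ).re
  have hX : X = ((a * x + b) * (c * x + e) + a * c * y ^ 2) / N := by
    rw [eq_div_iff hN.ne']; exact hre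
  have hnorm : ((a * x + b) * (c * x + e) + a * c * y ^ 2) ^ 2 + y ^ 2 =
      ((a * x + b) ^ 2 + a ^ 2 * y ^ 2) * N := by
    rw [hNdef]
    linear_combination (-(y ^ 2) * (a * e - b * c + 1)) * hdet
  have hnorm2 : X ^ 2 + (y / N) ^ 2 = ((a * x + b) ^ 2 + a ^ 2 * y ^ 2) / N := by
    rw [hX, div_pow, div_pow, ← add_div, hnorm]; field_simp
  rw [him, hnorm2, hX, inv_div]
  field_simp
  rw [hNdef]
  ring

lemma latExp_SL2Z_smul (γ : SL(2, ℤ)) (τ : ℍ) {X : Matrix (Fin d) (Fin d) ℝ} (hX : Xᵀ = X)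
    (M : Matrix (Fin 2) (Fin d) ℤ) :
    latExp (γ • τ) X M = latExp τ X ((flipSL γ : Matrix (Fin 2) (Fin 2) ℤ) * M) := by
  rw [latExp, latExp, rowGram_mul, binForm_SL2Z_smul γ τ (rowGram_symm hX M)]

/-- The Gram matrix of the dual lattice, with the coordinates in reverse order. -/
def dualGram (X : Matrix (Fin d) (Fin d) ℝ) : Matrix (Fin d) (Fin d) ℝ :=
  X⁻¹.submatrix Fin.rev Fin.rev

lemma IsGram.dualGram {X : Matrix (Fin d) (Fin d) ℝ} (hX : IsGram X) : IsGram (dualGram X) := by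
  obtain ⟨B, hB, hXB⟩ := hX.inv
  refine ⟨B.submatrix Fin.rev Fin.rev, ?_, ?_⟩
  · rw [show (Fin.rev : Fin d → Fin d) = Fin.revPerm from rfl, Matrix.det_submatrix_equiv_self, hB]
  · rw [NonEpstein.dualGram, hXB]
    rw [show (Fin.rev : Fin d → Fin d) = Fin.revPerm from rfl, Matrix.transpose_submatrix,
      Matrix.submatrix_mul_equiv]

lemma IsGram.kronecker {ι κ : Type*} [Fintype ι] [DecidableEq ι] [Fintype κ] [DecidableEq κ]
    {X : Matrix ι ι ℝ} {Y : Matrix κ κ ℝ} (hX : IsGram X) (hY : IsGram Y) : IsGram (X ⊗ₖ Y) := by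
  obtain ⟨B, hB, rfl⟩ := hX
  obtain ⟨C, hC, rfl⟩ := hY
  refine ⟨B ⊗ₖ C, ?_, ?_⟩
  · rw [Matrix.det_kronecker, hB, hC]; simp
  · rw [Matrix.mul_kronecker_mul, Matrix.kroneckerMap_transpose]

/-- Integral matrices as functions on pairs of indices. -/
def matEquiv (d : ℕ) : (Fin 2 × Fin d → ℤ) ≃ Matrix (Fin 2) (Fin d) ℤ :=
  Equiv.curry _ _ _

/-- It presents the sum over `2 × d` matrices as a theta series of a unimodular form in `2d`
variables, to which Poisson summation applies. -/
lemma intForm_tauGram_kronecker (τ : ℍ) {X : Matrix (Fin d) (Fin d) ℝ} (hX : Xᵀ = X)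
    (m : Fin 2 × Fin d → ℤ) :
    intForm (tauGram τ ⊗ₖ X) m = binForm τ (rowGram X (matEquiv d m)) := by
  have hs : rowGram X (matEquiv d m) 1 0 = rowGram X (matEquiv d m) 0 1 :=
    congrFun (congrFun (rowGram_symm hX (matEquiv d m)) 0) 1
  have h1 : intForm (tauGram τ ⊗ₖ X) m =
      ∑ a, ∑ b, tauGram τ a b * rowGram X (matEquiv d m) a b := by
    simp only [rowGram_apply, intForm, dotProduct, Matrix.mulVec, Fintype.sum_prod_type,
      Finset.mul_sum, Matrix.kroneckerMap_apply]
    refine Finset.sum_congr rfl fun a _ => ?_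
    rw [Finset.sum_comm]
    refine Finset.sum_congr rfl fun b _ => Finset.sum_congr rfl fun j _ =>
      Finset.sum_congr rfl fun k _ => ?_
    change (m (a, j) : ℝ) * (tauGram τ a b * X j k * m (b, k)) =
      tauGram τ a b * (m (a, j) * X j k * m (b, k))
    ring
  rw [h1]
  simp only [Fin.sum_univ_two, hs, binForm, tauGram, Matrix.of_apply, Matrix.cons_val',
    Matrix.cons_val_zero, Matrix.cons_val_one, Matrix.cons_val_fin_one]
  ring

end BinForm

/-! ### Decomposition of the theta series by rank -/

section Theta

open Matrix UpperHalfPlane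
open scoped Kronecker

variable {d : ℕ}

lemma intForm_reindex {ι : Type*} [Fintype ι] (X X' : Matrix ι ι ℝ) (s : ι → ℤ) (e : ι ≃ ι)
    (h : ∀ p q, X p q = s p * s q * X' (e p) (e q)) (m : ι → ℤ) :
    intForm X m = intForm X' fun p => s (e.symm p) * m (e.symm p) := by
  simp only [intForm, dotProduct, Matrix.mulVec, Finset.mul_sum]
  refine Eq.trans ?_ (e.sum_comp _)
  refine Finset.sum_congr rfl fun p _ => ?_
  refine Eq.trans ?_ (e.sum_comp _)
  refine Finset.sum_congr rfl fun q _ => ?_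
  simp only [Equiv.symm_apply_apply, h]
  push_cast
  ring

/-- Signed permutations are automorphisms of `ℤ^ι`, so forms conjugate under them have the same
theta series. -/
lemma gaussSum_reindex {ι : Type*} [Fintype ι] (X X' : Matrix ι ι ℝ) (s : ι → ℤˣ) (e : ι ≃ ι)
    (h : ∀ p q, X p q = (s p : ℤ) * (s q : ℤ) * X' (e p) (e q)) (t : ℝ) :
    gaussSum X t = gaussSum X' t := by
  let σ : (ι → ℤ) ≃ (ι → ℤ) :=
    { toFun := fun m p => (s (e.symm p) : ℤ) * m (e.symm p)
      invFun := fun m p => ((s p)⁻¹ : ℤˣ) * m (e p)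
      left_inv := fun m => by
        funext p; beta_reduce; rw [← mul_assoc, Equiv.symm_apply_apply, Units.inv_mul, one_mul]
      right_inv := fun m => by
        funext p; beta_reduce; rw [← mul_assoc, Equiv.apply_symm_apply, Units.mul_inv, one_mul] }
  refine Eq.trans ?_ (σ.tsum_eq (fun m => Real.exp (-Real.pi * t * intForm X' m)))
  refine tsum_congr fun m => ?_
  rw [intForm_reindex X X' (fun p => (s p : ℤ)) e h m]
  rfl

lemma gaussSum_inv_eq_dualGram (X : Matrix (Fin d) (Fin d) ℝ) (t : ℝ) :
    gaussSum X⁻¹ t = gaussSum (dualGram X) t :=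
  gaussSum_reindex _ _ (fun _ => 1) Fin.revPerm (fun p q => by simp [dualGram]) t

lemma inv_tauGram (τ : ℍ) : (tauGram τ)⁻¹ =
    !![τ.im⁻¹ * (τ.re ^ 2 + τ.im ^ 2), -(τ.im⁻¹ * τ.re); -(τ.im⁻¹ * τ.re), τ.im⁻¹] := by
  have hy := τ.im_pos
  refine Matrix.inv_eq_right_inv ?_
  ext i j
  fin_cases i <;> fin_cases j <;> simp [tauGram, Matrix.mul_apply, Fin.sum_univ_two] <;>
    field_simp <;> ring

/-- The sum of `exp (-π u Q)` over all integral matrices. -/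
def thetaAll (G : Matrix (Fin d) (Fin d) ℝ) (τ : ℍ) (u : ℝ) : ℝ :=
  ∑' M : Matrix (Fin 2) (Fin d) ℤ, latExp τ (u • G) M

/-- The sum of `exp (-π u Q)` over integral matrices of rank two. -/
def thetaTwo (G : Matrix (Fin d) (Fin d) ℝ) (τ : ℍ) (u : ℝ) : ℝ :=
  ∑' M : RankTwo d, latExp τ (u • G) M.1

lemma latExp_matEquiv {G : Matrix (Fin d) (Fin d) ℝ} (hG : IsGram G) (τ : ℍ) (u : ℝ)
    (m : Fin 2 × Fin d → ℤ) :
    latExp τ (u • G) (matEquiv d m) = Real.exp (-Real.pi * u * intForm (tauGram τ ⊗ₖ G) m) := by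
  rw [latExp, rowGram_smul, binForm_smul, intForm_tauGram_kronecker τ hG.transpose, mul_assoc]

lemma summable_latExp {G : Matrix (Fin d) (Fin d) ℝ} (hG : IsGram G) (τ : ℍ) {u : ℝ} (hu : 0 < u) :
    Summable (latExp τ (u • G)) := by
  rw [← (matEquiv d).summable_iff]
  refine (((isGram_tauGram τ).kronecker hG).summable_exp hu).congr fun m => ?_
  exact (latExp_matEquiv hG τ u m).symm

lemma thetaAll_eq_gaussSum {G : Matrix (Fin d) (Fin d) ℝ} (hG : IsGram G) (τ : ℍ) (u : ℝ) :
    thetaAll G τ u = gaussSum (tauGram τ ⊗ₖ G) u := by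
  rw [thetaAll, gaussSum, ← (matEquiv d).tsum_eq]
  exact tsum_congr fun m => latExp_matEquiv hG τ u m

/-- This is theta inversion for `tauGram τ ⊗ₖ G`. The inverse of `tauGram τ` is conjugate to
`tauGram τ` by a signed swap, so `τ` is unchanged, and reversal of coordinates takes `G⁻¹` to
`dualGram G`. -/
theorem thetaAll_inv {G : Matrix (Fin d) (Fin d) ℝ} (hG : IsGram G) (τ : ℍ) {u : ℝ} (hu : 0 < u) :
    thetaAll G τ u = u ^ (-(d : ℝ)) * thetaAll (dualGram G) τ u⁻¹ := by
  rw [thetaAll_eq_gaussSum hG, thetaAll_eq_gaussSum hG.dualGram,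
    ((isGram_tauGram τ).kronecker hG).gaussSum_inv hu]
  congr 1
  · congr 1
    simp only [Fintype.card_prod, Fintype.card_fin]
    push_cast; ring
  · rw [Matrix.inv_kronecker, inv_tauGram]
    refine gaussSum_reindex _ _ (fun p => if p.1 = 0 then 1 else -1)
      (Equiv.prodCongr (Equiv.swap 0 1) Fin.revPerm) (fun p q => ?_) _
    obtain ⟨a, j⟩ := p
    obtain ⟨b, k⟩ := q
    fin_cases a <;> fin_cases b <;>
      simp [Matrix.kroneckerMap_apply, tauGram, dualGram]

/-- The sum of `exp (-π G[m] / y)` over nonzero vectors. -/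
def cuspTheta (G : Matrix (Fin d) (Fin d) ℝ) (y : ℝ) : ℝ := gaussSum G y⁻¹ - 1

lemma intForm_zero {ι : Type*} [Fintype ι] (X : Matrix ι ι ℝ) : intForm X 0 = 0 := by
  simp [intForm, dotProduct]

lemma hasSum_gaussSum_sub_one {ι : Type*} [Fintype ι] [DecidableEq ι] {X : Matrix ι ι ℝ}
    (hX : IsGram X) {t : ℝ} (ht : 0 < t) :
    HasSum (fun m : {m : ι → ℤ // m ≠ 0} => Real.exp (-Real.pi * t * intForm X m.1))
      (gaussSum X t - 1) := by
  have h1 : HasSum (fun m : ({0}ᶜ : Set (ι → ℤ)) => Real.exp (-Real.pi * t * intForm X m))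
      (gaussSum X t - ∑ m ∈ {(0 : ι → ℤ)}, Real.exp (-Real.pi * t * intForm X m)) := by
    have := (Finset.hasSum_compl_iff (a := gaussSum X t -
      ∑ m ∈ {(0 : ι → ℤ)}, Real.exp (-Real.pi * t * intForm X m)) {(0 : ι → ℤ)}
      (f := fun m : ι → ℤ => Real.exp (-Real.pi * t * intForm X m))).2 (by
        rw [sub_add_cancel]; exact (hX.summable_exp ht).hasSum)
    refine (Equiv.hasSum_iff (Equiv.subtypeEquivRight (by simp))).1 this
  rw [Finset.sum_singleton, intForm_zero, mul_zero, Real.exp_zero] at h1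
  exact h1

lemma hasSum_cuspTheta {G : Matrix (Fin d) (Fin d) ℝ} (hG : IsGram G) {y : ℝ} (hy : 0 < y) :
    HasSum (fun m : {m : Fin d → ℤ // m ≠ 0} => Real.exp (-Real.pi * y⁻¹ * intForm G m.1))
      (cuspTheta G y) :=
  hasSum_gaussSum_sub_one hG (inv_pos.2 hy)

lemma cuspTheta_nonneg {G : Matrix (Fin d) (Fin d) ℝ} (hG : IsGram G) {y : ℝ} (hy : 0 < y) :
    0 ≤ cuspTheta G y :=
  (hasSum_cuspTheta hG hy).nonneg fun _ => (Real.exp_pos _).le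

/-- Theta inversion in `d` variables; the zero vector of the dual lattice is responsible for the
growth `y^(d/2)` at infinity. -/
lemma cuspTheta_inv {G : Matrix (Fin d) (Fin d) ℝ} (hG : IsGram G) {y : ℝ} (hy : 0 < y) :
    cuspTheta G y = y ^ ((d : ℝ) / 2) * (1 + cuspTheta (dualGram G) y⁻¹) - 1 := by
  rw [cuspTheta, cuspTheta, hG.gaussSum_inv (inv_pos.2 hy), gaussSum_inv_eq_dualGram, inv_inv,
    Real.inv_rpow hy.le, ← Real.rpow_neg hy.le, Fintype.card_fin]
  ring_nf

/-- At a nonzero integral vector the form is at least `c`, so the term at `t` is at most `exp(-πc(t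
- 1))` times the term at `1`. The added `1` only makes `K` positive. -/
lemma exists_gaussSum_sub_one_le {ι : Type*} [Fintype ι] [DecidableEq ι] {X : Matrix ι ι ℝ}
    (hX : IsGram X) : ∃ K c : ℝ, 0 < K ∧ 0 < c ∧ ∀ t : ℝ, 1 ≤ t →
      gaussSum X t - 1 ≤ K * Real.exp (-c * t) := by
  obtain ⟨c, hc, h⟩ := hX.exists_intForm_lower_bound
  refine ⟨Real.exp (Real.pi * c) * (gaussSum X 1 - 1) + 1, Real.pi * c, ?_, by positivity,
    fun t ht => ?_⟩
  · have := (hasSum_gaussSum_sub_one hX one_pos).nonneg fun _ => (Real.exp_pos _).le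
    positivity
  have h1 := hasSum_gaussSum_sub_one hX (by linarith : 0 < t)
  have h2 := (hasSum_gaussSum_sub_one hX one_pos).mul_left
    (Real.exp (Real.pi * c) * Real.exp (-(Real.pi * c) * t))
  have h3 := hasSum_le (fun m => ?_) h1 h2
  · have := Real.exp_pos (-(Real.pi * c) * t)
    linarith
  · rw [← Real.exp_add, ← Real.exp_add, Real.exp_le_exp]
    have hm : 1 ≤ ‖m.1‖ := by
      obtain ⟨i, hi⟩ := Function.ne_iff.1 m.2
      refine le_trans ?_ (norm_le_pi_norm m.1 i)
      rw [Int.norm_eq_abs]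
      exact_mod_cast Int.one_le_abs hi
    have hq : c ≤ intForm X m.1 := by
      exact (le_mul_of_one_le_right hc.le (one_le_pow₀ hm)).trans (h m.1)
    have h4 := mul_nonneg (sub_nonneg.2 ht) (mul_nonneg Real.pi_pos.le (sub_nonneg.2 hq))
    nlinarith

/-- For the bottom row `(c, e)` both sides are `|cτ + e|² / Im τ`; this explains the reversed order
in `cuspVec`. -/
lemma tauGram_cuspVec (τ : ℍ) (c : Cosets 2 1) :
    τ.im⁻¹ * ((cuspVec c 0 : ℝ) ^ 2 + 2 * (cuspVec c 0 * cuspVec c 1) * τ.re +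
      (cuspVec c 1 : ℝ) ^ 2 * (τ.re ^ 2 + τ.im ^ 2)) = (c.out • τ).im⁻¹ := by
  rw [im_SL2Z_smul, inv_div, cuspVec]
  simp only [Matrix.cons_val_zero, Matrix.cons_val_one]
  ring

lemma latExp_rankOne (G : Matrix (Fin d) (Fin d) ℝ) (τ : ℍ) (u : ℝ) (c : Cosets 2 1)
    (m : {m : Fin d → ℤ // m ≠ 0}) :
    latExp τ (u • G) (rankOneEquiv d (c, m)).1 =
      Real.exp (-Real.pi * ((c.out • τ).im / u)⁻¹ * intForm G m.1) := by
  rw [latExp, rowGram_smul, binForm_smul]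
  congr 1
  have h1 : ∀ a b, rowGram G (rankOneEquiv d (c, m)).1 a b =
      cuspVec c a * cuspVec c b * intForm G m.1 := by
    intro a b
    rw [rowGram_apply]
    simp only [intForm, dotProduct, Matrix.mulVec, Finset.mul_sum]
    refine Finset.sum_congr rfl fun j _ => Finset.sum_congr rfl fun k _ => ?_
    change (((cuspVec c a * m.1 j : ℤ) : ℝ) * G j k * ((cuspVec c b * m.1 k : ℤ) : ℝ)) = _
    push_cast; ring
  rw [binForm, h1, h1, h1, inv_div, div_eq_mul_inv, ← tauGram_cuspVec τ c]
  ring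

lemma summable_rankOne {G : Matrix (Fin d) (Fin d) ℝ} (hG : IsGram G) (τ : ℍ) {u : ℝ} (hu : 0 < u) :
    Summable fun x : Cosets 2 1 × {m : Fin d → ℤ // m ≠ 0} =>
      Real.exp (-Real.pi * ((x.1.out • τ).im / u)⁻¹ * intForm G x.2.1) := by
  have h1 : Summable fun M : RankOne d => latExp τ (u • G) M.1 :=
    (summable_latExp hG τ hu).subtype _
  rw [← (rankOneEquiv d).summable_iff] at h1
  exact h1.congr fun x => latExp_rankOne G τ u x.1 x.2

lemma summable_cuspTheta {G : Matrix (Fin d) (Fin d) ℝ} (hG : IsGram G) (τ : ℍ) {u : ℝ}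
    (hu : 0 < u) : Summable fun c : Cosets 2 1 => cuspTheta G ((c.out • τ).im / u) := by
  refine (summable_rankOne hG τ hu).prod.congr fun c => ?_
  exact (hasSum_cuspTheta hG (div_pos (c.out • τ).im_pos hu)).tsum_eq

/-- The zero matrix gives `1`. A rank-one matrix is a primitive column times a nonzero row, and its
term depends on the column only through the height of `τ` seen from the corresponding cusp. -/
theorem thetaAll_eq {G : Matrix (Fin d) (Fin d) ℝ} (hG : IsGram G) (τ : ℍ) {u : ℝ} (hu : 0 < u) :
    thetaAll G τ u = 1 + ∑' c : Cosets 2 1, cuspTheta G ((c.out • τ).im / u) + thetaTwo G τ u := by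
  have hs := summable_latExp hG τ hu
  let S1 : Set (Matrix (Fin 2) (Fin d) ℤ) := {M | (M.map (Int.cast : ℤ → ℝ)).rank ≠ 2 ∧ M ≠ 0}
  let S2 : Set (Matrix (Fin 2) (Fin d) ℤ) := {M | (M.map (Int.cast : ℤ → ℝ)).rank = 2}
  let S0 : Set (Matrix (Fin 2) (Fin d) ℤ) := {0}
  have h0 : ((0 : Matrix (Fin 2) (Fin d) ℤ).map (Int.cast : ℤ → ℝ)).rank ≠ 2 := by
    rw [Ne, rank_eq_two_iff_exists_minor]; simp
  have hdec : latExp τ (u • G) = fun M => S0.indicator (latExp τ (u • G)) M +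
      S1.indicator (latExp τ (u • G)) M + S2.indicator (latExp τ (u • G)) M := by
    classical
    funext M
    by_cases hM0 : M = 0
    · subst hM0
      rw [Set.indicator_of_mem (show 0 ∈ S0 from rfl), Set.indicator_of_notMem (show 0 ∉ S1 from fun h => h.2 rfl),
        Set.indicator_of_notMem (show 0 ∉ S2 from h0)]
      ring
    · by_cases hM2 : (M.map (Int.cast : ℤ → ℝ)).rank = 2
      · rw [Set.indicator_of_notMem (show M ∉ S0 from hM0), Set.indicator_of_notMem (show M ∉ S1 from fun h => h.1 hM2),
          Set.indicator_of_mem (show M ∈ S2 from hM2)]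
        ring
      · rw [Set.indicator_of_notMem (show M ∉ S0 from hM0), Set.indicator_of_mem (show M ∈ S1 from ⟨hM2, hM0⟩),
          Set.indicator_of_notMem (show M ∉ S2 from hM2)]
        ring
  rw [thetaAll, hdec, ((hs.indicator S0).add (hs.indicator S1)).tsum_add (hs.indicator S2),
    (hs.indicator S0).tsum_add (hs.indicator S1), ← tsum_subtype S0, ← tsum_subtype S1,
    ← tsum_subtype S2]
  congr 1
  congr 1
  · rw [tsum_singleton (0 : Matrix (Fin 2) (Fin d) ℤ) (latExp τ (u • G)), latExp]
    simp [binForm, rowGram]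
  · have h1 : ∑' M : S1, latExp τ (u • G) M = ∑' x : Cosets 2 1 × {m : Fin d → ℤ // m ≠ 0},
        Real.exp (-Real.pi * ((x.1.out • τ).im / u)⁻¹ * intForm G x.2.1) := by
      refine ((rankOneEquiv d).tsum_eq (fun M : RankOne d => latExp τ (u • G) M.1)).symm.trans ?_
      exact tsum_congr fun x => latExp_rankOne G τ u x.1 x.2
    rw [h1, (summable_rankOne hG τ hu).tsum_prod]
    exact tsum_congr fun c => (hasSum_cuspTheta hG (div_pos (c.out • τ).im_pos hu)).tsum_eq

/-- The functional equation of the rank two part of the theta series. -/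
theorem thetaTwo_inv {G : Matrix (Fin d) (Fin d) ℝ} (hG : IsGram G) (τ : ℍ) {u : ℝ} (hu : 0 < u) :
    thetaTwo G τ u = u ^ (-(d : ℝ)) * thetaTwo (dualGram G) τ u⁻¹ + (u ^ (-(d : ℝ)) - 1) +
      ∑' c : Cosets 2 1, (u ^ (-(d : ℝ)) * cuspTheta (dualGram G) ((c.out • τ).im * u) -
        cuspTheta G ((c.out • τ).im / u)) := by
  have h1 := thetaAll_eq hG τ hu
  have h2 := thetaAll_eq hG.dualGram τ (inv_pos.2 hu)
  have h3 := thetaAll_inv hG τ hu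
  have s1 := summable_cuspTheta hG τ hu
  have s2 := summable_cuspTheta hG.dualGram τ (inv_pos.2 hu)
  simp only [div_inv_eq_mul] at h2 s2
  rw [(s2.mul_left _).tsum_sub s1, tsum_mul_left]
  rw [h3, h2] at h1
  linear_combination -h1

end Theta

/-! ### The integral of the rank two part of the theta series -/

section Plucker

open Matrix UpperHalfPlane
open scoped Kronecker

variable {d : ℕ}

/-- The Plücker coordinates of a pair of rows. -/
def plucker (M : Matrix (Fin 2) (Fin d) ℤ) (p : Fin d × Fin d) : ℤ :=
  M 0 p.1 * M 1 p.2 - M 0 p.2 * M 1 p.1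

lemma plucker_ne_zero (M : RankTwo d) : plucker M.1 ≠ 0 := by
  obtain ⟨j, k, h⟩ := (rank_eq_two_iff_exists_minor M.1).1 M.2
  exact fun h0 => h (congrFun h0 (j, k))

lemma one_le_norm_int {ι : Type*} [Fintype ι] {m : ι → ℤ} (hm : m ≠ 0) : 1 ≤ ‖m‖ := by
  obtain ⟨i, hi⟩ := Function.ne_iff.1 hm
  refine le_trans ?_ (norm_le_pi_norm m i)
  rw [Int.norm_eq_abs]
  exact_mod_cast Int.one_le_abs hi

/-- The Plücker vector is the antisymmetric tensor `m ⊗ n - n ⊗ m`; its norm under `G ⊗ G` is twice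
the Gram determinant, since each pair of columns is counted in both orders. -/
lemma intForm_kronecker_plucker {G : Matrix (Fin d) (Fin d) ℝ} (hG : Gᵀ = G)
    (M : Matrix (Fin 2) (Fin d) ℤ) :
    intForm (G ⊗ₖ G) (plucker M) = 2 * (rowGram G M).det := by
  have hs : rowGram G M 1 0 = rowGram G M 0 1 := congrFun (congrFun (rowGram_symm hG M) 0) 1
  have hprod : ∀ a b a' b' : Fin 2, ∑ p : Fin d × Fin d, ∑ q : Fin d × Fin d,
      ((M a p.1 : ℝ) * M b p.2) * (G p.1 q.1 * G p.2 q.2) * ((M a' q.1 : ℝ) * M b' q.2) =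
      rowGram G M a a' * rowGram G M b b' := by
    intro a b a' b'
    rw [rowGram_apply, rowGram_apply, Finset.sum_mul_sum]
    simp only [Fintype.sum_prod_type, Finset.sum_mul_sum]
    refine Finset.sum_congr rfl fun i _ => Finset.sum_congr rfl fun j _ =>
      Finset.sum_congr rfl fun k _ => Finset.sum_congr rfl fun l _ => ?_
    ring
  have h1 : intForm (G ⊗ₖ G) (plucker M) = rowGram G M 0 0 * rowGram G M 1 1 -
      rowGram G M 0 1 * rowGram G M 1 0 - rowGram G M 1 0 * rowGram G M 0 1 +
      rowGram G M 1 1 * rowGram G M 0 0 := by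
    rw [← hprod 0 1 0 1, ← hprod 0 1 1 0, ← hprod 1 0 0 1, ← hprod 1 0 1 0]
    simp only [intForm, dotProduct, Matrix.mulVec, Finset.mul_sum, Matrix.kroneckerMap_apply,
      ← Finset.sum_sub_distrib, ← Finset.sum_add_distrib]
    refine Finset.sum_congr rfl fun p _ => Finset.sum_congr rfl fun q _ => ?_
    simp only [plucker]
    push_cast
    ring
  rw [h1, Matrix.det_fin_two, hs]
  ring

lemma exists_det_rowGram_lower_bound {G : Matrix (Fin d) (Fin d) ℝ} (hG : IsGram G) :
    ∃ κ : ℝ, 0 < κ ∧ ∀ M : Matrix (Fin 2) (Fin d) ℤ,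
      κ * ‖plucker M‖ ^ 2 ≤ (rowGram G M).det := by
  obtain ⟨c, hc, h⟩ := (hG.kronecker hG).exists_intForm_lower_bound
  refine ⟨c / 2, by positivity, fun M => ?_⟩
  have := h (plucker M)
  rw [intForm_kronecker_plucker hG.transpose] at this
  linarith

lemma det_rowGram_pos {G : Matrix (Fin d) (Fin d) ℝ} (hG : IsGram G) (M : RankTwo d) :
    0 < (rowGram G M.1).det := by
  obtain ⟨κ, hκ, h⟩ := exists_det_rowGram_lower_bound hG
  refine lt_of_lt_of_le ?_ (h M.1)
  have := norm_pos_iff.2 (plucker_ne_zero M)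
  positivity

lemma rowGram_one_one_pos {G : Matrix (Fin d) (Fin d) ℝ} (hG : IsGram G) (M : RankTwo d) :
    0 < rowGram G M.1 1 1 := by
  have h1 : rowGram G M.1 1 1 = intForm G (M.1 1) := by
    rw [rowGram_apply]
    simp only [intForm, dotProduct, Matrix.mulVec, Finset.mul_sum, mul_assoc]
  rw [h1]
  refine hG.intForm_pos fun h0 => plucker_ne_zero M ?_
  funext p
  simp [plucker, h0]

/-- The determinant of the Gram matrix of the bottom rows of a coset. -/
def cosetDet {i : ℕ} (hi : i ≤ d) (G : Matrix (Fin d) (Fin d) ℝ) (c : Cosets d i) : ℝ :=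
  (rowGram G (cosetRows hi c)).det

/-- The bottom rows of a coset, as a matrix of rank two. -/
def cosetRankTwo (hd : 2 < d) (c : Cosets d 2) : RankTwo d :=
  ⟨cosetRows hd.le c, by
    have := (rank_mul_cosetRows hd 1 c).2 (by simp)
    rwa [Matrix.one_mul] at this⟩

lemma cosetDet_pos (hd : 2 < d) {G : Matrix (Fin d) (Fin d) ℝ} (hG : IsGram G) (c : Cosets d 2) :
    0 < cosetDet hd.le G c := det_rowGram_pos hG (cosetRankTwo hd c)

/-- For the columns `j, k` of a nonzero minor, `K B * B` consists of two rows of Plücker coordinates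
of `B`, and `K B` has that minor as determinant. Equal Plücker vectors thus give equal products, and
`cosetRows_mul_injective` applies. -/
lemma plucker_cosetRows_injective (hd : 2 < d) :
    Function.Injective fun c : Cosets d 2 => plucker (cosetRows hd.le c) := by
  intro c c' hcc
  obtain ⟨j, k, h⟩ := (rank_eq_two_iff_exists_minor _).1 (cosetRankTwo hd c).2
  change cosetRows hd.le c 0 j * cosetRows hd.le c 1 k -
    cosetRows hd.le c 0 k * cosetRows hd.le c 1 j ≠ 0 at h
  let K : Matrix (Fin 2) (Fin d) ℤ → Matrix (Fin 2) (Fin 2) ℤ := fun B =>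
    !![-B 1 j, B 0 j; -B 1 k, B 0 k]
  have hK : ∀ B : Matrix (Fin 2) (Fin d) ℤ,
      K B * B = Matrix.of ![fun l => plucker B (j, l), fun l => plucker B (k, l)] := by
    intro B
    ext a l
    fin_cases a <;> simp [K, Matrix.mul_apply, Fin.sum_univ_two, plucker] <;> ring
  refine (cosetRows_mul_injective hd.le (h := K (cosetRows hd.le c))
    (h' := K (cosetRows hd.le c')) ?_ ?_).1
  · rw [Matrix.det_fin_two_of]
    intro h0
    exact h (by linarith)
  · have hcc' : plucker (cosetRows hd.le c) = plucker (cosetRows hd.le c') := hcc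
    rw [hK, hK, hcc']

lemma exists_cosetDet_lower_bound (hd : 2 < d) {G : Matrix (Fin d) (Fin d) ℝ} (hG : IsGram G) :
    ∃ κ : ℝ, 0 < κ ∧ ∀ c : Cosets d 2, κ ≤ cosetDet hd.le G c := by
  obtain ⟨κ, hκ, h⟩ := exists_det_rowGram_lower_bound hG
  exact ⟨κ, hκ, fun c => (le_mul_of_one_le_right hκ.le
    (one_le_pow₀ (one_le_norm_int (plucker_ne_zero (cosetRankTwo hd c))))).trans
      (h (cosetRows hd.le c))⟩

/-- Plücker coordinates embed the cosets into `ℤ^(d²)` and bound the Gram determinant below by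
`κ‖p‖²`, so the series is compared with `∑ ‖p‖^(-2r)` over all nonzero vectors of that lattice. This
crude comparison is the origin of the bound `d²`. -/
lemma summable_cosetDet_rpow (hd : 2 < d) {G : Matrix (Fin d) (Fin d) ℝ} (hG : IsGram G) {r : ℝ}
    (hr : (d : ℝ) ^ 2 < 2 * r) : Summable fun c : Cosets d 2 => cosetDet hd.le G c ^ (-r) := by
  obtain ⟨κ, hκ, h⟩ := exists_det_rowGram_lower_bound hG
  have h1 : Summable fun m : Fin d × Fin d → ℤ => ‖m‖ ^ (-(2 * r)) :=
    summable_norm_rpow_int _ (by simp only [Fintype.card_prod, Fintype.card_fin]; push_cast; nlinarith)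
  have h2 := (h1.comp_injective (plucker_cosetRows_injective hd)).mul_left (κ ^ (-r))
  have hr0 : 0 ≤ r := by nlinarith [sq_nonneg (d : ℝ)]
  refine Summable.of_nonneg_of_le (fun c => Real.rpow_nonneg (cosetDet_pos hd hG c).le _)
    (fun c => ?_) h2
  have hp : 0 < ‖plucker (cosetRows hd.le c)‖ :=
    norm_pos_iff.2 (plucker_ne_zero (cosetRankTwo hd c))
  have h3 : κ ^ (-r) * ‖plucker (cosetRows hd.le c)‖ ^ (-(2 * r)) =
      (κ * ‖plucker (cosetRows hd.le c)‖ ^ 2) ^ (-r) := by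
    rw [Real.mul_rpow hκ.le (by positivity), ← Real.rpow_natCast, ← Real.rpow_mul hp.le]
    congr 2; push_cast; ring
  simp only [Function.comp]
  rw [h3]
  exact Real.rpow_le_rpow_of_nonpos (by positivity) (h _) (by linarith)

end Plucker

/-! ### Dirichlet series over Hermite normal forms. -/

section HermiteSums

lemma summable_pnat_rpow {r : ℝ} (hr : 1 < r) : Summable fun n : ℕ+ => (n : ℝ) ^ (-r) := by
  have := (Real.summable_nat_rpow (p := -r)).2 (by linarith)
  exact this.comp_injective PNat.coe_injective

lemma hasSum_pnat_cpow {w : ℂ} (hw : 1 < w.re) :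
    HasSum (fun n : ℕ+ => (n : ℂ) ^ (-w)) (riemannZeta w) := by
  have h1 : Summable fun n : ℕ+ => (n : ℂ) ^ (-w) := by
    refine Summable.of_norm ((summable_pnat_rpow hw).congr fun n => ?_)
    rw [← Complex.ofReal_natCast, Complex.norm_cpow_eq_rpow_re_of_pos (by exact_mod_cast n.pos)]
    simp
  rw [zeta_eq_tsum_one_div_nat_add_one_cpow hw]
  convert h1.hasSum using 1
  rw [tsum_pnat_eq_tsum_succ (f := fun n => (n : ℂ) ^ (-w))]
  refine tsum_congr fun n => ?_
  rw [Complex.cpow_neg, one_div]; push_cast; rfl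

lemma norm_natCast_cpow_neg (n : ℕ+) (w : ℂ) : ‖(n : ℂ) ^ (-w)‖ = (n : ℝ) ^ (-w.re) := by
  rw [← Complex.ofReal_natCast, Complex.norm_cpow_eq_rpow_re_of_pos (by exact_mod_cast n.pos)]
  simp

lemma summable_sigma_fin {r : ℝ} (hr : 2 < r) :
    Summable fun x : Σ n : ℕ+, Fin n => (x.1 : ℝ) ^ (-r) := by
  rw [summable_sigma_of_nonneg fun x => Real.rpow_nonneg (by positivity) _]
  refine ⟨fun n => Summable.of_finite, ?_⟩
  refine (summable_pnat_rpow (r := r - 1) (by linarith)).congr fun n => ?_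
  have hn : (0 : ℝ) < n := by exact_mod_cast n.pos
  rw [tsum_fintype]
  change _ = ∑ _ : Fin n, (n : ℝ) ^ (-r)
  rw [Finset.sum_const, Finset.card_univ, Fintype.card_fin, nsmul_eq_mul,
    show -(r - 1) = 1 + -r by ring, Real.rpow_add hn, Real.rpow_one]

/-- The `n` residues modulo `n` turn `n^(-w)` into `n^(1-w)`. -/
lemma hasSum_sigma_fin {w : ℂ} (hw : 2 < w.re) :
    HasSum (fun x : Σ n : ℕ+, Fin n => (x.1 : ℂ) ^ (-w)) (riemannZeta (w - 1)) := by
  have hs : Summable fun x : Σ n : ℕ+, Fin n => (x.1 : ℂ) ^ (-w) :=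
    Summable.of_norm ((summable_sigma_fin hw).congr fun x => (norm_natCast_cpow_neg x.1 w).symm)
  have h1 := hs.hasSum.sigma (g := fun n : ℕ+ => (n : ℂ) ^ (-(w - 1))) fun n => by
    have hn : (n : ℂ) ≠ 0 := by exact_mod_cast n.ne_zero
    have := hasSum_fintype fun _ : Fin n => (n : ℂ) ^ (-w)
    rwa [Finset.sum_const, Finset.card_univ, Fintype.card_fin, nsmul_eq_mul,
      show (n : ℂ) * (n : ℂ) ^ (-w) = (n : ℂ) ^ (-(w - 1)) by
        rw [show -(w - 1) = 1 + -w by ring, Complex.cpow_add _ _ hn, Complex.cpow_one]] at this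
  rw [← h1.unique (hasSum_pnat_cpow (by simp; linarith))]
  exact hs.hasSum

lemma summable_hermite_rpow {r : ℝ} (hr : 2 < r) :
    Summable fun x : HermiteIndex => (x.1 : ℝ) ^ (-r) * (x.2.1.1 : ℝ) ^ (-r) := by
  have h1 : Summable fun y : (Σ n : ℕ+, Fin n) × ℤˣ => (y.1.1 : ℝ) ^ (-r) * 1 :=
    (summable_sigma_fin hr).mul_of_nonneg (g := fun _ : ℤˣ => (1 : ℝ)) Summable.of_finite
      (fun x => Real.rpow_nonneg (by positivity) _) (fun _ => zero_le_one)
  have h2 := (summable_pnat_rpow (r := r) (by linarith)).mul_of_nonneg h1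
    (fun x => Real.rpow_nonneg (by positivity) _)
    (fun y => mul_nonneg (Real.rpow_nonneg (by positivity) _) zero_le_one)
  exact h2.congr fun x => by rw [mul_one]

lemma hasSum_prod_mul {ι κ : Type*} {f : ι → ℂ} {g : κ → ℂ} {a b : ℂ} (hf : HasSum f a)
    (hg : HasSum g b) (hf' : Summable fun x => ‖f x‖) (hg' : Summable fun x => ‖g x‖) :
    HasSum (fun x : ι × κ => f x.1 * g x.2) (a * b) :=
  hf.mul hg (summable_mul_of_summable_norm hf' hg')

lemma hasSum_units_int : HasSum (fun _ : ℤˣ => (1 : ℂ)) 2 := by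
  have := hasSum_fintype fun _ : ℤˣ => (1 : ℂ)
  simpa using this

/-- The first diagonal entry gives `ζ(w)`, the second with its residues gives `ζ(w - 1)`, and the
sign gives the factor `2`. -/
lemma hasSum_hermite_cpow {w : ℂ} (hw : 2 < w.re) :
    HasSum (fun x : HermiteIndex => (x.1 : ℂ) ^ (-w) * (x.2.1.1 : ℂ) ^ (-w))
      (2 * riemannZeta w * riemannZeta (w - 1)) := by
  have n1 : Summable fun x : Σ n : ℕ+, Fin n => ‖(x.1 : ℂ) ^ (-w)‖ :=
    (summable_sigma_fin hw).congr fun x => (norm_natCast_cpow_neg x.1 w).symm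
  have n2 : Summable fun n : ℕ+ => ‖(n : ℂ) ^ (-w)‖ :=
    (summable_pnat_rpow (r := w.re) (by linarith)).congr fun n => (norm_natCast_cpow_neg n w).symm
  have h1 := hasSum_prod_mul (hasSum_sigma_fin hw) hasSum_units_int n1 Summable.of_finite
  have n3 : Summable fun y : (Σ n : ℕ+, Fin n) × ℤˣ => ‖(y.1.1 : ℂ) ^ (-w) * 1‖ :=
    Summable.norm h1.summable
  have h2 := hasSum_prod_mul (hasSum_pnat_cpow (w := w) (by linarith)) h1 n2 n3
  rw [show 2 * riemannZeta w * riemannZeta (w - 1) =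
    riemannZeta w * (riemannZeta (w - 1) * 2) by ring]
  refine h2.congr_fun fun x => ?_
  rw [mul_one]

end HermiteSums

/-! ### The integrated rank-two theta series as a sum over lattice areas. -/

section Delta

open Matrix UpperHalfPlane MeasureTheory ModularGroup
open scoped ENNReal

variable {d : ℕ}

/-- The square root of the determinant of the Gram matrix of a lattice of rank two, indexed by a
primitive lattice and a sublattice. -/
def latticeArea (hd : 2 < d) (G : Matrix (Fin d) (Fin d) ℝ) (x : HermiteIndex × Cosets d 2) : ℝ :=
  (x.1.1 : ℝ) * (x.1.2.1.1 : ℝ) * Real.sqrt (cosetDet hd.le G x.2)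

variable {G : Matrix (Fin d) (Fin d) ℝ}

lemma latticeArea_pos (hd : 2 < d) (hG : IsGram G) (x : HermiteIndex × Cosets d 2) :
    0 < latticeArea hd G x := by
  have h1 : (0 : ℝ) < x.1.1 := by exact_mod_cast x.1.1.pos
  have h2 : (0 : ℝ) < x.1.2.1.1 := by exact_mod_cast x.1.2.1.1.pos
  have h3 := Real.sqrt_pos.2 (cosetDet_pos hd hG x.2)
  unfold latticeArea
  positivity

lemma exists_latticeArea_lower_bound (hd : 2 < d) (hG : IsGram G) :
    ∃ κ : ℝ, 0 < κ ∧ ∀ x, κ ≤ latticeArea hd G x := by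
  obtain ⟨κ, hκ, h⟩ := exists_cosetDet_lower_bound hd hG
  refine ⟨Real.sqrt κ, Real.sqrt_pos.2 hκ, fun x => ?_⟩
  have h1 : (1 : ℝ) ≤ x.1.1 := by exact_mod_cast x.1.1.pos
  have h2 : (1 : ℝ) ≤ x.1.2.1.1 := by exact_mod_cast x.1.2.1.1.pos
  exact (Real.sqrt_le_sqrt (h x.2)).trans
    (le_mul_of_one_le_left (Real.sqrt_nonneg _) (one_le_mul_of_one_le_of_one_le h1 h2))

lemma two_lt_sq (hd : 2 < d) : (2 : ℝ) < (d : ℝ) ^ 2 := by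
  have : (2 : ℝ) < d := by exact_mod_cast hd
  nlinarith

lemma summable_latticeArea_rpow (hd : 2 < d) (hG : IsGram G) {r : ℝ} (hr : (d : ℝ) ^ 2 < r) :
    Summable fun x => latticeArea hd G x ^ (-r) := by
  have h1 := (summable_hermite_rpow (r := r) (by linarith [two_lt_sq hd])).mul_of_nonneg
    (summable_cosetDet_rpow hd hG (r := r / 2) (by linarith))
    (fun x => mul_nonneg (Real.rpow_nonneg (by positivity) _) (Real.rpow_nonneg (by positivity) _))
    (fun c => Real.rpow_nonneg (cosetDet_pos hd hG c).le _)
  refine h1.congr fun x => ?_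
  rw [latticeArea, Real.mul_rpow (by positivity) (Real.sqrt_nonneg _),
    Real.mul_rpow (by positivity) (by positivity), Real.sqrt_eq_rpow,
    ← Real.rpow_mul (cosetDet_pos hd hG x.2).le]
  congr 2; ring

lemma summable_cosetDet_cpow (hd : 2 < d) (hG : IsGram G) {s : ℂ} (hs : (d : ℝ) ^ 2 < 2 * s.re) :
    Summable fun c : Cosets d 2 => (cosetDet hd.le G c : ℂ) ^ (-s) := by
  refine Summable.of_norm ((summable_cosetDet_rpow hd hG hs).congr fun c => ?_)
  rw [Complex.norm_cpow_eq_rpow_re_of_pos (cosetDet_pos hd hG c)]; rfl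

lemma hasSum_latticeArea_cpow (hd : 2 < d) (hG : IsGram G) {s : ℂ}
    (hs : (d : ℝ) ^ 2 < 2 * s.re) :
    HasSum (fun x => (latticeArea hd G x : ℂ) ^ (-(2 * s)))
      (2 * riemannZeta (2 * s) * riemannZeta (2 * s - 1) *
        ∑' c : Cosets d 2, (cosetDet hd.le G c : ℂ) ^ (-s)) := by
  have hre : (2 * s).re = 2 * s.re := by simp
  have hterm : ∀ x : HermiteIndex × Cosets d 2, (latticeArea hd G x : ℂ) ^ (-(2 * s)) =
      ((x.1.1 : ℂ) ^ (-(2 * s)) * (x.1.2.1.1 : ℂ) ^ (-(2 * s))) *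
        (cosetDet hd.le G x.2 : ℂ) ^ (-s) := by
    intro x
    have hD := cosetDet_pos hd hG x.2
    rw [latticeArea, Complex.ofReal_mul, Complex.mul_cpow_ofReal_nonneg (by positivity)
      (Real.sqrt_nonneg _), Complex.ofReal_mul, Complex.mul_cpow_ofReal_nonneg (by positivity)
      (by positivity), Complex.ofReal_natCast, Complex.ofReal_natCast]
    congr 1
    have h2 : cosetDet hd.le G x.2 =
        Real.sqrt (cosetDet hd.le G x.2) * Real.sqrt (cosetDet hd.le G x.2) :=
      (Real.mul_self_sqrt hD.le).symm
    have h3 : (Real.sqrt (cosetDet hd.le G x.2) : ℂ) ≠ 0 := by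
      exact_mod_cast (Real.sqrt_pos.2 hD).ne'
    conv_rhs => rw [h2, Complex.ofReal_mul, Complex.mul_cpow_ofReal_nonneg (Real.sqrt_nonneg _)
      (Real.sqrt_nonneg _), ← Complex.cpow_add _ _ h3]
    congr 1; ring
  have h1 := hasSum_hermite_cpow (w := 2 * s) (by rw [hre]; linarith [two_lt_sq hd])
  have h2 := (summable_cosetDet_cpow hd hG hs).hasSum
  exact (hasSum_prod_mul h1 h2 (Summable.norm h1.summable) (Summable.norm h2.summable)).congr_fun
    hterm

lemma measurable_latExp (X : Matrix (Fin d) (Fin d) ℝ) (M : Matrix (Fin 2) (Fin d) ℤ) :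
    Measurable fun τ : ℍ => latExp τ X M := by
  have hre : Measurable fun z : ℍ => z.re := Complex.measurable_re.comp measurable_coe
  have him : Measurable fun z : ℍ => z.im := Complex.measurable_im.comp measurable_coe
  unfold latExp binForm
  fun_prop

lemma lintegral_latExp (hG : IsGram G) (M : RankTwo d) {u : ℝ} (hu : 0 < u) :
    ∫⁻ τ : ℍ, ENNReal.ofReal (latExp τ (u • G) M.1) =
      ENNReal.ofReal (Real.exp (-2 * Real.pi * (u * Real.sqrt (rowGram G M.1).det)) /
        (u * Real.sqrt (rowGram G M.1).det)) := by
  have hs : rowGram G M.1 1 0 = rowGram G M.1 0 1 :=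
    congrFun (congrFun (rowGram_symm hG.transpose M.1) 0) 1
  have hdet := det_rowGram_pos hG M
  have h := lintegral_exp_form (A := u * rowGram G M.1 0 0) (B := u * rowGram G M.1 0 1)
    (C := u * rowGram G M.1 1 1) (D := u ^ 2 * (rowGram G M.1).det)
    (mul_pos hu (rowGram_one_one_pos hG M)) (by positivity)
    (by rw [Matrix.det_fin_two, hs]; ring)
  rw [Real.sqrt_mul (by positivity), Real.sqrt_sq hu.le] at h
  rw [← h]
  refine lintegral_congr fun τ => ?_
  rw [latExp, rowGram_smul, binForm]
  rfl

lemma sqrt_det_rowGram_hermite (hd : 2 < d) (x : HermiteIndex × Cosets d 2) :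
    Real.sqrt (rowGram G (hermiteMatrix x.1 * cosetRows hd.le x.2)).det = latticeArea hd G x := by
  rw [det_rowGram_mul, Real.sqrt_mul (sq_nonneg _), Real.sqrt_sq_eq_abs, latticeArea,
    det_hermiteMatrix]
  congr 1
  have h1 : |(((x.1.2.2 : ℤˣ) : ℤ) : ℝ)| = 1 := by
    rcases Int.units_eq_one_or x.1.2.2 with h | h <;> simp [h]
  push_cast
  rw [abs_mul, h1, one_mul, abs_of_nonneg (by positivity)]

/-- The rank-two matrices split into free left orbits of `SL(2, ℤ)`, indexed by a Hermite form and a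
coset. By `latExp_SL2Z_smul` the flipped group element moves onto `τ`, so each orbit unfolds to
twice an integral over the half plane. -/
theorem lintegral_thetaTwo (hd : 2 < d) (hG : IsGram G) {u : ℝ} (hu : 0 < u) :
    ∫⁻ τ in fd, ∑' M : RankTwo d, ENNReal.ofReal (latExp τ (u • G) M.1) =
      ∑' x : HermiteIndex × Cosets d 2, 2 * ENNReal.ofReal
        (Real.exp (-2 * Real.pi * (u * latticeArea hd G x)) / (u * latticeArea hd G x)) := by
  have hX : (u • G)ᵀ = u • G := by rw [Matrix.transpose_smul, hG.transpose]
  let e : (HermiteIndex × Cosets d 2) × SL(2, ℤ) ≃ RankTwo d :=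
    (Equiv.prodComm _ _).trans <| (Equiv.prodAssoc _ _ _).symm.trans <|
      (Equiv.prodCongr ((Equiv.prodCongr (flipSL_involutive.toPerm) (Equiv.refl _)).trans
        hermiteEquiv) (Equiv.refl _)).trans (rankTwoEquiv hd)
  have he : ∀ x γ, (e (x, γ)).1 = (flipSL γ : Matrix (Fin 2) (Fin 2) ℤ) *
      (hermiteMatrix x.1 * cosetRows hd.le x.2) := by
    intro x γ
    rw [← Matrix.mul_assoc]
    rfl
  have h1 : ∀ τ : ℍ, ∑' M : RankTwo d, ENNReal.ofReal (latExp τ (u • G) M.1) =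
      ∑' x : HermiteIndex × Cosets d 2, ∑' γ : SL(2, ℤ),
        ENNReal.ofReal (latExp (γ • τ) (u • G) (hermiteMatrix x.1 * cosetRows hd.le x.2)) := by
    intro τ
    rw [← e.tsum_eq, ENNReal.tsum_prod (f := fun x γ =>
      ENNReal.ofReal (latExp τ (u • G) (e (x, γ)).1))]
    refine tsum_congr fun x => tsum_congr fun γ => ?_
    rw [he, latExp_SL2Z_smul γ τ hX]
  have hm : ∀ (M : Matrix (Fin 2) (Fin d) ℤ),
      Measurable fun τ : ℍ => ENNReal.ofReal (latExp τ (u • G) M) :=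
    fun M => (measurable_latExp _ M).ennreal_ofReal
  simp only [h1]
  rw [lintegral_tsum fun x => Measurable.aemeasurable ?_]
  swap
  · exact Measurable.tsum fun γ => (hm (hermiteMatrix x.1 * cosetRows hd.le x.2)).comp
      (measurePreserving_SL2Z_smul γ).measurable
  refine tsum_congr fun x => ?_
  rw [lintegral_fd_tsum (hm _), ← sqrt_det_rowGram_hermite hd x]
  exact congrArg _ (lintegral_latExp hG ⟨_, (rank_mul_cosetRows hd _ x.2).2
    (det_hermiteMatrix_ne_zero x.1)⟩ hu)

/-- The integral of the rank two part of the theta series over the fundamental domain. -/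
def thetaPhi (G : Matrix (Fin d) (Fin d) ℝ) (u : ℝ) : ℝ := ∫ τ in fd, thetaTwo G τ u

lemma summable_bessel (hd : 2 < d) (hG : IsGram G) {u : ℝ} (hu : 0 < u) :
    Summable fun x : HermiteIndex × Cosets d 2 => 2 *
      (Real.exp (-2 * Real.pi * (u * latticeArea hd G x)) / (u * latticeArea hd G x)) := by
  -- The bound `exp(-x) ≤ (d²)! / x^(d²)` together with the denominator gives the exponent `d² + 1`,
  -- the first integer in the range of `summable_latticeArea_rpow`.
  have h1 := (summable_latticeArea_rpow hd hG (r := ((d ^ 2 + 1 : ℕ) : ℝ))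
    (by push_cast; linarith)).mul_left
    (2 * ((d ^ 2 : ℕ).factorial : ℝ) * (2 * Real.pi) ^ (-((d ^ 2 : ℕ) : ℝ)) *
      u ^ (-((d ^ 2 + 1 : ℕ) : ℝ)))
  refine Summable.of_nonneg_of_le (fun x => ?_) (fun x => ?_) h1
  · have := latticeArea_pos hd hG x
    positivity
  · have hδ := latticeArea_pos hd hG x
    have h2 := Real.pow_div_factorial_le_exp (2 * Real.pi * (u * latticeArea hd G x))
      (by positivity) (d ^ 2)
    have h3 : Real.exp (-2 * Real.pi * (u * latticeArea hd G x)) ≤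
        ((d ^ 2 : ℕ).factorial : ℝ) / (2 * Real.pi * (u * latticeArea hd G x)) ^ (d ^ 2) := by
      rw [show -2 * Real.pi * (u * latticeArea hd G x) =
        -(2 * Real.pi * (u * latticeArea hd G x)) by ring, Real.exp_neg, ← inv_div]
      exact inv_anti₀ (by positivity) h2
    calc 2 * (Real.exp (-2 * Real.pi * (u * latticeArea hd G x)) / (u * latticeArea hd G x))
        ≤ 2 * (((d ^ 2 : ℕ).factorial : ℝ) / (2 * Real.pi * (u * latticeArea hd G x)) ^ (d ^ 2) /
          (u * latticeArea hd G x)) := by gcongr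
      _ = _ := by
        rw [Real.rpow_neg (by positivity), Real.rpow_neg (by positivity),
          Real.rpow_neg (by positivity), Real.rpow_natCast, Real.rpow_natCast, Real.rpow_natCast]
        field_simp
        rw [mul_pow, mul_pow, mul_pow, pow_succ, pow_succ]
        ring

lemma thetaTwo_eq_toReal (hG : IsGram G) (τ : ℍ) {u : ℝ} (hu : 0 < u) :
    thetaTwo G τ u = (∑' M : RankTwo d, ENNReal.ofReal (latExp τ (u • G) M.1)).toReal := by
  rw [← ENNReal.ofReal_tsum_of_nonneg (f := fun M : RankTwo d => latExp τ (u • G) M.1)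
    (fun M => (Real.exp_pos _).le) ((summable_latExp hG τ hu).subtype _), ENNReal.toReal_ofReal]
  · rfl
  · exact tsum_nonneg fun M => (Real.exp_pos _).le

instance countable_rankTwo : Countable (RankTwo d) := by
  have : Countable (Matrix (Fin 2) (Fin d) ℤ) := inferInstanceAs (Countable (Fin 2 → Fin d → ℤ))
  exact Subtype.countable

lemma measurable_tsum_latExp (u : ℝ) : Measurable fun τ : ℍ =>
    ∑' M : RankTwo d, ENNReal.ofReal (latExp τ (u • G) M.1) :=
  Measurable.tsum fun M => (measurable_latExp _ M.1).ennreal_ofReal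

lemma lintegral_thetaTwo_eq_ofReal (hd : 2 < d) (hG : IsGram G) {u : ℝ} (hu : 0 < u) :
    ∫⁻ τ in fd, ∑' M : RankTwo d, ENNReal.ofReal (latExp τ (u • G) M.1) =
      ENNReal.ofReal (∑' x : HermiteIndex × Cosets d 2, 2 *
        (Real.exp (-2 * Real.pi * (u * latticeArea hd G x)) / (u * latticeArea hd G x))) := by
  rw [lintegral_thetaTwo hd hG hu, ENNReal.ofReal_tsum_of_nonneg _ (summable_bessel hd hG hu)]
  · refine tsum_congr fun x => ?_
    rw [ENNReal.ofReal_mul zero_le_two, ENNReal.ofReal_ofNat]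
  · intro x
    have := latticeArea_pos hd hG x
    positivity

lemma integrableOn_thetaTwo (hd : 2 < d) (hG : IsGram G) {u : ℝ} (hu : 0 < u) :
    IntegrableOn (fun τ : ℍ => thetaTwo G τ u) fd := by
  simp only [thetaTwo_eq_toReal hG _ hu]
  refine integrable_toReal_of_lintegral_ne_top (measurable_tsum_latExp u).aemeasurable ?_
  rw [lintegral_thetaTwo_eq_ofReal hd hG hu]
  exact ENNReal.ofReal_ne_top

/-- All terms are positive, so the unfolded identity passes from `lintegral` to the Bochner integral
once its value is known to be finite. -/
theorem hasSum_thetaPhi (hd : 2 < d) (hG : IsGram G) {u : ℝ} (hu : 0 < u) :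
    HasSum (fun x : HermiteIndex × Cosets d 2 => 2 *
      (Real.exp (-2 * Real.pi * (u * latticeArea hd G x)) / (u * latticeArea hd G x)))
      (thetaPhi G u) := by
  have h := lintegral_thetaTwo_eq_ofReal hd hG hu
  have h1 : thetaPhi G u = ∑' x : HermiteIndex × Cosets d 2, 2 *
      (Real.exp (-2 * Real.pi * (u * latticeArea hd G x)) / (u * latticeArea hd G x)) := by
    rw [thetaPhi]
    simp only [thetaTwo_eq_toReal hG _ hu]
    rw [integral_toReal (measurable_tsum_latExp u).aemeasurable
      (ae_lt_top (measurable_tsum_latExp u) (by rw [h]; exact ENNReal.ofReal_ne_top)), h,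
      ENNReal.toReal_ofReal]
    refine tsum_nonneg fun x => ?_
    have := latticeArea_pos hd hG x
    positivity
  rw [h1]
  exact (summable_bessel hd hG hu).hasSum

lemma thetaPhi_nonneg (hd : 2 < d) (hG : IsGram G) {u : ℝ} (hu : 0 < u) : 0 ≤ thetaPhi G u :=
  (hasSum_thetaPhi hd hG hu).nonneg fun x => by
    have := latticeArea_pos hd hG x
    positivity

/-- The areas are bounded below by `κ > 0`, so each term is at most `exp(-2πκ(u - 1))` times its
value at `u = 1`. -/
lemma exists_thetaPhi_le (hd : 2 < d) (hG : IsGram G) :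
    ∃ K c : ℝ, 0 < c ∧ ∀ u : ℝ, 1 ≤ u → thetaPhi G u ≤ K * Real.exp (-c * u) := by
  obtain ⟨κ, hκ, h⟩ := exists_latticeArea_lower_bound hd hG
  refine ⟨thetaPhi G 1 * Real.exp (2 * Real.pi * κ), 2 * Real.pi * κ, by positivity, fun u hu => ?_⟩
  have h1 := hasSum_thetaPhi hd hG (by linarith : 0 < u)
  have h2 := (hasSum_thetaPhi hd hG one_pos).mul_right
    (Real.exp (2 * Real.pi * κ) * Real.exp (-(2 * Real.pi * κ) * u))
  rw [mul_assoc]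
  refine hasSum_le (fun x => ?_) h1 h2
  have hδ := latticeArea_pos hd hG x
  have h3 : Real.exp (-2 * Real.pi * (u * latticeArea hd G x)) ≤
      Real.exp (-2 * Real.pi * (1 * latticeArea hd G x)) *
        (Real.exp (2 * Real.pi * κ) * Real.exp (-(2 * Real.pi * κ) * u)) := by
    rw [← Real.exp_add, ← Real.exp_add, Real.exp_le_exp]
    have := mul_nonneg (sub_nonneg.2 hu) (mul_nonneg Real.pi_pos.le (sub_nonneg.2 (h x)))
    nlinarith
  calc 2 * (Real.exp (-2 * Real.pi * (u * latticeArea hd G x)) / (u * latticeArea hd G x))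
      ≤ 2 * (Real.exp (-2 * Real.pi * (1 * latticeArea hd G x)) *
        (Real.exp (2 * Real.pi * κ) * Real.exp (-(2 * Real.pi * κ) * u)) /
          (1 * latticeArea hd G x)) := by gcongr
    _ = _ := by ring

end Delta

/-! ### The functional equation of the integrated theta series -/

section Unfold

open MeasureTheory UpperHalfPlane ModularGroup
open scoped ENNReal

lemma measurable_im_out_smul (c : Cosets 2 1) : Measurable fun τ : ℍ => (c.out • τ).im :=
  (Complex.measurable_im.comp measurable_coe).comp (measurePreserving_SL2Z_smul c.out).measurable

lemma integral_fd_tsum_cosets_of_nonneg {k : ℝ → ℝ} (hk : Measurable k) (h0 : ∀ y, 0 ≤ k y)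
    (hint : IntegrableOn (fun y => k y * (1 / y ^ 2)) (Set.Ioi 0))
    (hs : ∀ τ : ℍ, Summable fun c : Cosets 2 1 => k (c.out • τ).im) :
    IntegrableOn (fun τ : ℍ => ∑' c : Cosets 2 1, k (c.out • τ).im) fd ∧
      ∫ τ in fd, ∑' c : Cosets 2 1, k (c.out • τ).im =
        ∫ y in Set.Ioi (0 : ℝ), k y * (1 / y ^ 2) := by
  have hm : Measurable fun τ : ℍ => ∑' c : Cosets 2 1, ENNReal.ofReal (k (c.out • τ).im) :=
    Measurable.tsum fun c => (hk.comp (measurable_im_out_smul c)).ennreal_ofReal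
  have h1 : ∀ τ : ℍ, ∑' c : Cosets 2 1, k (c.out • τ).im =
      (∑' c : Cosets 2 1, ENNReal.ofReal (k (c.out • τ).im)).toReal := by
    intro τ
    rw [← ENNReal.ofReal_tsum_of_nonneg (fun c => h0 _) (hs τ), ENNReal.toReal_ofReal
      (tsum_nonneg fun c => h0 _)]
  have h2 : ∫⁻ τ in fd, ∑' c : Cosets 2 1, ENNReal.ofReal (k (c.out • τ).im) =
      ENNReal.ofReal (∫ y in Set.Ioi (0 : ℝ), k y * (1 / y ^ 2)) := by
    rw [lintegral_fd_tsum_cosets hk.ennreal_ofReal, ofReal_integral_eq_lintegral_ofReal hint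
      (Filter.Eventually.of_forall fun y => mul_nonneg (h0 y) (by positivity))]
    refine lintegral_congr fun y => ?_
    rw [ENNReal.ofReal_mul (h0 y)]
  simp only [h1]
  refine ⟨integrable_toReal_of_lintegral_ne_top hm.aemeasurable
    (by rw [h2]; exact ENNReal.ofReal_ne_top), ?_⟩
  rw [integral_toReal hm.aemeasurable (ae_lt_top hm (by rw [h2]; exact ENNReal.ofReal_ne_top)), h2,
    ENNReal.toReal_ofReal]
  exact setIntegral_nonneg measurableSet_Ioi fun y _ => mul_nonneg (h0 y) (by positivity)

/-- The kernel needed later changes sign. Its positive and negative parts are dominated by `|k|`, so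
they inherit integrability and summability and unfold separately. -/
theorem integral_fd_tsum_cosets {k : ℝ → ℝ} (hk : Measurable k)
    (hint : IntegrableOn (fun y => k y * (1 / y ^ 2)) (Set.Ioi 0))
    (hs : ∀ τ : ℍ, Summable fun c : Cosets 2 1 => k (c.out • τ).im) :
    IntegrableOn (fun τ : ℍ => ∑' c : Cosets 2 1, k (c.out • τ).im) fd ∧
      ∫ τ in fd, ∑' c : Cosets 2 1, k (c.out • τ).im =
        ∫ y in Set.Ioi (0 : ℝ), k y * (1 / y ^ 2) := by
  have hp : ∀ (f : ℝ → ℝ), Measurable f → (∀ y, 0 ≤ f y) → (∀ y, f y ≤ |k y|) →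
      IntegrableOn (fun y => f y * (1 / y ^ 2)) (Set.Ioi 0) ∧
        ∀ τ : ℍ, Summable fun c : Cosets 2 1 => f (c.out • τ).im := by
    intro f hf h0 hle
    refine ⟨Integrable.mono' hint.norm (by fun_prop) (Filter.Eventually.of_forall fun y => ?_),
      fun τ => Summable.of_nonneg_of_le (fun c => h0 _) (fun c => hle _) (hs τ).abs⟩
    rw [norm_mul, norm_mul, Real.norm_of_nonneg (h0 y), Real.norm_eq_abs (k y)]
    exact mul_le_mul_of_nonneg_right (hle y) (norm_nonneg _)
  have hm1 : Measurable fun y => max (k y) 0 := hk.max measurable_const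
  have hm2 : Measurable fun y => max (-k y) 0 := hk.neg.max measurable_const
  obtain ⟨i1, s1⟩ := hp _ hm1 (fun y => le_max_right _ _)
    (fun y => max_le (le_abs_self _) (abs_nonneg _))
  obtain ⟨i2, s2⟩ := hp _ hm2 (fun y => le_max_right _ _)
    (fun y => max_le (neg_le_abs _) (abs_nonneg _))
  obtain ⟨j1, e1⟩ := integral_fd_tsum_cosets_of_nonneg hm1 (fun y => le_max_right _ _) i1 s1
  obtain ⟨j2, e2⟩ := integral_fd_tsum_cosets_of_nonneg hm2 (fun y => le_max_right _ _) i2 s2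
  have hk' : ∀ y, k y = max (k y) 0 - max (-k y) 0 := fun y => by
    rcases le_total 0 (k y) with h | h
    · rw [max_eq_left h, max_eq_right (by linarith)]; ring
    · rw [max_eq_right h, max_eq_left (by linarith)]; ring
  have h3 : ∀ τ : ℍ, ∑' c : Cosets 2 1, k (c.out • τ).im =
      ∑' c : Cosets 2 1, max (k (c.out • τ).im) 0 - ∑' c : Cosets 2 1, max (-k (c.out • τ).im) 0 := by
    intro τ
    rw [← (s1 τ).tsum_sub (s2 τ)]
    exact tsum_congr fun c => hk' _
  simp only [h3]
  refine ⟨j1.sub j2, ?_⟩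
  rw [integral_sub j1 j2, e1, e2, ← integral_sub i1 i2]
  refine integral_congr_ae (Filter.Eventually.of_forall fun y => ?_)
  change max (k y) 0 * _ - max (-k y) 0 * _ = k y * _
  rw [← sub_mul, ← hk']

end Unfold

/-! ### Regularisation of the rank-one contribution. -/

section CuspConst

open MeasureTheory Matrix

variable {d : ℕ} {G : Matrix (Fin d) (Fin d) ℝ}

lemma measurable_cuspTheta : Measurable (cuspTheta G) := by
  have h : Measurable fun y : ℝ => ∑' m : Fin d → ℤ, Real.exp (-Real.pi * y⁻¹ * intForm G m) :=
    Measurable.tsum fun m => by fun_prop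
  exact h.sub_const 1

lemma dualGram_dualGram (hG : IsGram G) : dualGram (dualGram G) = G := by
  have h : (dualGram G)⁻¹ = G.submatrix Fin.rev Fin.rev := by
    refine Matrix.inv_eq_right_inv ?_
    rw [dualGram, show (Fin.rev : Fin d → Fin d) = Fin.revPerm from rfl,
      Matrix.submatrix_mul_equiv, Matrix.nonsing_inv_mul _ (by rw [hG.det]; exact isUnit_one)]
    simp
  rw [dualGram, h]
  ext i j
  simp

/-- The cusp term `∑ exp (-π G[m] / y)` less its growing part, against the invariant measure. -/
def cuspRem (G : Matrix (Fin d) (Fin d) ℝ) (y : ℝ) : ℝ :=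
  (cuspTheta G y - Set.indicator (Set.Ioi 1) (fun y => y ^ ((d : ℝ) / 2)) y) * (1 / y ^ 2)

lemma measurable_cuspRem : Measurable (cuspRem G) := by
  have h : Measurable (Set.indicator (Set.Ioi (1 : ℝ)) fun y : ℝ => y ^ ((d : ℝ) / 2)) :=
    Measurable.indicator (by fun_prop) measurableSet_Ioi
  exact (measurable_cuspTheta.sub h).mul (by fun_prop)

lemma exp_neg_le_factorial_div_pow {x : ℝ} (hx : 0 < x) (n : ℕ) :
    Real.exp (-x) ≤ n.factorial / x ^ n := by
  rw [Real.exp_neg, ← inv_div]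
  exact inv_anti₀ (by positivity) (Real.pow_div_factorial_le_exp x hx.le n)

/-- On `(0, 1]` the cusp term decays faster than any power of `y`. Beyond `1`, theta inversion
leaves `-1` plus `y^(d/2)` times an exponentially small term, so the remainder is `O(y⁻²)`. -/
lemma integrableOn_cuspRem (hG : IsGram G) : IntegrableOn (cuspRem G) (Set.Ioi 0) := by
  rw [← Set.Ioc_union_Ioi_eq_Ioi (zero_le_one (α := ℝ)), integrableOn_union]
  constructor
  · obtain ⟨K, c, hK, hc, h⟩ := exists_gaussSum_sub_one_le hG
    refine Measure.integrableOn_of_bounded (M := K * (2 / c ^ 2)) (by simp)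
      measurable_cuspRem.aestronglyMeasurable ?_
    refine (ae_restrict_iff' measurableSet_Ioc).2 (Filter.Eventually.of_forall fun y hy => ?_)
    have hy0 : 0 < y := hy.1
    have h1 : cuspTheta G y ≤ K * Real.exp (-c * y⁻¹) := h y⁻¹ ((one_le_inv₀ hy0).2 hy.2)
    have h0 := cuspTheta_nonneg hG hy0
    have h2 := exp_neg_le_factorial_div_pow (mul_pos hc (inv_pos.2 hy0)) 2
    rw [cuspRem, Set.indicator_of_notMem (by simpa using hy.2), sub_zero,
      Real.norm_of_nonneg (by positivity)]
    calc cuspTheta G y * (1 / y ^ 2) ≤ K * ((Nat.factorial 2 : ℝ) / (c * y⁻¹) ^ 2) * (1 / y ^ 2) := by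
          refine mul_le_mul_of_nonneg_right (h1.trans ?_) (by positivity)
          refine mul_le_mul_of_nonneg_left ?_ hK.le
          rwa [← neg_mul] at h2
      _ = K * (2 / c ^ 2) := by
          simp only [Nat.factorial]
          field_simp
          push_cast; ring
  · obtain ⟨K, c, hK, hc, h⟩ := exists_gaussSum_sub_one_le hG.dualGram
    have hint := (integrableOn_Ioi_rpow_of_lt (a := -2) (by norm_num) one_pos).const_mul
      (K * (d.factorial / c ^ d) + 1)
    refine Integrable.mono' hint measurable_cuspRem.aestronglyMeasurable ?_
    refine (ae_restrict_iff' measurableSet_Ioi).2 (Filter.Eventually.of_forall fun y hy => ?_)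
    have hy1 : (1 : ℝ) < y := hy
    have hy0 : 0 < y := by linarith
    have h1 : cuspTheta (dualGram G) y⁻¹ ≤ K * Real.exp (-c * y) := by
      have := h y hy1.le
      rwa [cuspTheta, inv_inv]
    have h0 := cuspTheta_nonneg hG.dualGram (inv_pos.2 hy0)
    have h2 := exp_neg_le_factorial_div_pow (mul_pos hc hy0) d
    have hyd : y ^ ((d : ℝ) / 2) ≤ y ^ d := by
      rw [← Real.rpow_natCast]
      refine Real.rpow_le_rpow_of_exponent_le hy1.le ?_
      have : (0 : ℝ) ≤ d := by positivity
      linarith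
    have h3 : y ^ ((d : ℝ) / 2) * cuspTheta (dualGram G) y⁻¹ ≤ K * (d.factorial / c ^ d) := by
      calc y ^ ((d : ℝ) / 2) * cuspTheta (dualGram G) y⁻¹
          ≤ y ^ d * (K * (d.factorial / (c * y) ^ d)) := by
            refine mul_le_mul hyd (h1.trans ?_) h0 (by positivity)
            refine mul_le_mul_of_nonneg_left ?_ hK.le
            rwa [← neg_mul] at h2
        _ = _ := by rw [mul_pow]; field_simp
    have h4 : 0 ≤ y ^ ((d : ℝ) / 2) * cuspTheta (dualGram G) y⁻¹ := by positivity
    rw [cuspRem, Set.indicator_of_mem (show y ∈ Set.Ioi (1 : ℝ) from hy), cuspTheta_inv hG hy0, norm_mul,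
      Real.norm_of_nonneg (show 0 ≤ 1 / y ^ 2 by positivity), Real.rpow_neg hy0.le, Real.rpow_two,
      one_div (y ^ 2)]
    refine mul_le_mul_of_nonneg_right ?_ (by positivity)
    rw [Real.norm_eq_abs, abs_le]
    constructor <;> nlinarith

/-- The constant that the rank one terms contribute to the functional equation. -/
def cuspConst (G : Matrix (Fin d) (Fin d) ℝ) : ℝ :=
  (∫ y in Set.Ioi (0 : ℝ), cuspRem G y) - 1 / ((d : ℝ) / 2 - 1)

/-- Rescaling moves the cut at `1` to `u⁻¹` in one term and to `u` in the other. Both growing parts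
are `u^(-d/2) y^(d/2)`, so they cancel beyond `u` and survive only on `(u⁻¹, u]`. -/
lemma cusp_kernel_eq {u y : ℝ} (hu : 1 ≤ u) (hy : 0 < y) (G G' : Matrix (Fin d) (Fin d) ℝ) :
    (u ^ (-(d : ℝ)) * cuspTheta G' (y * u) - cuspTheta G (y / u)) * (1 / y ^ 2) =
      u ^ (-(d : ℝ)) * u ^ 2 * cuspRem G' (u * y) - (u ^ 2)⁻¹ * cuspRem G (u⁻¹ * y) +
        Set.indicator (Set.Ioc u⁻¹ u)
          (fun y => u ^ (-((d : ℝ) / 2)) * y ^ ((d : ℝ) / 2 - 2)) y := by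
  have hu0 : 0 < u := by linarith
  have hpow : y ^ ((d : ℝ) / 2 - 2) = y ^ ((d : ℝ) / 2) / y ^ 2 := by
    rw [Real.rpow_sub hy, Real.rpow_two]
  have e1 : (u * y) ^ ((d : ℝ) / 2) * u ^ (-(d : ℝ)) = u ^ (-((d : ℝ) / 2)) * y ^ ((d : ℝ) / 2) := by
    rw [Real.mul_rpow hu0.le hy.le, mul_right_comm, ← Real.rpow_add hu0]
    congr 2; ring
  have e2 : (u⁻¹ * y) ^ ((d : ℝ) / 2) = u ^ (-((d : ℝ) / 2)) * y ^ ((d : ℝ) / 2) := by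
    rw [Real.mul_rpow (by positivity) hy.le, Real.inv_rpow hu0.le, Real.rpow_neg hu0.le]
  have i1 : (1 < u * y) ↔ u⁻¹ < y := by rw [inv_lt_iff_one_lt_mul₀' hu0]
  have i2 : (1 < u⁻¹ * y) ↔ u < y := by
    rw [inv_mul_eq_div, lt_div_iff₀ hu0, one_mul]
  have hinv : u⁻¹ ≤ u := (inv_le_one_of_one_le₀ hu).trans hu
  simp only [cuspRem, Set.indicator_apply, Set.mem_Ioi, Set.mem_Ioc, i1, i2]
  rw [mul_comm y u, div_eq_inv_mul y u]
  by_cases h1 : u⁻¹ < y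
  · by_cases h2 : u < y
    · simp only [h1, h2, not_le.2 h2, if_true, and_false, if_false, e2]
      field_simp
      linear_combination e1
    · simp only [h1, h2, not_lt.1 h2, if_true, and_true, if_false, hpow]
      field_simp
      linear_combination e1
  · have h2 : ¬ u < y := fun h => h1 (hinv.trans_lt h)
    simp only [h1, h2, false_and, if_false]
    field_simp
    ring

/-- The part on `(u⁻¹, u]` integrates to `(u⁻¹ - u^(1-d)) / (d/2 - 1)`; the constant subtracted in
`cuspConst` absorbs these two boundary terms. -/
lemma integral_cusp_kernel (hd : 2 < d) (hG : IsGram G) {u : ℝ} (hu : 1 ≤ u) :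
    IntegrableOn (fun y => (u ^ (-(d : ℝ)) * cuspTheta (dualGram G) (y * u) - cuspTheta G (y / u)) *
        (1 / y ^ 2)) (Set.Ioi 0) ∧
    ∫ y in Set.Ioi (0 : ℝ), (u ^ (-(d : ℝ)) * cuspTheta (dualGram G) (y * u) - cuspTheta G (y / u)) *
        (1 / y ^ 2) =
      u ^ (1 - (d : ℝ)) * cuspConst (dualGram G) - u⁻¹ * cuspConst G := by
  have hu0 : 0 < u := by linarith
  have hd' : (2 : ℝ) < d := by exact_mod_cast hd
  have hinv : u⁻¹ ≤ u := (inv_le_one_of_one_le₀ hu).trans hu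
  have r1 : IntegrableOn (fun y => u ^ (-(d : ℝ)) * u ^ 2 * cuspRem (dualGram G) (u * y))
      (Set.Ioi 0) := by
    refine Integrable.const_mul ?_ _
    refine (integrableOn_Ioi_comp_mul_left_iff (cuspRem (dualGram G)) 0 hu0).2 ?_
    rw [mul_zero]; exact integrableOn_cuspRem hG.dualGram
  have r2 : IntegrableOn (fun y => (u ^ 2)⁻¹ * cuspRem G (u⁻¹ * y)) (Set.Ioi 0) := by
    refine Integrable.const_mul ?_ _
    refine (integrableOn_Ioi_comp_mul_left_iff (cuspRem G) 0 (inv_pos.2 hu0)).2 ?_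
    rw [mul_zero]; exact integrableOn_cuspRem hG
  have hsub : Set.Ioc u⁻¹ u ⊆ Set.Ioi 0 := fun y hy => (inv_pos.2 hu0).trans hy.1
  have hpint : IntegrableOn (fun y : ℝ => u ^ (-((d : ℝ) / 2)) * y ^ ((d : ℝ) / 2 - 2))
      (Set.Ioc u⁻¹ u) := by
    refine Integrable.const_mul ?_ _
    have := intervalIntegral.intervalIntegrable_rpow' (a := u⁻¹) (b := u) (r := (d : ℝ) / 2 - 2)
      (by linarith)
    exact (intervalIntegrable_iff_integrableOn_Ioc_of_le hinv).1 this
  have r3 : IntegrableOn (Set.indicator (Set.Ioc u⁻¹ u)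
      (fun y : ℝ => u ^ (-((d : ℝ) / 2)) * y ^ ((d : ℝ) / 2 - 2))) (Set.Ioi 0) :=
    ((integrable_indicator_iff measurableSet_Ioc).2 hpint).integrableOn
  have r12 : IntegrableOn (fun y => u ^ (-(d : ℝ)) * u ^ 2 * cuspRem (dualGram G) (u * y) -
      (u ^ 2)⁻¹ * cuspRem G (u⁻¹ * y)) (Set.Ioi 0) := r1.sub r2
  have hcongr : Set.EqOn (fun y => (u ^ (-(d : ℝ)) * cuspTheta (dualGram G) (y * u) -
      cuspTheta G (y / u)) * (1 / y ^ 2)) _ (Set.Ioi 0) := fun y hy =>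
    cusp_kernel_eq hu hy G (dualGram G)
  refine ⟨IntegrableOn.congr_fun (r12.add r3) hcongr.symm measurableSet_Ioi, ?_⟩
  rw [setIntegral_congr_fun measurableSet_Ioi hcongr, integral_add r12 r3,
    integral_sub r1 r2, integral_const_mul, integral_const_mul,
    integral_comp_mul_left_Ioi _ _ hu0, integral_comp_mul_left_Ioi _ _ (inv_pos.2 hu0), mul_zero,
    mul_zero, setIntegral_indicator measurableSet_Ioc, Set.inter_eq_self_of_subset_right hsub,
    integral_const_mul, ← intervalIntegral.integral_of_le hinv,
    integral_rpow (Or.inl (by linarith)), cuspConst, cuspConst, inv_inv]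
  have hp : (d : ℝ) / 2 - 2 + 1 = (d : ℝ) / 2 - 1 := by ring
  have f1 : u ^ (1 - (d : ℝ)) = u ^ (-(d : ℝ)) * u := by
    rw [show 1 - (d : ℝ) = -(d : ℝ) + 1 by ring, Real.rpow_add hu0, Real.rpow_one]
  have f2 : u ^ (-((d : ℝ) / 2)) * u ^ ((d : ℝ) / 2 - 1) = u⁻¹ := by
    rw [← Real.rpow_add hu0, ← Real.rpow_neg_one]; congr 1; ring
  have f3 : u ^ (-((d : ℝ) / 2)) * u⁻¹ ^ ((d : ℝ) / 2 - 1) = u ^ (-(d : ℝ)) * u := by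
    rw [Real.inv_rpow hu0.le, ← Real.rpow_neg hu0.le, ← Real.rpow_add hu0, ← f1]; congr 1; ring
  rw [hp, mul_div_assoc', mul_sub, f2, f3, f1, smul_eq_mul, smul_eq_mul]
  field_simp
  ring

end CuspConst

/-! ### Functional equation of the integrated rank-two theta series. -/

section FunctionalEquation

open MeasureTheory UpperHalfPlane ModularGroup Matrix

variable {d : ℕ} {G : Matrix (Fin d) (Fin d) ℝ}

/-- The functional equation of the integrated rank two theta series. -/
theorem thetaPhi_inv (hd : 2 < d) (hG : IsGram G) {u : ℝ} (hu : 1 ≤ u) :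
    thetaPhi G u = u ^ (-(d : ℝ)) * thetaPhi (dualGram G) u⁻¹ +
      (u ^ (-(d : ℝ)) - 1) * volume.real fd +
      (u ^ (1 - (d : ℝ)) * cuspConst (dualGram G) - u⁻¹ * cuspConst G) := by
  have hu0 : 0 < u := by linarith
  obtain ⟨hint, hval⟩ := integral_cusp_kernel hd hG hu
  have hk : Measurable fun y : ℝ =>
      u ^ (-(d : ℝ)) * cuspTheta (dualGram G) (y * u) - cuspTheta G (y / u) :=
    ((measurable_cuspTheta.comp (measurable_id.mul_const u)).const_mul _).sub
      (measurable_cuspTheta.comp (measurable_id.div_const u))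
  have hs : ∀ τ : ℍ, Summable fun c : Cosets 2 1 => u ^ (-(d : ℝ)) *
      cuspTheta (dualGram G) ((c.out • τ).im * u) - cuspTheta G ((c.out • τ).im / u) := by
    intro τ
    have s2 := summable_cuspTheta hG.dualGram τ (inv_pos.2 hu0)
    simp only [div_inv_eq_mul] at s2
    exact (s2.mul_left _).sub (summable_cuspTheta hG τ hu0)
  -- The two cusp sums must be integrated together: each alone grows like `y^(d/2)` at the cusp,
  -- which is not integrable against `dy/y²`.
  obtain ⟨j, e⟩ := integral_fd_tsum_cosets hk hint hs
  rw [← hval, ← e, thetaPhi]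
  simp only [thetaTwo_inv hG _ hu0]
  have i1 := (integrableOn_thetaTwo hd hG.dualGram (inv_pos.2 hu0)).const_mul (u ^ (-(d : ℝ)))
  have i2 : IntegrableOn (fun _ : ℍ => u ^ (-(d : ℝ)) - 1) fd :=
    integrableOn_const volume_fd_lt_top.ne
  have i12 : IntegrableOn (fun τ : ℍ => u ^ (-(d : ℝ)) * thetaTwo (dualGram G) τ u⁻¹ +
      (u ^ (-(d : ℝ)) - 1)) fd := i1.add i2
  rw [integral_add i12 j, integral_add i1 i2, integral_const_mul, setIntegral_const,
    smul_eq_mul, thetaPhi]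
  ring

end FunctionalEquation

/-! ### Uniqueness of meromorphic continuations -/

section Meromorphic

open Filter Topology Set

/-- Identity theorem: the order of `f - g` is infinite at a point of the half plane, hence at every
point of the connected plane. -/
lemma eventuallyEq_nhdsNE_of_eqOn_halfPlane {f g : ℂ → ℂ} (hf : MeromorphicOn f univ)
    (hg : MeromorphicOn g univ) {σ : ℝ} (h : ∀ s : ℂ, σ < s.re → f s = g s) (z : ℂ) :
    f =ᶠ[𝓝[≠] z] g := by
  have hfg : MeromorphicOn (f - g) univ := hf.sub hg
  have h0 : meromorphicOrderAt (f - g) ((σ + 1 : ℝ) : ℂ) = ⊤ := by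
    rw [meromorphicOrderAt_eq_top_iff]
    have hopen : IsOpen {s : ℂ | σ < s.re} := isOpen_lt continuous_const Complex.continuous_re
    have hmem : ((σ + 1 : ℝ) : ℂ) ∈ {s : ℂ | σ < s.re} := by
      change σ < (((σ + 1 : ℝ) : ℂ)).re
      rw [Complex.ofReal_re]; linarith
    filter_upwards [nhdsWithin_le_nhds (hopen.mem_nhds hmem)] with s hs
    simp [h s hs]
  have hz : meromorphicOrderAt (f - g) z = ⊤ := by
    by_contra hne
    exact (hfg.meromorphicOrderAt_ne_top_of_isPreconnected isPreconnected_univ (mem_univ z)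
      (mem_univ _) hne) h0
  rw [meromorphicOrderAt_eq_top_iff] at hz
  filter_upwards [hz] with s hs
  exact sub_eq_zero.1 hs

lemma eventuallyEq_codiscrete_of_eqOn_halfPlane {f g : ℂ → ℂ} (hf : MeromorphicOn f univ)
    (hg : MeromorphicOn g univ) {σ : ℝ} (h : ∀ s : ℂ, σ < s.re → f s = g s) :
    f =ᶠ[codiscrete ℂ] g := by
  refine mem_codiscrete.2 fun z => ?_
  rw [disjoint_principal_right, compl_compl]
  exact eventuallyEq_nhdsNE_of_eqOn_halfPlane hf hg h z

/-- In normal form the value at a point is determined by the germ on the punctured neighbourhood, so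
equality also holds at poles. -/
lemma eq_of_eqOn_halfPlane {f g : ℂ → ℂ} (hf : MeromorphicNFOn f univ)
    (hg : MeromorphicNFOn g univ) {σ : ℝ} (h : ∀ s : ℂ, σ < s.re → f s = g s) : f = g := by
  funext z
  exact (((hf (mem_univ z)).eventuallyEq_nhdsNE_iff_eventuallyEq_nhds (hg (mem_univ z))).1
    (eventuallyEq_nhdsNE_of_eqOn_halfPlane hf.meromorphicOn hg.meromorphicOn h z)).eq_of_nhds

/-- Uniqueness makes the function picked by choice equal to any known continuation, whatever half
plane either is attached to. -/
lemma meromorphicContinuation_eq {f F : ℂ → ℂ} {σ : ℝ} (h : IsMeromorphicContinuation σ f F) :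
    meromorphicContinuation f = F := by
  have hex : ∃ F : ℂ → ℂ, ∃ σ : ℝ, IsMeromorphicContinuation σ f F := ⟨F, σ, h⟩
  rw [meromorphicContinuation, dif_pos hex]
  obtain ⟨σ', h'⟩ := hex.choose_spec
  refine eq_of_eqOn_halfPlane (σ := max σ σ') h'.1 h.1 fun s hs => ?_
  rw [h'.2 s (lt_of_le_of_lt (le_max_right _ _) hs), h.2 s (lt_of_le_of_lt (le_max_left _ _) hs)]

lemma toMeromorphicNFOn_apply_of_analyticAt {M : ℂ → ℂ} (hM : MeromorphicOn M univ) {z : ℂ}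
    (hz : AnalyticAt ℂ M z) : toMeromorphicNFOn M univ z = M z := by
  rw [toMeromorphicNFOn_eq_toMeromorphicNFAt hM (mem_univ z),
    toMeromorphicNFAt_eq_self.2 hz.meromorphicNFAt]

/-- A function that agrees on a half plane with a meromorphic function without poles there has a
meromorphic continuation. -/
theorem meromorphicContinuation_eq_toMeromorphicNFOn {f M : ℂ → ℂ} {σ : ℝ}
    (hM : MeromorphicOn M univ) (ha : ∀ s : ℂ, σ < s.re → AnalyticAt ℂ M s)
    (h : ∀ s : ℂ, σ < s.re → f s = M s) :
    meromorphicContinuation f = toMeromorphicNFOn M univ ∧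
      IsMeromorphicContinuation σ f (meromorphicContinuation f) := by
  have h1 : IsMeromorphicContinuation σ f (toMeromorphicNFOn M univ) :=
    ⟨meromorphicNFOn_toMeromorphicNFOn _ _, fun s hs => by
      rw [toMeromorphicNFOn_apply_of_analyticAt hM (ha s hs), h s hs]⟩
  have h2 := meromorphicContinuation_eq h1
  exact ⟨h2, by rw [h2]; exact h1⟩

end Meromorphic

/-! ### The completed zeta function outside the critical strip. -/

section CompletedZeta

open Set

lemma meromorphicAt_completedRiemannZeta (z : ℂ) : MeromorphicAt completedRiemannZeta z := by
  have h : completedRiemannZeta = fun s => completedRiemannZeta₀ s - 1 / s - 1 / (1 - s) := by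
    funext s; exact completedRiemannZeta_eq s
  rw [h]
  have h0 : MeromorphicAt completedRiemannZeta₀ z :=
    (differentiable_completedZeta₀.analyticAt z).meromorphicAt
  have h1 : MeromorphicAt (fun s : ℂ => s) z := analyticAt_id.meromorphicAt
  exact (h0.sub ((MeromorphicAt.const 1 z).div h1)).sub
    ((MeromorphicAt.const 1 z).div ((MeromorphicAt.const 1 z).sub h1))

lemma analyticAt_completedRiemannZeta {z : ℂ} (h0 : z ≠ 0) (h1 : z ≠ 1) :
    AnalyticAt ℂ completedRiemannZeta z := by
  rw [Complex.analyticAt_iff_eventually_differentiableAt]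
  filter_upwards [isOpen_ne.mem_nhds h0, isOpen_ne.mem_nhds h1] with s hs0 hs1
  exact differentiableAt_completedZeta hs0 hs1

lemma completedRiemannZeta_ne_zero {z : ℂ} (hz : 1 < z.re) : completedRiemannZeta z ≠ 0 := by
  have hz0 : z ≠ 0 := by rintro rfl; simp at hz; linarith
  intro h
  have := riemannZeta_def_of_ne_zero hz0
  rw [h, zero_div] at this
  exact riemannZeta_ne_zero_of_one_le_re hz.le this

lemma ne_zero_one_of_one_lt_re {z : ℂ} (hz : 1 < z.re) : z ≠ 0 ∧ z ≠ 1 := by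
  constructor
  · rintro rfl; simp at hz; linarith
  · rintro rfl; simp at hz

/-- Away from the critical strip, the completed zeta function is analytic and does not vanish. -/
lemma completedRiemannZeta_regular {z : ℂ} (hz : 1 < z.re ∨ z.re < 0) :
    AnalyticAt ℂ completedRiemannZeta z ∧ completedRiemannZeta z ≠ 0 := by
  rcases hz with hz | hz
  · obtain ⟨h0, h1⟩ := ne_zero_one_of_one_lt_re hz
    exact ⟨analyticAt_completedRiemannZeta h0 h1, completedRiemannZeta_ne_zero hz⟩
  · refine ⟨analyticAt_completedRiemannZeta ?_ ?_, ?_⟩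
    · rintro rfl; simp at hz
    · rintro rfl; simp at hz; linarith
    · rw [← completedRiemannZeta_one_sub]
      exact completedRiemannZeta_ne_zero (by simp; linarith)

/-- This is the duplication formula, in the form `Gammaℝ s * Gammaℝ (s + 1) = Gammaℂ s`. -/
lemma completedRiemannZeta_mul {s : ℂ} (hs : 1 < s.re) :
    completedRiemannZeta (s + 1) * completedRiemannZeta s =
      2 * (2 * Real.pi : ℂ) ^ (-s) * Complex.Gamma s * (riemannZeta (s + 1) * riemannZeta s) := by
  have h1 : s ≠ 0 := (ne_zero_one_of_one_lt_re hs).1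
  have hs2 : 0 < (s + 1).re := by simp; linarith
  have h2 : s + 1 ≠ 0 := by intro h; rw [h] at hs2; simp at hs2
  rw [riemannZeta_def_of_ne_zero h1, riemannZeta_def_of_ne_zero h2, ← Complex.Gammaℂ,
    ← Complex.Gammaℝ_mul_Gammaℝ_add_one]
  have g1 := Complex.Gammaℝ_ne_zero_of_re_pos (by linarith : 0 < s.re)
  have g2 := Complex.Gammaℝ_ne_zero_of_re_pos hs2
  field_simp

end CompletedZeta

/-! ### The Mellin transform of the integrated theta series -/

section Mellin

open MeasureTheory Matrix Set Filter Topology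

lemma hasMellin_add_of_hasMellin {f g : ℝ → ℂ} {s m n : ℂ} (hf : HasMellin f s m) (hg : HasMellin g s n) :
    HasMellin (fun t => f t + g t) s (m + n) := by
  have := hasMellin_add hf.1 hg.1
  rwa [hf.2, hg.2] at this

lemma hasMellin_const_mul {f : ℝ → ℂ} {s m : ℂ} (hf : HasMellin f s m) (c : ℂ) :
    HasMellin (fun t => c * f t) s (c * m) := by
  have := hasMellin_const_smul hf.1 c
  rwa [hf.2] at this

/-- The decomposition of `thetaPhi` cut at `1` need not hold at `u = 1` itself, which is a null set.
-/
lemma hasMellin_congr_off_one {f g : ℝ → ℂ} {s m : ℂ} (hf : HasMellin f s m)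
    (h : ∀ t : ℝ, 0 < t → t ≠ 1 → f t = g t) : HasMellin g s m := by
  have hae : (fun t : ℝ => (t : ℂ) ^ (s - 1) • f t) =ᵐ[volume.restrict (Ioi 0)]
      fun t : ℝ => (t : ℂ) ^ (s - 1) • g t := by
    refine (ae_restrict_iff' measurableSet_Ioi).2 ?_
    have h1 : ∀ᵐ t : ℝ, t ≠ 1 := by
      exact Measure.ae_ne volume 1
    filter_upwards [h1] with t ht h0
    rw [h t h0 ht]
  refine ⟨?_, ?_⟩
  · exact Integrable.congr hf.1 hae
  · rw [← hf.2, mellin, mellin]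
    exact (integral_congr_ae hae).symm

variable {d : ℕ} {G : Matrix (Fin d) (Fin d) ℝ}

/-- The functional equation for all positive arguments. -/
theorem thetaPhi_inv_of_pos (hd : 2 < d) (hG : IsGram G) {u : ℝ} (hu : 0 < u) :
    thetaPhi G u = u ^ (-(d : ℝ)) * thetaPhi (dualGram G) u⁻¹ +
      (u ^ (-(d : ℝ)) - 1) * volume.real ModularGroup.fd +
      (u ^ (1 - (d : ℝ)) * cuspConst (dualGram G) - u⁻¹ * cuspConst G) := by
  rcases le_total 1 u with h | h
  · exact thetaPhi_inv hd hG h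
  -- For `u ≤ 1` the equation for the dual form at `u⁻¹` is solved for `thetaPhi G u`; the relation
  -- is its own inverse.
  · have h1 := thetaPhi_inv hd hG.dualGram ((one_le_inv₀ hu).2 h)
    rw [dualGram_dualGram hG, inv_inv, Real.inv_rpow hu.le, Real.inv_rpow hu.le] at h1
    have e1 : u ^ (-(d : ℝ)) = (u ^ (d : ℝ))⁻¹ := Real.rpow_neg hu.le _
    have e2 : u ^ (1 - (d : ℝ)) = u * (u ^ (d : ℝ))⁻¹ := by
      rw [sub_eq_add_neg, Real.rpow_add hu, Real.rpow_one, e1]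
    have hp : 0 < u ^ (d : ℝ) := Real.rpow_pos_of_pos hu _
    rw [h1, e1, e2]
    field_simp
    ring

/-- The part of the integrated theta series above one. -/
def thetaTail (G : Matrix (Fin d) (Fin d) ℝ) (u : ℝ) : ℂ :=
  indicator (Ioi (1 : ℝ)) (fun u => (thetaPhi G u : ℂ)) u

lemma measurable_thetaTail (hd : 2 < d) (hG : IsGram G) : Measurable (thetaTail G) := by
  have h1 : Measurable fun u : ℝ => ∑' x : HermiteIndex × Cosets d 2, 2 *
      (Real.exp (-2 * Real.pi * (u * latticeArea hd G x)) / (u * latticeArea hd G x)) :=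
    Measurable.tsum fun x => by fun_prop
  have h2 : thetaTail G = indicator (Ioi (1 : ℝ)) fun u => ((∑' x : HermiteIndex × Cosets d 2, 2 *
      (Real.exp (-2 * Real.pi * (u * latticeArea hd G x)) /
        (u * latticeArea hd G x)) : ℝ) : ℂ) := by
    refine indicator_congr fun u hu => ?_
    rw [(hasSum_thetaPhi hd hG (zero_lt_one.trans hu)).tsum_eq]
  rw [h2]
  exact (Complex.measurable_ofReal.comp h1).indicator measurableSet_Ioi

lemma exists_norm_thetaTail_le (hd : 2 < d) (hG : IsGram G) :
    ∃ K c : ℝ, 0 < c ∧ 0 ≤ K ∧ ∀ u : ℝ, 0 < u → ‖thetaTail G u‖ ≤ K * Real.exp (-c * u) := by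
  obtain ⟨K, c, hc, h⟩ := exists_thetaPhi_le hd hG
  have hK : 0 ≤ K := by
    have := (thetaPhi_nonneg hd hG one_pos).trans (h 1 le_rfl)
    exact nonneg_of_mul_nonneg_left this (Real.exp_pos _)
  refine ⟨K, c, hc, hK, fun u hu => ?_⟩
  by_cases h1 : 1 < u
  · rw [thetaTail, indicator_of_mem (show u ∈ Ioi (1 : ℝ) from h1), Complex.norm_real,
      Real.norm_of_nonneg (thetaPhi_nonneg hd hG hu)]
    exact h u h1.le
  · rw [thetaTail, indicator_of_notMem (show u ∉ Ioi (1 : ℝ) from h1), norm_zero]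
    positivity

/-- The tail decays exponentially and vanishes near zero, so its Mellin transform is entire. -/
lemma thetaTail_mellin (hd : 2 < d) (hG : IsGram G) (w : ℂ) :
    MellinConvergent (thetaTail G) w ∧ DifferentiableAt ℂ (mellin (thetaTail G)) w := by
  obtain ⟨K, c, hc, hK, h⟩ := exists_norm_thetaTail_le hd hG
  have hloc : LocallyIntegrableOn (thetaTail G) (Ioi 0) := by
    refine IntegrableOn.locallyIntegrableOn ?_
    refine Integrable.mono' ((exp_neg_integrableOn_Ioi 0 hc).const_mul K)
      (measurable_thetaTail hd hG).aestronglyMeasurable ?_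
    exact (ae_restrict_iff' measurableSet_Ioi).2 (Eventually.of_forall fun u hu => h u hu)
  have htop : thetaTail G =O[atTop] fun t => Real.exp (-c * t) := by
    refine Asymptotics.IsBigO.of_bound K ?_
    filter_upwards [eventually_gt_atTop 0] with u hu
    rw [Real.norm_of_nonneg (Real.exp_pos _).le]
    exact h u hu
  have hzero : thetaTail G =O[𝓝[>] 0] fun x => x ^ (-(w.re - 1)) := by
    refine (Asymptotics.isBigO_zero _ _).congr' ?_ EventuallyEq.rfl
    filter_upwards [nhdsWithin_le_nhds (Iio_mem_nhds one_pos)] with u hu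
    rw [thetaTail, indicator_of_notMem (show u ∉ Ioi (1 : ℝ) from fun h => lt_asymm (mem_Ioi.1 h) (mem_Iio.1 hu))]
  exact ⟨mellinConvergent_of_isBigO_rpow_exp hc hloc htop hzero (by linarith),
    mellin_differentiableAt_of_isBigO_rpow_exp hc hloc htop hzero (by linarith)⟩

/-- The meromorphic continuation of the Mellin transform of the integrated theta series. -/
def thetaLambda (G : Matrix (Fin d) (Fin d) ℝ) (w : ℂ) : ℂ :=
  mellin (thetaTail G) w + mellin (thetaTail (dualGram G)) (d - w) +
    volume.real ModularGroup.fd * (1 / (w - d)) + -volume.real ModularGroup.fd * (1 / w) +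
    cuspConst (dualGram G) * (1 / (w + (1 - d))) + -cuspConst G * (1 / (w - 1))

/-- The reflection `w ↦ d - w` exchanges the two tails, the pole at `0` with that at `d`, and the
pole at `1` with that at `d - 1`. -/
theorem thetaLambda_dual (hG : IsGram G) (w : ℂ) :
    thetaLambda (dualGram G) (d - w) = thetaLambda G w := by
  have e1 : (1 : ℂ) / (d - w - d) = -(1 / w) := by
    rw [show (d : ℂ) - w - d = -w by ring, div_neg]
  have e2 : (1 : ℂ) / (d - w) = -(1 / (w - d)) := by
    rw [show (d : ℂ) - w = -(w - d) by ring, div_neg]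
  have e3 : (1 : ℂ) / (d - w + (1 - d)) = -(1 / (w - 1)) := by
    rw [show (d : ℂ) - w + (1 - d) = -(w - 1) by ring, div_neg]
  have e4 : (1 : ℂ) / (d - w - 1) = -(1 / (w + (1 - d))) := by
    rw [show (d : ℂ) - w - 1 = -(w + (1 - d)) by ring, div_neg]
  rw [thetaLambda, thetaLambda, dualGram_dualGram hG, e1, e2, e3, e4,
    show (d : ℂ) - (d - w) = w by ring]
  ring

/-- Riemann's method: above `1` the function is its own tail, and below `1` the functional equation
expresses it through the dual tail and powers of `u`. -/
theorem hasMellin_thetaPhi (hd : 2 < d) (hG : IsGram G) {w : ℂ} (hw : (d : ℝ) < w.re) :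
    HasMellin (fun u : ℝ => (thetaPhi G u : ℂ)) w (thetaLambda G w) := by
  have hd' : (2 : ℝ) < d := by exact_mod_cast hd
  have h1 : HasMellin (thetaTail G) w (mellin (thetaTail G) w) := ⟨(thetaTail_mellin hd hG w).1, rfl⟩
  have h2 : HasMellin (fun u : ℝ => (u : ℂ) ^ (-(d : ℂ)) * thetaTail (dualGram G) u⁻¹) w
      (mellin (thetaTail (dualGram G)) (d - w)) := by
    have hc := (thetaTail_mellin hd hG.dualGram (d - w)).1
    refine ⟨?_, ?_⟩
    · refine (MellinConvergent.cpow_smul (f := fun u => thetaTail (dualGram G) u⁻¹)).2 ?_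
      have := (MellinConvergent.comp_rpow (f := thetaTail (dualGram G)) (s := w + -(d : ℂ))
        (a := -1) (by norm_num)).2 (by
          rw [show (w + -(d : ℂ)) / ((-1 : ℝ) : ℂ) = d - w by push_cast; ring]; exact hc)
      simpa only [Real.rpow_neg_one] using this
    · have := mellin_cpow_smul (fun u => thetaTail (dualGram G) u⁻¹) w (-(d : ℂ))
      rw [mellin_comp_inv] at this
      rw [show (d : ℂ) - w = -(w + -(d : ℂ)) by ring, ← this]
      rfl
  -- The four powers `u^(-d)`, `1`, `u^(1-d)`, `u⁻¹` on `(0, 1]` give the four polar terms; the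
  -- first of them requires `Re w > d`.
  have h3 := hasMellin_const_mul (hasMellin_cpow_Ioc (-(d : ℂ)) (s := w) (by simp; linarith))
    (volume.real ModularGroup.fd : ℂ)
  have h4 := hasMellin_const_mul (hasMellin_cpow_Ioc 0 (s := w) (by simp; linarith))
    (-(volume.real ModularGroup.fd : ℂ))
  have h5 := hasMellin_const_mul (hasMellin_cpow_Ioc (1 - (d : ℂ)) (s := w) (by simp; linarith))
    (cuspConst (dualGram G) : ℂ)
  have h6 := hasMellin_const_mul (hasMellin_cpow_Ioc (-1) (s := w) (by simp; linarith))
    (-(cuspConst G : ℂ))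
  have h := hasMellin_add_of_hasMellin (hasMellin_add_of_hasMellin (hasMellin_add_of_hasMellin
    (hasMellin_add_of_hasMellin (hasMellin_add_of_hasMellin h1 h2) h3) h4) h5) h6
  rw [add_zero, ← sub_eq_add_neg, ← sub_eq_add_neg] at h
  refine hasMellin_congr_off_one h fun u hu hu1 => ?_
  rcases lt_or_gt_of_ne hu1 with hlt | hgt
  · have hm : u ∈ Ioc (0 : ℝ) 1 := ⟨hu, hlt.le⟩
    have hn : u ∉ Ioi (1 : ℝ) := not_lt.2 hlt.le
    have hi : u⁻¹ ∈ Ioi (1 : ℝ) := (one_lt_inv₀ hu).2 hlt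
    simp only [thetaTail, indicator_of_mem hm, indicator_of_notMem hn, indicator_of_mem hi]
    rw [thetaPhi_inv_of_pos hd hG hu]
    push_cast
    rw [Complex.ofReal_cpow hu.le, Complex.ofReal_cpow hu.le, Complex.cpow_zero,
      Complex.cpow_neg_one]
    push_cast
    ring
  · have hm : u ∉ Ioc (0 : ℝ) 1 := fun h => not_lt.2 h.2 hgt
    have hn : u ∈ Ioi (1 : ℝ) := hgt
    have hi : u⁻¹ ∉ Ioi (1 : ℝ) := not_lt.2 (inv_le_one_of_one_le₀ hgt.le)
    simp only [thetaTail, indicator_of_notMem hm, indicator_of_mem hn, indicator_of_notMem hi]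
    ring

lemma meromorphicAt_thetaLambda (hd : 2 < d) (hG : IsGram G) (w : ℂ) :
    MeromorphicAt (thetaLambda G) w := by
  have a1 : AnalyticAt ℂ (mellin (thetaTail G)) w :=
    Differentiable.analyticAt (fun w => (thetaTail_mellin hd hG w).2) w
  have a2 : AnalyticAt ℂ (fun w => mellin (thetaTail (dualGram G)) (d - w)) w := by
    refine Differentiable.analyticAt (fun w => ?_) w
    exact (thetaTail_mellin hd hG.dualGram (d - w)).2.comp w
      ((differentiableAt_const _).sub differentiableAt_id)
  have r : ∀ a : ℂ, MeromorphicAt (fun w : ℂ => 1 / (w + a)) w := fun a =>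
    (MeromorphicAt.const 1 w).div ((analyticAt_id.meromorphicAt).add (MeromorphicAt.const a w))
  have r0 : MeromorphicAt (fun w : ℂ => 1 / w) w := by simpa using r 0
  have rs : ∀ a : ℂ, MeromorphicAt (fun w : ℂ => 1 / (w - a)) w := fun a => by
    simpa [sub_eq_add_neg] using r (-a)
  exact ((((a1.meromorphicAt.add a2.meromorphicAt).add ((MeromorphicAt.const _ w).mul
    (rs d))).add ((MeromorphicAt.const _ w).mul r0)).add ((MeromorphicAt.const _ w).mul
    (r (1 - d)))).add ((MeromorphicAt.const _ w).mul (rs 1))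

lemma analyticAt_thetaLambda (hd : 2 < d) (hG : IsGram G) {w : ℂ}
    (hw : (d : ℝ) < w.re ∨ w.re < 0) : AnalyticAt ℂ (thetaLambda G) w := by
  have hd' : (2 : ℝ) < d := by exact_mod_cast hd
  have a1 : AnalyticAt ℂ (mellin (thetaTail G)) w :=
    Differentiable.analyticAt (fun w => (thetaTail_mellin hd hG w).2) w
  have a2 : AnalyticAt ℂ (fun w => mellin (thetaTail (dualGram G)) (d - w)) w := by
    refine Differentiable.analyticAt (fun w => ?_) w
    exact (thetaTail_mellin hd hG.dualGram (d - w)).2.comp w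
      ((differentiableAt_const _).sub differentiableAt_id)
  have hne : ∀ a : ℂ, 0 ≤ a.re → a.re ≤ d → w - a ≠ 0 := by
    intro a h0 h1 h
    have := congrArg Complex.re h
    simp at this
    rcases hw with hw | hw <;> linarith
  have rs : ∀ a : ℂ, 0 ≤ a.re → a.re ≤ d → AnalyticAt ℂ (fun w : ℂ => 1 / (w - a)) w :=
    fun a h0 h1 => analyticAt_const.div (analyticAt_id.sub analyticAt_const) (hne a h0 h1)
  have r0 : AnalyticAt ℂ (fun w : ℂ => 1 / w) w := by
    simpa using rs 0 (by simp) (by simp)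
  have r1 : AnalyticAt ℂ (fun w : ℂ => 1 / (w + (1 - d))) w := by
    have := rs (d - 1) (by simp; linarith) (by simp)
    simpa [sub_eq_add_neg, add_comm] using this
  exact ((((a1.add a2).add (analyticAt_const.mul (rs d (by simp) (by simp)))).add
    (analyticAt_const.mul r0)).add (analyticAt_const.mul r1)).add
      (analyticAt_const.mul (rs 1 (by simp) (by simp; linarith)))

/-- The Mellin transform of the integrated theta series is an Eisenstein series. -/
theorem mellin_thetaPhi (hd : 2 < d) (hG : IsGram G) {s : ℂ} (hs : (d : ℝ) ^ 2 < 2 * s.re) :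
    mellin (fun u : ℝ => (thetaPhi G u : ℂ)) (2 * s) =
      2 * completedRiemannZeta (2 * s) * completedRiemannZeta (2 * s - 1) *
        ∑' c : Cosets d 2, (cosetDet hd.le G c : ℂ) ^ (-s) := by
  have hd2 := two_lt_sq hd
  set z : ℂ := 2 * s - 1 with hz
  have hzre : z.re = 2 * s.re - 1 := by simp [hz]
  -- The factor `1/u` of each term lowers the Mellin exponent from `2s` to `z = 2s - 1`, leaving
  -- pure exponentials.
  have h1 : mellin (fun u : ℝ => (thetaPhi G u : ℂ)) (2 * s) =
      mellin (fun u : ℝ => (u : ℂ) ^ (1 : ℂ) • (thetaPhi G u : ℂ)) z := by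
    rw [mellin_cpow_smul]; congr 1; rw [hz]; ring
  have hδ := latticeArea_pos hd hG
  have h2 := hasSum_mellin (a := fun x => 2 / (latticeArea hd G x : ℂ))
    (p := fun x => 2 * Real.pi * latticeArea hd G x)
    (F := fun u : ℝ => (u : ℂ) ^ (1 : ℂ) • (thetaPhi G u : ℂ)) (s := z)
    (fun x => Or.inr (by have := hδ x; positivity)) (by rw [hzre]; linarith) (fun u hu => ?_) ?_
  · rw [h1]
    have h3 := (hasSum_latticeArea_cpow hd hG hs).mul_left
      (2 * Complex.Gamma z * (2 * Real.pi : ℂ) ^ (-z))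
    have h4 := h2.unique (h3.congr_fun fun x => ?_)
    · rw [h4]
      have h5 := completedRiemannZeta_mul (s := z) (by rw [hzre]; linarith)
      rw [show z + 1 = 2 * s by rw [hz]; ring] at h5
      linear_combination (-2 * ∑' c : Cosets d 2, (cosetDet hd.le G c : ℂ) ^ (-s)) * h5
    · have hx := hδ x
      have hxc : (latticeArea hd G x : ℂ) ≠ 0 := by exact_mod_cast hx.ne'
      have e1 : ((2 * Real.pi * latticeArea hd G x : ℝ) : ℂ) ^ z =
          (2 * Real.pi : ℂ) ^ z * (latticeArea hd G x : ℂ) ^ z := by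
        rw [Complex.ofReal_mul, Complex.mul_cpow_ofReal_nonneg (by positivity) hx.le]
        push_cast; rfl
      have e2 : (latticeArea hd G x : ℂ) ^ (-(2 * s)) =
          ((latticeArea hd G x : ℂ) * (latticeArea hd G x : ℂ) ^ z)⁻¹ := by
        rw [Complex.cpow_neg, show 2 * s = 1 + z by rw [hz]; ring, Complex.cpow_add _ _ hxc,
          Complex.cpow_one]
      rw [e1, e2, Complex.cpow_neg, div_eq_mul_inv, mul_inv, mul_inv, div_eq_mul_inv]
      ring
  · have hu0 : 0 < u := hu
    have h3 := Complex.hasSum_ofReal.2 ((hasSum_thetaPhi hd hG hu0).mul_left u)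
    rw [Complex.cpow_one, smul_eq_mul, ← Complex.ofReal_mul]
    refine h3.congr_fun fun x => ?_
    have hx := hδ x
    have hxc : (latticeArea hd G x : ℂ) ≠ 0 := by exact_mod_cast hx.ne'
    have huc : (u : ℂ) ≠ 0 := by exact_mod_cast hu0.ne'
    rw [show -(2 * Real.pi * latticeArea hd G x) * u =
      -2 * Real.pi * (u * latticeArea hd G x) by ring]
    push_cast
    field_simp
  · refine ((summable_latticeArea_rpow hd hG hs).mul_left (2 * (2 * Real.pi) ^ (-z.re))).congr
      fun x => ?_
    have hx := hδ x
    rw [norm_div, Complex.norm_real, Real.norm_of_nonneg hx.le, Complex.norm_ofNat,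
      Real.mul_rpow (by positivity) hx.le, Real.rpow_neg (by positivity), Real.rpow_neg hx.le,
      show 2 * s.re = 1 + z.re by rw [hzre]; ring, Real.rpow_add hx, Real.rpow_one]
    have := Real.rpow_pos_of_pos hx z.re
    field_simp

end Mellin

/-! ### The nonholomorphic Eisenstein series of `SL(2)` -/

section EisensteinSLTwo

open MeasureTheory Matrix Set Filter Topology UpperHalfPlane

/-- A unimodular binary form is equivalent to its inverse through a signed swap, so its theta series
is self-dual. -/
lemma gaussSum_tauGram_inv (τ : ℍ) {t : ℝ} (ht : 0 < t) :
    gaussSum (tauGram τ) t = t⁻¹ * gaussSum (tauGram τ) t⁻¹ := by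
  have h1 : gaussSum (tauGram τ)⁻¹ t⁻¹ = gaussSum (tauGram τ) t⁻¹ := by
    rw [inv_tauGram]
    refine gaussSum_reindex _ _ (fun p => if p = 0 then 1 else -1) (Equiv.swap 0 1)
      (fun p q => ?_) _
    fin_cases p <;> fin_cases q <;> simp [tauGram]
  rw [(isGram_tauGram τ).gaussSum_inv ht, h1, Fintype.card_fin]
  congr 1
  rw [← Real.rpow_neg_one]
  congr 1; norm_num

/-- Monotonicity supplies the local integrability required in `thetaFEPair`. -/
lemma antitoneOn_gaussSum {ι : Type*} [Fintype ι] [DecidableEq ι] {X : Matrix ι ι ℝ}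
    (hX : IsGram X) : AntitoneOn (gaussSum X) (Ioi 0) := by
  intro a ha b hb hab
  refine Summable.tsum_le_tsum (fun m => ?_) (hX.summable_exp hb) (hX.summable_exp ha)
  rw [Real.exp_le_exp]
  have := mul_nonneg (sub_nonneg.2 hab) (mul_nonneg Real.pi_pos.le (hX.intForm_nonneg m))
  nlinarith

/-- The theta function whose Mellin transform is the Eisenstein series. -/
def thetaFEPair (τ : ℍ) : WeakFEPair ℂ where
  f t := (gaussSum (tauGram τ) t : ℂ)
  g t := (gaussSum (tauGram τ) t : ℂ)
  k := 1
  ε := 1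
  f₀ := 1
  g₀ := 1
  hf_int := by
    refine (locallyIntegrableOn_iff isOpen_Ioi.isLocallyClosed).2 fun K hK hc => ?_
    exact (((antitoneOn_gaussSum (isGram_tauGram τ)).mono hK).integrableOn_isCompact hc).ofReal
  hg_int := by
    refine (locallyIntegrableOn_iff isOpen_Ioi.isLocallyClosed).2 fun K hK hc => ?_
    exact (((antitoneOn_gaussSum (isGram_tauGram τ)).mono hK).integrableOn_isCompact hc).ofReal
  hk := one_pos
  hε := one_ne_zero
  h_feq x hx := by
    have hx0 : 0 < x := hx
    rw [gaussSum_tauGram_inv τ (one_div_pos.2 hx0), one_div, inv_inv, Real.rpow_one]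
    push_cast
    simp
  hf_top r := by
    obtain ⟨K, c, hK, hc, h⟩ := exists_gaussSum_sub_one_le (isGram_tauGram τ)
    refine Asymptotics.IsBigO.trans ?_ (isLittleO_exp_neg_mul_rpow_atTop hc r).isBigO
    refine Asymptotics.IsBigO.of_bound K ?_
    filter_upwards [eventually_ge_atTop 1] with t ht
    have h0 := (hasSum_gaussSum_sub_one (isGram_tauGram τ) (by linarith : 0 < t)).nonneg
      fun _ => (Real.exp_pos _).le
    rw [← Complex.ofReal_one, ← Complex.ofReal_sub, Complex.norm_real, Real.norm_of_nonneg h0,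
      Real.norm_of_nonneg (Real.exp_pos _).le]
    exact h t ht
  hg_top r := by
    obtain ⟨K, c, hK, hc, h⟩ := exists_gaussSum_sub_one_le (isGram_tauGram τ)
    refine Asymptotics.IsBigO.trans ?_ (isLittleO_exp_neg_mul_rpow_atTop hc r).isBigO
    refine Asymptotics.IsBigO.of_bound K ?_
    filter_upwards [eventually_ge_atTop 1] with t ht
    have h0 := (hasSum_gaussSum_sub_one (isGram_tauGram τ) (by linarith : 0 < t)).nonneg
      fun _ => (Real.exp_pos _).le
    rw [← Complex.ofReal_one, ← Complex.ofReal_sub, Complex.norm_real, Real.norm_of_nonneg h0,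
      Real.norm_of_nonneg (Real.exp_pos _).le]
    exact h t ht

lemma pnat_units_injective {n n' : ℕ+} {ε ε' : ℤˣ} (h : (ε : ℤ) * n = ε' * n') :
    n = n' ∧ ε = ε' := by
  have hn : n = n' := by
    have := congrArg Int.natAbs h
    simp [Int.natAbs_mul] at this
    exact this
  subst hn
  refine ⟨rfl, Units.ext ?_⟩
  exact mul_right_cancel₀ (by exact_mod_cast n.ne_zero) h

lemma exists_units_mul_pnat {a : ℤ} (ha : a ≠ 0) : ∃ (n : ℕ+) (ε : ℤˣ), (ε : ℤ) * n = a := by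
  refine ⟨⟨a.natAbs, Int.natAbs_pos.2 ha⟩, ?_⟩
  rcases Int.natAbs_eq a with h | h
  · exact ⟨1, by simpa using h.symm⟩
  · exact ⟨-1, by simpa using h.symm⟩

lemma cuspVec_ne_zero (c : Cosets 2 1) : cuspVec c ≠ 0 := by
  intro h
  have := cuspVec_det c
  rw [h] at this
  simp at this

/-- Nonzero integral vectors are unique multiples of primitive vectors taken up to sign. -/
def vectorEquiv : Cosets 2 1 × (ℕ+ × ℤˣ) ≃ {v : Fin 2 → ℤ // v ≠ 0} :=
  Equiv.ofBijective (fun x => ⟨fun r => cuspVec x.1 r * ((x.2.2 : ℤ) * (x.2.1 : ℕ)), by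
    obtain ⟨r, hr⟩ := Function.ne_iff.1 (cuspVec_ne_zero x.1)
    refine Function.ne_iff.2 ⟨r, mul_ne_zero hr (mul_ne_zero x.2.2.ne_zero ?_)⟩
    exact_mod_cast x.2.1.ne_zero⟩) <| by
  constructor
  · rintro ⟨c, n, ε⟩ ⟨c', n', ε'⟩ h
    have h1 := smul_cuspVec_injective (c := c) (c' := c')
      (mul_ne_zero ε.ne_zero (by exact_mod_cast n.ne_zero)) fun r =>
      congrFun (congrArg Subtype.val h) r
    obtain ⟨h2, h3⟩ := pnat_units_injective h1.2
    exact Prod.ext h1.1 (Prod.ext h2 h3)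
  · rintro ⟨v, hv⟩
    obtain ⟨c, a, h⟩ := exists_eq_smul_cuspVec v
    have ha : a ≠ 0 := by
      rintro rfl
      exact hv (funext fun r => by rw [h r, mul_zero]; rfl)
    obtain ⟨n, ε, hn⟩ := exists_units_mul_pnat ha
    refine ⟨(c, n, ε), Subtype.ext (funext fun r => ?_)⟩
    change cuspVec c r * ((ε : ℤ) * (n : ℕ)) = v r
    rw [h r, ← hn]

lemma intForm_tauGram (τ : ℍ) (v : Fin 2 → ℤ) : intForm (tauGram τ) v =
    τ.im⁻¹ * ((v 0 : ℝ) ^ 2 + 2 * (v 0 * v 1) * τ.re + (v 1 : ℝ) ^ 2 * (τ.re ^ 2 + τ.im ^ 2)) := by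
  simp only [intForm, dotProduct, Matrix.mulVec, Fin.sum_univ_two, tauGram, Matrix.of_apply,
    Matrix.cons_val', Matrix.cons_val_zero, Matrix.cons_val_one, Matrix.cons_val_fin_one]
  ring

lemma intForm_tauGram_cuspVec (τ : ℍ) (c : Cosets 2 1) :
    intForm (tauGram τ) (cuspVec c) = (c.out • τ).im⁻¹ := by
  rw [intForm_tauGram, tauGram_cuspVec]

lemma intForm_tauGram_vectorEquiv (τ : ℍ) (x : Cosets 2 1 × (ℕ+ × ℤˣ)) :
    intForm (tauGram τ) (vectorEquiv x).1 = (x.2.1 : ℝ) ^ 2 * (x.1.out • τ).im⁻¹ := by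
  have hε : ((x.2.2 : ℤ) : ℝ) ^ 2 = 1 := by
    rcases Int.units_eq_one_or x.2.2 with h | h <;> simp [h]
  have hv : ∀ r, (((vectorEquiv x).1 r : ℤ) : ℝ) = cuspVec x.1 r * (((x.2.2 : ℤ) : ℝ) * x.2.1) := by
    intro r
    change ((cuspVec x.1 r * ((x.2.2 : ℤ) * (x.2.1 : ℕ)) : ℤ) : ℝ) = _
    push_cast; rfl
  rw [← tauGram_cuspVec τ x.1, intForm_tauGram, hv, hv]
  linear_combination (τ.im⁻¹ * (x.2.1 : ℝ) ^ 2 * ((cuspVec x.1 0 : ℝ) ^ 2 +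
    2 * (cuspVec x.1 0 * cuspVec x.1 1) * τ.re +
      (cuspVec x.1 1 : ℝ) ^ 2 * (τ.re ^ 2 + τ.im ^ 2))) * hε

/-- The cusps embed into `ℤ²` through `cuspVec`, where `(Im γτ)⁻¹` is the value of a positive
definite form. -/
lemma summable_im_rpow (τ : ℍ) {r : ℝ} (hr : 1 < r) :
    Summable fun c : Cosets 2 1 => (c.out • τ).im ^ r := by
  obtain ⟨κ, hκ, h⟩ := (isGram_tauGram τ).exists_intForm_lower_bound
  have hinj : Function.Injective cuspVec := fun c c' hcc =>
    (smul_cuspVec_injective (a := 1) (a' := 1) one_ne_zero fun r => by rw [hcc]).1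
  have h1 := ((summable_norm_rpow_int (ι := Fin 2) (-(2 * r))
    (by rw [Fintype.card_fin]; push_cast; linarith)).comp_injective hinj).mul_left (κ ^ (-r))
  refine Summable.of_nonneg_of_le (fun c => Real.rpow_nonneg (c.out • τ).im_pos.le _)
    (fun c => ?_) h1
  have hp : 0 < ‖cuspVec c‖ := norm_pos_iff.2 (cuspVec_ne_zero c)
  have h3 : κ ^ (-r) * ‖cuspVec c‖ ^ (-(2 * r)) = (κ * ‖cuspVec c‖ ^ 2) ^ (-r) := by
    rw [Real.mul_rpow hκ.le (by positivity), ← Real.rpow_natCast, ← Real.rpow_mul hp.le]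
    congr 2; push_cast; ring
  have h4 := h (cuspVec c)
  rw [intForm_tauGram_cuspVec] at h4
  simp only [Function.comp]
  rw [h3, show (c.out • τ).im ^ r = ((c.out • τ).im⁻¹) ^ (-r) by
    rw [Real.inv_rpow (c.out • τ).im_pos.le, Real.rpow_neg (c.out • τ).im_pos.le, inv_inv]]
  exact Real.rpow_le_rpow_of_nonpos (by positivity) h4 (by linarith)

lemma norm_eisensteinTermSL2 (τ : ℍ) (s : ℂ) (c : Cosets 2 1) :
    ‖eisensteinTermSL2 τ s c‖ = (c.out • τ).im ^ s.re :=
  Complex.norm_cpow_eq_rpow_re_of_pos (c.out • τ).im_pos s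

lemma summable_norm_eisensteinTermSL2 (τ : ℍ) {s : ℂ} (hs : 1 < s.re) :
    Summable fun c => ‖eisensteinTermSL2 τ s c‖ :=
  (summable_im_rpow τ hs).congr fun c => (norm_eisensteinTermSL2 τ s c).symm

lemma hasSum_pnat_units {w : ℂ} (hw : 1 < w.re) :
    HasSum (fun x : ℕ+ × ℤˣ => (x.1 : ℂ) ^ (-w) * 1) (riemannZeta w * 2) := by
  have h1 : Summable fun n : ℕ+ => ‖(n : ℂ) ^ (-w)‖ := Summable.norm (hasSum_pnat_cpow hw).summable
  have h2 := hasSum_prod_mul (hasSum_pnat_cpow hw) hasSum_units_int h1 Summable.of_finite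
  exact h2

/-- The Mellin transform of the theta series without its constant term is `π^(-s) Γ(s)` times the
Epstein zeta function. Writing nonzero vectors as `±n` times primitive ones splits off `2 ζ(2s)`. -/
theorem thetaFEPair_Λ (τ : ℍ) {s : ℂ} (hs : 1 < s.re) :
    (thetaFEPair τ).Λ s = 2 * completedRiemannZeta (2 * s) * eisensteinSumSL2 τ s := by
  have hs2 : 1 < (2 * s).re := by simp; linarith
  have h1 := ((thetaFEPair τ).hasMellin (s := s) hs).2
  rw [← h1]
  have hE := (summable_norm_eisensteinTermSL2 τ hs).of_norm.hasSum
  have hZ := hasSum_pnat_units hs2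
  have h3 := (hasSum_prod_mul hE hZ (summable_norm_eisensteinTermSL2 τ hs)
    (Summable.norm hZ.summable))
  have hq : ∀ x : Cosets 2 1 × (ℕ+ × ℤˣ), 0 < (x.2.1 : ℝ) ^ 2 * (x.1.out • τ).im⁻¹ := fun x => by
    have h1 : (0 : ℝ) < x.2.1 := by exact_mod_cast x.2.1.pos
    have h2 := (x.1.out • τ).im_pos
    positivity
  have hterm : ∀ x : Cosets 2 1 × (ℕ+ × ℤˣ),
      (1 : ℂ) / (((x.2.1 : ℝ) ^ 2 * (x.1.out • τ).im⁻¹ : ℝ) : ℂ) ^ s =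
        eisensteinTermSL2 τ s x.1 * ((x.2.1 : ℂ) ^ (-(2 * s)) * 1) := by
    intro x
    have hn : (x.2.1 : ℂ) ≠ 0 := by exact_mod_cast x.2.1.ne_zero
    have hy := (x.1.out • τ).im_pos
    rw [Complex.ofReal_mul, Complex.mul_cpow_ofReal_nonneg (by positivity) (by positivity),
      sq, Complex.ofReal_mul, Complex.mul_cpow_ofReal_nonneg (by positivity) (by positivity),
      Complex.ofReal_natCast, ← Complex.cpow_add _ _ hn, Complex.ofReal_inv, Complex.inv_cpow _ _
        (by rw [Complex.arg_ofReal_of_nonneg hy.le]; exact Real.pi_pos.ne),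
      eisensteinTermSL2, Complex.cpow_neg, show s + s = 2 * s by ring, one_div, mul_inv, inv_inv]
    ring
  have h2 := hasSum_mellin_pi_mul (a := fun _ : Cosets 2 1 × (ℕ+ × ℤˣ) => (1 : ℂ))
    (q := fun x => (x.2.1 : ℝ) ^ 2 * (x.1.out • τ).im⁻¹)
    (F := fun t => (thetaFEPair τ).f t - (thetaFEPair τ).f₀) (s := s)
    (fun x => Or.inr (hq x)) (by linarith) (fun t ht => ?_) ?_
  · have h4 := h3.mul_left ((Real.pi : ℂ) ^ (-s) * Complex.Gamma s)
    rw [h2.unique (h4.congr_fun fun x => by rw [mul_div_assoc, hterm x])]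
    have hs0 : (2 * s) ≠ 0 := (ne_zero_one_of_one_lt_re hs2).1
    have hG := Complex.Gammaℝ_ne_zero_of_re_pos (by linarith : 0 < (2 * s).re)
    have h5 : completedRiemannZeta (2 * s) = Complex.Gammaℝ (2 * s) * riemannZeta (2 * s) := by
      rw [riemannZeta_def_of_ne_zero hs0]; field_simp
    rw [h5, Complex.Gammaℝ_def, show -(2 * s) / 2 = -s by ring, show 2 * s / 2 = s by ring,
      eisensteinSumSL2]
    ring
  · have ht0 : 0 < t := ht
    have h4 := Complex.hasSum_ofReal.2 (hasSum_gaussSum_sub_one (isGram_tauGram τ) ht0)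
    have h5 := (Equiv.hasSum_iff vectorEquiv).2 h4
    rw [Complex.ofReal_sub, Complex.ofReal_one] at h5
    refine h5.congr_fun fun x => ?_
    simp only [Function.comp, one_mul]
    rw [intForm_tauGram_vectorEquiv]
    congr 2
    ring
  · refine (Summable.norm h3.summable).congr fun x => ?_
    rw [← hterm x, norm_div, Complex.norm_cpow_eq_rpow_re_of_pos (hq x)]

/-- The Eisenstein series as a quotient of functions without a pole at `s = 0`. -/
def eisensteinQuotient (τ : ℍ) (s : ℂ) : ℂ :=
  (s * (1 - s) * (thetaFEPair τ).Λ₀ s - 1) /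
    ((1 - s) * (2 * s * completedRiemannZeta₀ (2 * s) - 1 - 2 * s / (1 - 2 * s)))

lemma eisensteinQuotient_zero (τ : ℍ) : eisensteinQuotient τ 0 = 1 := by
  simp [eisensteinQuotient]

lemma analyticAt_eisensteinQuotient (τ : ℍ) {s : ℂ} (h1 : 1 - 2 * s ≠ 0)
    (h2 : (1 - s) * (2 * s * completedRiemannZeta₀ (2 * s) - 1 - 2 * s / (1 - 2 * s)) ≠ 0) :
    AnalyticAt ℂ (eisensteinQuotient τ) s := by
  have a0 : AnalyticAt ℂ (fun s => (thetaFEPair τ).Λ₀ s) s :=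
    (thetaFEPair τ).differentiable_Λ₀.analyticAt s
  have a1 : AnalyticAt ℂ (fun s => completedRiemannZeta₀ (2 * s)) s :=
    Differentiable.analyticAt (differentiable_completedZeta₀.comp (by fun_prop)) s
  unfold eisensteinQuotient
  refine AnalyticAt.fun_div (by fun_prop) ?_ h2
  refine AnalyticAt.fun_mul (by fun_prop) (AnalyticAt.fun_sub (by fun_prop) ?_)
  exact AnalyticAt.fun_div (by fun_prop) (by fun_prop) h1

lemma meromorphicOn_eisensteinQuotient (τ : ℍ) : MeromorphicOn (eisensteinQuotient τ) univ := by
  intro s _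
  have a0 : AnalyticAt ℂ (fun s => (thetaFEPair τ).Λ₀ s) s :=
    (thetaFEPair τ).differentiable_Λ₀.analyticAt s
  have a1 : AnalyticAt ℂ (fun s => completedRiemannZeta₀ (2 * s)) s :=
    Differentiable.analyticAt (differentiable_completedZeta₀.comp (by fun_prop)) s
  have m : ∀ f : ℂ → ℂ, AnalyticAt ℂ f s → MeromorphicAt f s := fun f h => h.meromorphicAt
  refine MeromorphicAt.fun_div (m _ (by fun_prop)) (MeromorphicAt.fun_mul (m _ (by fun_prop))
    (MeromorphicAt.fun_sub (m _ (by fun_prop)) (MeromorphicAt.fun_div (m _ (by fun_prop))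
      (m _ (by fun_prop)))))

/-- The left form stays regular at `s = 0`, where the factor `s` cancels the pole of `ξ(2s)`; its
value there is `-1`, equal to that of the numerator. -/
lemma eisensteinQuotient_den (s : ℂ) (h0 : s ≠ 0) :
    (1 - s) * (2 * s * completedRiemannZeta₀ (2 * s) - 1 - 2 * s / (1 - 2 * s)) =
      s * (1 - s) * (2 * completedRiemannZeta (2 * s)) := by
  rw [completedRiemannZeta_eq]
  have : s * (1 / (2 * s)) = 1 / 2 := by field_simp
  linear_combination (2 * (1 - s)) * this

/-- The Eisenstein series is `Λ(s) / (2 ξ(2s))`. Multiplying numerator and denominator by `s(1 - s)`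
removes the poles at zero; the quotient is analytic there, so the normal form keeps its value `1`.
-/
theorem eisensteinSL2_continuation (τ : ℍ) {σ : ℝ} (hσ : 1 ≤ σ) :
    IsMeromorphicContinuation σ (eisensteinSumSL2 τ) (eisensteinSL2 τ) ∧ eisensteinSL2 τ 0 = 1 := by
  have hne : ∀ s : ℂ, σ < s.re → s ≠ 0 ∧ 1 - s ≠ 0 ∧ 1 - 2 * s ≠ 0 ∧
      completedRiemannZeta (2 * s) ≠ 0 := by
    intro s hs
    obtain ⟨h0, h1⟩ := ne_zero_one_of_one_lt_re (z := s) (by linarith)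
    have hs2 : 1 < (2 * s).re := by simp; linarith
    exact ⟨h0, sub_ne_zero.2 h1.symm, sub_ne_zero.2 (ne_zero_one_of_one_lt_re hs2).2.symm,
      completedRiemannZeta_ne_zero hs2⟩
  have hmain := meromorphicContinuation_eq_toMeromorphicNFOn (f := eisensteinSumSL2 τ) (σ := σ)
    (meromorphicOn_eisensteinQuotient τ) (fun s hs => ?_) (fun s hs => ?_)
  · refine ⟨hmain.2, ?_⟩
    rw [eisensteinSL2, hmain.1, toMeromorphicNFOn_apply_of_analyticAt
      (meromorphicOn_eisensteinQuotient τ) (analyticAt_eisensteinQuotient τ (by simp) (by simp)),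
      eisensteinQuotient_zero]
  · obtain ⟨h0, h1, h2, h3⟩ := hne s hs
    refine analyticAt_eisensteinQuotient τ h2 ?_
    rw [eisensteinQuotient_den s h0]
    exact mul_ne_zero (mul_ne_zero h0 h1) (mul_ne_zero two_ne_zero h3)
  · obtain ⟨h0, h1, h2, h3⟩ := hne s hs
    have h4 := thetaFEPair_Λ τ (s := s) (by linarith)
    have h5 := (thetaFEPair τ).Λ₀_eq s
    have h6 : (thetaFEPair τ).Λ₀ s = (thetaFEPair τ).Λ s + 1 / s + 1 / (1 - s) := by
      rw [h5]
      simp [thetaFEPair]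
    rw [eisensteinQuotient, eisensteinQuotient_den s h0, h6, h4,
      eq_div_iff (mul_ne_zero (mul_ne_zero h0 h1) (mul_ne_zero two_ne_zero h3))]
    field_simp
    ring

end EisensteinSLTwo

/-! ### Iwasawa coordinates and Gram determinants -/

section Iwasawa

open Matrix

variable {d i i' : ℕ}

lemma botIdx_strictMono (hi : i ≤ d) : StrictMono (botIdx hi) := by
  intro a b h
  have : (a : ℕ) < b := h
  simp only [botIdx, Fin.mk_lt_mk]; omega

lemma det_eq_one_of_unitriangular {m : ℕ} {n : Matrix (Fin m) (Fin m) ℝ}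
    (h1 : ∀ j, n j j = 1) (h2 : ∀ j k, k < j → n j k = 0) : n.det = 1 := by
  have h : n.det = ∏ j, n j j := Matrix.det_of_isUpperTriangular fun j k hjk => h2 _ _ hjk
  rw [h]
  exact Finset.prod_eq_one fun j _ => h1 _

lemma det_botBlock_of_unitriangular {n : Matrix (Fin d) (Fin d) ℝ} (hi : i ≤ d)
    (h1 : ∀ j, n j j = 1) (h2 : ∀ j k, k < j → n j k = 0) : (botBlock hi n).det = 1 :=
  det_eq_one_of_unitriangular (fun _ => h1 _) fun _ _ hjk => h2 _ _ (botIdx_strictMono hi hjk)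

lemma blockUpper_of_triangular {n : Matrix (Fin d) (Fin d) ℝ} (h2 : ∀ j k, k < j → n j k = 0) :
    BlockUpper i n := fun j k hj hk => h2 j k (by change (k : ℕ) < j; omega)

lemma botBlock_diagonal (hi : i ≤ d) (b : Fin d → ℝ) :
    botBlock hi (Matrix.diagonal b) = Matrix.diagonal fun j => b (botIdx hi j) :=
  Matrix.submatrix_diagonal b _ (botIdx_injective hi)

lemma det_botBlock_conj (hi : i ≤ d) {N : Matrix (Fin d) (Fin d) ℝ} (hN : BlockUpper i N)
    (hdet : (botBlock hi N).det = 1) (b : Fin d → ℝ) :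
    (botBlock hi (N * Matrix.diagonal b * Nᵀ)).det = ∏ j, b (botIdx hi j) := by
  have hD : BlockUpper i (Matrix.diagonal b) :=
    blockUpper_of_triangular fun j k hjk => Matrix.diagonal_apply_ne _ hjk.ne'
  rw [Matrix.mul_assoc, hN.botBlock_mul, hD.botBlock_mul, botBlock_diagonal, Matrix.det_mul,
    Matrix.det_mul, Matrix.det_diagonal, show botBlock hi Nᵀ = (botBlock hi N)ᵀ from rfl,
    Matrix.det_transpose, hdet, one_mul, mul_one]

lemma det_botBlock_eq_one_of_mul (hi : i ≤ d) {N N' : Matrix (Fin d) (Fin d) ℝ}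
    (hN : BlockUpper i N) (h : N * N' = 1) (h' : (botBlock hi N).det = 1) :
    (botBlock hi N').det = 1 := by
  have := congrArg Matrix.det (hN.botBlock_mul hi N')
  rw [h, botBlock_one, Matrix.det_one, Matrix.det_mul, h', one_mul] at this
  exact this.symm

lemma mul_transpose_of_isIwasawa {g n k : Matrix (Fin d) (Fin d) ℝ} {a : Fin d → ℝ}
    (hk : k ∈ Matrix.orthogonalGroup (Fin d) ℝ) (hg : g = n * Matrix.diagonal a * k) :
    g * gᵀ = n * Matrix.diagonal (fun j => a j ^ 2) * nᵀ := by
  have hk' : k * kᵀ = 1 := (Matrix.mem_orthogonalGroup_iff (Fin d) ℝ).1 hk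
  have h2 : Matrix.diagonal (fun j => a j ^ 2) = Matrix.diagonal a * Matrix.diagonal a := by
    rw [Matrix.diagonal_mul_diagonal]; simp only [sq]
  calc g * gᵀ = n * Matrix.diagonal a * (k * kᵀ) * (Matrix.diagonal a * nᵀ) := by
        rw [hg]
        simp only [Matrix.transpose_mul, Matrix.diagonal_transpose, Matrix.mul_assoc]
    _ = _ := by rw [hk', Matrix.mul_one, h2]; simp only [Matrix.mul_assoc]

lemma prod_sq_eq_one_of_isIwasawa {g : Matrix (Fin d) (Fin d) ℝ} {a : Fin d → ℝ}
    (hg : g.det = 1) (h : IsIwasawa g a) : ∏ j, a j ^ 2 = 1 := by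
  obtain ⟨-, n, k, hn1, hn2, hk, hgk⟩ := h
  have h1 := congrArg Matrix.det (mul_transpose_of_isIwasawa hk hgk)
  have hn : n.det = 1 := det_eq_one_of_unitriangular hn1 hn2
  rw [Matrix.det_mul, Matrix.det_mul, Matrix.det_mul, Matrix.det_transpose, Matrix.det_transpose,
    Matrix.det_diagonal, hn, hg] at h1
  simpa using h1.symm

lemma det_botBlock_mul_transpose (hi : i ≤ d) {g : Matrix (Fin d) (Fin d) ℝ} {a : Fin d → ℝ}
    (h : IsIwasawa g a) : (botBlock hi (g * gᵀ)).det = ∏ j, a (botIdx hi j) ^ 2 := by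
  obtain ⟨-, n, k, hn1, hn2, hk, hgk⟩ := h
  rw [mul_transpose_of_isIwasawa hk hgk, det_botBlock_conj hi (blockUpper_of_triangular hn2)
    (det_botBlock_of_unitriangular hi hn1 hn2)]

/-- The inverse transpose of `n` is lower triangular, and reversing the coordinates makes it upper
triangular again. The dual form thus has its own triangular decomposition, with inverted and
reversed diagonal. -/
lemma det_botBlock_dualGram (hi : i ≤ d) {g : Matrix (Fin d) (Fin d) ℝ} {a : Fin d → ℝ}
    (h : IsIwasawa g a) :
    (botBlock hi (dualGram (g * gᵀ))).det = ∏ j, (a (botIdx hi j).rev ^ 2)⁻¹ := by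
  obtain ⟨ha, n, k, hn1, hn2, hk, hgk⟩ := h
  have hndet : n.det = 1 := det_eq_one_of_unitriangular hn1 hn2
  have hnu : IsUnit n.det := by rw [hndet]; exact isUnit_one
  have hinv : Invertible n := Matrix.invertibleOfIsUnitDet n hnu
  have htri : ∀ j k, k < j → n⁻¹ j k = 0 := by
    have hb : Matrix.BlockTriangular n id := fun j k hjk => hn2 j k hjk
    intro j k hjk
    exact Matrix.blockTriangular_inv_of_blockTriangular hb hjk
  let N : Matrix (Fin d) (Fin d) ℝ := nᵀ.submatrix Fin.rev Fin.rev
  let N' : Matrix (Fin d) (Fin d) ℝ := n⁻¹ᵀ.submatrix Fin.rev Fin.rev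
  have hrev : (Fin.rev : Fin d → Fin d) = Fin.revPerm := rfl
  have hNtri : ∀ j k, k < j → N j k = 0 := fun j k hjk => hn2 _ _ (Fin.rev_lt_rev.2 hjk)
  have hN'tri : ∀ j k, k < j → N' j k = 0 := fun j k hjk => htri _ _ (Fin.rev_lt_rev.2 hjk)
  have hNN : N * N' = 1 := by
    simp only [N, N', hrev]
    rw [Matrix.submatrix_mul_equiv, ← Matrix.transpose_mul, Matrix.nonsing_inv_mul _ hnu]
    simp
  have hdet : (botBlock hi N').det = 1 :=
    det_botBlock_eq_one_of_mul hi (blockUpper_of_triangular hNtri) hNN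
      (det_botBlock_of_unitriangular hi (fun j => hn1 _) hNtri)
  have hS : dualGram (g * gᵀ) = N' * Matrix.diagonal (fun j => (a j.rev ^ 2)⁻¹) * N'ᵀ := by
    have hD : (Matrix.diagonal fun j => a j ^ 2)⁻¹ = Matrix.diagonal fun j => (a j ^ 2)⁻¹ := by
      refine Matrix.inv_eq_right_inv ?_
      rw [Matrix.diagonal_mul_diagonal, ← Matrix.diagonal_one]
      congr 1
      funext j
      exact mul_inv_cancel₀ (pow_pos (ha j) 2).ne'
    rw [mul_transpose_of_isIwasawa hk hgk, dualGram, Matrix.mul_inv_rev, Matrix.mul_inv_rev,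
      ← Matrix.transpose_nonsing_inv, hD]
    have hdiag : Matrix.diagonal (fun j => (a j.rev ^ 2)⁻¹) =
        (Matrix.diagonal fun j => (a j ^ 2)⁻¹).submatrix (Fin.revPerm : Fin d ≃ Fin d)
          (Fin.revPerm : Fin d ≃ Fin d) := by
      rw [Matrix.submatrix_diagonal_equiv]; rfl
    rw [hdiag]
    simp only [N', hrev]
    rw [Matrix.transpose_submatrix, Matrix.submatrix_mul_equiv, Matrix.submatrix_mul_equiv,
      Matrix.transpose_transpose, Matrix.mul_assoc]
  rw [hS, det_botBlock_conj hi (blockUpper_of_triangular hN'tri) hdet]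

lemma fundamentalWeight_eq_sum_rev (hi' : i' ≤ d) (hii : i + i' = d) (H : Fin d → ℝ) :
    fundamentalWeight d i H = ∑ j : Fin i', H (botIdx hi' j).rev := by
  rw [fundamentalWeight, ← Equiv.sum_comp Fin.revPerm, sum_botIdx hi']
  · refine Finset.sum_congr rfl fun j _ => if_pos ?_
    have := le_botIdx hi' j
    simp only [Fin.revPerm_apply, Fin.val_rev]
    omega
  · intro k hk
    refine if_neg ?_
    simp only [Fin.revPerm_apply, Fin.val_rev]
    omega

lemma sum_eq_fundamentalWeight_add (hi : i ≤ d) (H : Fin d → ℝ) :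
    ∑ j, H j = fundamentalWeight d i H + ∑ j : Fin i, H (botIdx hi j) := by
  have h1 := sum_botIdx hi (fun j : Fin d => if (j : ℕ) + i < d then 0 else H j)
    (fun k hk => if_pos hk)
  have h2 : ∀ j : Fin i, (if (botIdx hi j : ℕ) + i < d then 0 else H (botIdx hi j)) =
      H (botIdx hi j) := fun j => if_neg (not_lt.2 (le_botIdx hi j))
  simp only [h2] at h1
  rw [← h1, fundamentalWeight, ← Finset.sum_add_distrib]
  refine Finset.sum_congr rfl fun j _ => ?_
  split_ifs <;> ring

/-- The exponential of the fundamental weight in terms of the last rows. -/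
theorem exp_fundamentalWeight (hi : i ≤ d) (g : SL(d, ℝ)) :
    Real.exp (2 * fundamentalWeight d i (iwasawaH g)) =
      (botBlock hi ((g : Matrix (Fin d) (Fin d) ℝ) * (g : Matrix (Fin d) (Fin d) ℝ)ᵀ)).det⁻¹ := by
  have h := (exists_isIwasawa g).choose_spec
  set a := (exists_isIwasawa g).choose with ha
  have hpos : ∀ j, 0 < a j := h.1
  rw [det_botBlock_mul_transpose hi h]
  have h1 := prod_sq_eq_one_of_isIwasawa g.2 h
  -- Since `det g = 1`, the logarithms sum to zero and the weight, a sum over the first `d - i`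
  -- indices, is minus the sum over the last `i`.
  have h2 : ∑ j, Real.log (a j) = 0 := by
    have := congrArg Real.log h1
    rw [Real.log_prod (fun j _ => (pow_pos (hpos j) 2).ne'), Real.log_one] at this
    simp only [Real.log_pow, ← Finset.mul_sum] at this
    simpa using this
  have h3 := sum_eq_fundamentalWeight_add hi (iwasawaH g)
  have h4 : fundamentalWeight d i (iwasawaH g) = -∑ j : Fin i, Real.log (a (botIdx hi j)) := by
    have h5 : ∑ j, iwasawaH g j = 0 := h2
    rw [h5] at h3
    have h6 : ∑ j : Fin i, iwasawaH g (botIdx hi j) = ∑ j : Fin i, Real.log (a (botIdx hi j)) := rfl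
    linarith
  rw [h4, mul_neg, Real.exp_neg, Finset.mul_sum, Real.exp_sum]
  congr 1
  refine Finset.prod_congr rfl fun j _ => ?_
  rw [two_mul, Real.exp_add, Real.exp_log (hpos _), sq]

/-- The exponential of the fundamental weight in terms of the dual lattice. -/
theorem exp_fundamentalWeight_dual (hi' : i' ≤ d) (hii : i + i' = d) (g : SL(d, ℝ)) :
    Real.exp (2 * fundamentalWeight d i (iwasawaH g)) = (botBlock hi'
      (dualGram ((g : Matrix (Fin d) (Fin d) ℝ) * (g : Matrix (Fin d) (Fin d) ℝ)ᵀ))).det⁻¹ := by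
  have h := (exists_isIwasawa g).choose_spec
  have hpos := h.1
  rw [det_botBlock_dualGram hi' h, fundamentalWeight_eq_sum_rev hi' hii, Finset.mul_sum,
    Real.exp_sum, Finset.prod_inv_distrib, inv_inv]
  refine Finset.prod_congr rfl fun j _ => ?_
  rw [two_mul, Real.exp_add, iwasawaH, Real.exp_log (hpos _), sq]

lemma cexp_eq_cpow_neg {ω X : ℝ} (h : Real.exp (2 * ω) = X⁻¹) (s : ℂ) :
    Complex.exp (2 * s * (ω : ℂ)) = (X : ℂ) ^ (-s) := by
  have hX : 0 < X := inv_pos.1 (h ▸ Real.exp_pos _)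
  have h1 : Real.log X = -(2 * ω) := by
    rw [← inv_inv X, ← h, Real.log_inv, Real.log_exp]
  rw [Complex.cpow_def_of_ne_zero (by exact_mod_cast hX.ne'), ← Complex.ofReal_log hX.le, h1]
  congr 1
  push_cast; ring

lemma map_mul_mul_transpose (γ : SL(d, ℤ)) (e : SL(d, ℝ)) :
    ((Matrix.SpecialLinearGroup.map (Int.castRingHom ℝ) γ * e : SL(d, ℝ)) :
      Matrix (Fin d) (Fin d) ℝ) * ((Matrix.SpecialLinearGroup.map (Int.castRingHom ℝ) γ * e :
        SL(d, ℝ)) : Matrix (Fin d) (Fin d) ℝ)ᵀ =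
      (γ : Matrix (Fin d) (Fin d) ℤ).map (Int.cast : ℤ → ℝ) *
        ((e : Matrix (Fin d) (Fin d) ℝ) * (e : Matrix (Fin d) (Fin d) ℝ)ᵀ) *
        ((γ : Matrix (Fin d) (Fin d) ℤ).map (Int.cast : ℤ → ℝ))ᵀ := by
  have h : ((Matrix.SpecialLinearGroup.map (Int.castRingHom ℝ) γ : SL(d, ℝ)) :
      Matrix (Fin d) (Fin d) ℝ) = (γ : Matrix (Fin d) (Fin d) ℤ).map (Int.cast : ℤ → ℝ) := rfl
  rw [Matrix.SpecialLinearGroup.coe_mul, h, Matrix.transpose_mul]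
  simp only [Matrix.mul_assoc]

lemma botBlock_conj_eq_rowGram (hi : i ≤ d) (A : Matrix (Fin d) (Fin d) ℤ)
    (G : Matrix (Fin d) (Fin d) ℝ) :
    botBlock hi (A.map (Int.cast : ℤ → ℝ) * G * (A.map (Int.cast : ℤ → ℝ))ᵀ) =
      rowGram G (botRows hi A) := by
  ext j k
  simp [botBlock, rowGram, botRows, Matrix.mul_apply]

theorem eisensteinTerm_eq (hi : i ≤ d) (e : SL(d, ℝ)) (s : ℂ) (c : Cosets d i) :
    eisensteinTerm d i e s c = (cosetDet hi
      ((e : Matrix (Fin d) (Fin d) ℝ) * (e : Matrix (Fin d) (Fin d) ℝ)ᵀ) c : ℂ) ^ (-s) := by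
  refine cexp_eq_cpow_neg ?_ s
  rw [exp_fundamentalWeight hi, map_mul_mul_transpose, botBlock_conj_eq_rowGram]
  rfl

/-- The inverse transpose, conjugated by the longest Weyl group element. -/
def dualSL (γ : SL(d, ℤ)) : SL(d, ℤ) :=
  ⟨((γ⁻¹ : SL(d, ℤ)) : Matrix (Fin d) (Fin d) ℤ)ᵀ.submatrix Fin.revPerm Fin.revPerm, by
    rw [Matrix.det_submatrix_equiv_self, Matrix.det_transpose]; exact (γ⁻¹).2⟩

lemma dualSL_apply (γ : SL(d, ℤ)) (j k : Fin d) : dualSL γ j k = γ⁻¹ k.rev j.rev := rfl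

lemma dualSL_mul (γ γ' : SL(d, ℤ)) : dualSL (γ * γ') = dualSL γ * dualSL γ' := by
  apply Subtype.ext
  change ((γ * γ')⁻¹ : SL(d, ℤ)).1ᵀ.submatrix _ _ = (γ⁻¹).1ᵀ.submatrix _ _ * (γ'⁻¹).1ᵀ.submatrix _ _
  rw [_root_.mul_inv_rev, Matrix.submatrix_mul_equiv, ← Matrix.transpose_mul]
  rfl

lemma dualSL_one : dualSL (1 : SL(d, ℤ)) = 1 := by
  apply Subtype.ext
  change ((1 : SL(d, ℤ))⁻¹).1ᵀ.submatrix Fin.revPerm Fin.revPerm = 1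
  rw [inv_one]
  change (1 : Matrix (Fin d) (Fin d) ℤ)ᵀ.submatrix Fin.revPerm Fin.revPerm = 1
  simp

lemma dualSL_inv (γ : SL(d, ℤ)) : dualSL γ⁻¹ = (dualSL γ)⁻¹ := by
  rw [eq_inv_iff_mul_eq_one, ← dualSL_mul, inv_mul_cancel, dualSL_one]

lemma dualSL_involutive : Function.Involutive (dualSL (d := d)) := by
  intro γ
  ext j k
  rw [dualSL_apply, ← dualSL_inv, dualSL_apply, inv_inv, Fin.rev_rev, Fin.rev_rev]

lemma dualSL_mem_parabolic (hii : i + i' = d) {γ : SL(d, ℤ)} (h : γ ∈ parabolic d i) :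
    dualSL γ ∈ parabolic d i' := by
  intro j k hj hk
  rw [dualSL_apply]
  refine (parabolic d i).inv_mem h _ _ ?_ ?_
  · rw [Fin.val_rev]; omega
  · rw [Fin.val_rev]; omega

/-- Duality between cosets of opposite maximal parabolic subgroups. -/
def cosetDual (hii : i + i' = d) : Cosets d i ≃ Cosets d i' :=
  Quotient.congr dualSL_involutive.toPerm fun a b => by
    change QuotientGroup.rightRel _ a b ↔ QuotientGroup.rightRel _ (dualSL a) (dualSL b)
    rw [QuotientGroup.rightRel_apply, QuotientGroup.rightRel_apply, ← dualSL_inv, ← dualSL_mul]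
    refine ⟨dualSL_mem_parabolic hii, fun h => ?_⟩
    have := dualSL_mem_parabolic (i := i') (i' := i) (by omega) h
    rwa [dualSL_involutive] at this

/-- Passage to the dual form is equivariant for `dualSL`; reversal of the coordinates is what makes
`dualSL` preserve block upper triangular shape, with the block sizes exchanged. -/
lemma dualGram_conj (γ : SL(d, ℤ)) (G : Matrix (Fin d) (Fin d) ℝ) :
    dualGram ((γ : Matrix (Fin d) (Fin d) ℤ).map (Int.cast : ℤ → ℝ) * G *
      ((γ : Matrix (Fin d) (Fin d) ℤ).map (Int.cast : ℤ → ℝ))ᵀ) =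
      (dualSL γ : Matrix (Fin d) (Fin d) ℤ).map (Int.cast : ℤ → ℝ) * dualGram G *
        ((dualSL γ : Matrix (Fin d) (Fin d) ℤ).map (Int.cast : ℤ → ℝ))ᵀ := by
  have hinv : ((γ : Matrix (Fin d) (Fin d) ℤ).map (Int.cast : ℤ → ℝ))⁻¹ =
      ((γ⁻¹ : SL(d, ℤ)) : Matrix (Fin d) (Fin d) ℤ).map (Int.cast : ℤ → ℝ) := by
    refine Matrix.inv_eq_right_inv ?_
    have h1 : ((γ : Matrix (Fin d) (Fin d) ℤ) * ((γ⁻¹ : SL(d, ℤ)) :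
        Matrix (Fin d) (Fin d) ℤ)).map (Int.cast : ℤ → ℝ) =
        (γ : Matrix (Fin d) (Fin d) ℤ).map (Int.cast : ℤ → ℝ) *
          ((γ⁻¹ : SL(d, ℤ)) : Matrix (Fin d) (Fin d) ℤ).map (Int.cast : ℤ → ℝ) :=
      Matrix.map_mul (f := Int.castRingHom ℝ)
    rw [← h1, ← Matrix.SpecialLinearGroup.coe_mul, mul_inv_cancel,
      Matrix.SpecialLinearGroup.coe_one, Matrix.map_one _ Int.cast_zero Int.cast_one]
  have hdual : (dualSL γ : Matrix (Fin d) (Fin d) ℤ).map (Int.cast : ℤ → ℝ) =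
      (((γ : Matrix (Fin d) (Fin d) ℤ).map (Int.cast : ℤ → ℝ))⁻¹)ᵀ.submatrix
        (Fin.revPerm : Fin d ≃ Fin d) (Fin.revPerm : Fin d ≃ Fin d) := by
    rw [hinv]; rfl
  rw [hdual, dualGram, dualGram, Matrix.mul_inv_rev, Matrix.mul_inv_rev,
    show (Fin.rev : Fin d → Fin d) = Fin.revPerm from rfl, Matrix.transpose_submatrix,
    Matrix.submatrix_mul_equiv, Matrix.submatrix_mul_equiv, Matrix.transpose_transpose,
    Matrix.transpose_nonsing_inv, Matrix.mul_assoc]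

/-- The dual of a chosen representative need not be the chosen representative of the dual coset, so
independence of the representative is needed. -/
lemma det_rowGram_botRows_out (hi : i ≤ d) (G : Matrix (Fin d) (Fin d) ℝ) (γ : SL(d, ℤ)) :
    cosetDet hi G (Quotient.mk (QuotientGroup.rightRel (parabolic d i)) γ) =
      (rowGram G (botRows hi (γ : Matrix (Fin d) (Fin d) ℤ))).det := by
  obtain ⟨p, hp, hpγ⟩ := exists_out_eq_mul (i := i) γ
  have h1 : BlockUpper i (p : Matrix (Fin d) (Fin d) ℤ) := hp
  rw [cosetDet, cosetRows, hpγ, Matrix.SpecialLinearGroup.coe_mul, h1.botRows_mul hi,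
    det_rowGram_mul]
  have : (((botBlock hi (p : Matrix (Fin d) (Fin d) ℤ)).det : ℤ) : ℝ) ^ 2 = 1 := by
    exact_mod_cast sq_det_botBlock hi hp
  rw [this, one_mul]

/-- The weight involves the first `d - i` Iwasawa coordinates of `γg`, which are the last ones for
the dual form. For `i = d - 2` the series becomes a sum over `Cosets d 2`, so the rank-two results
apply to it. -/
theorem eisensteinTerm_eq_dual (hi' : i' ≤ d) (hii : i + i' = d) (e : SL(d, ℝ)) (s : ℂ)
    (c : Cosets d i) :
    eisensteinTerm d i e s c = (cosetDet hi' (dualGram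
      ((e : Matrix (Fin d) (Fin d) ℝ) * (e : Matrix (Fin d) (Fin d) ℝ)ᵀ))
        (cosetDual hii c) : ℂ) ^ (-s) := by
  refine cexp_eq_cpow_neg ?_ s
  rw [exp_fundamentalWeight_dual hi' hii, map_mul_mul_transpose, dualGram_conj,
    botBlock_conj_eq_rowGram]
  have h : cosetDual hii c = Quotient.mk (QuotientGroup.rightRel (parabolic d i'))
      (dualSL c.out) := by
    conv_lhs => rw [← Quotient.out_eq c]
    rfl
  rw [h, det_rowGram_botRows_out]

lemma isGram_mul_transpose (e : SL(d, ℝ)) :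
    IsGram ((e : Matrix (Fin d) (Fin d) ℝ) * (e : Matrix (Fin d) (Fin d) ℝ)ᵀ) :=
  ⟨(e : Matrix (Fin d) (Fin d) ℝ)ᵀ, by rw [Matrix.det_transpose]; exact e.2, by
    rw [Matrix.transpose_transpose]⟩

end Iwasawa

/-! ### Meromorphic continuation of the Eisenstein series and of the Mellin transform -/

section Continuation

open MeasureTheory Matrix Set UpperHalfPlane ModularGroup

variable {d : ℕ} {G : Matrix (Fin d) (Fin d) ℝ}

/-- The Eisenstein series of a lattice as a meromorphic function. -/
def latticeEisenstein (G : Matrix (Fin d) (Fin d) ℝ) (s : ℂ) : ℂ :=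
  thetaLambda G (2 * s) / (2 * completedRiemannZeta (2 * s) * completedRiemannZeta (2 * s - 1))

lemma meromorphicAt_completedRiemannZeta_affine (a b s : ℂ) :
    MeromorphicAt (fun s => completedRiemannZeta (a * s + b)) s :=
  MeromorphicAt.comp_analyticAt (g := fun s => a * s + b)
    (meromorphicAt_completedRiemannZeta _) (by fun_prop)

lemma meromorphicOn_thetaLambda_two_mul (hd : 2 < d) (hG : IsGram G) :
    MeromorphicOn (fun s => thetaLambda G (2 * s)) univ := fun s _ =>
  MeromorphicAt.comp_analyticAt (g := fun s => 2 * s) (meromorphicAt_thetaLambda hd hG _)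
    (by fun_prop)

lemma meromorphicOn_zeta_mul_zeta :
    MeromorphicOn (fun s => 2 * completedRiemannZeta (2 * s) * completedRiemannZeta (2 * s - 1))
      univ := by
  intro s _
  have h1 := meromorphicAt_completedRiemannZeta_affine 2 0 s
  have h2 := meromorphicAt_completedRiemannZeta_affine 2 (-1) s
  simp only [add_zero, ← sub_eq_add_neg] at h1 h2
  exact ((MeromorphicAt.const 2 s).mul h1).mul h2

lemma meromorphicOn_latticeEisenstein (hd : 2 < d) (hG : IsGram G) :
    MeromorphicOn (latticeEisenstein G) univ :=
  (meromorphicOn_thetaLambda_two_mul hd hG).div meromorphicOn_zeta_mul_zeta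

/-- The left half plane is included because the second identity evaluates the quotient at the
reflected point `d/2 - s`. -/
lemma zeta_mul_zeta_ne_zero (hd : 2 < d) {s : ℂ} (hs : (d : ℝ) < 2 * s.re ∨ 2 * s.re < 0) :
    2 * completedRiemannZeta (2 * s) * completedRiemannZeta (2 * s - 1) ≠ 0 := by
  have hd' : (2 : ℝ) < d := by exact_mod_cast hd
  have h1 : 1 < (2 * s).re ∨ (2 * s).re < 0 := by
    simp only [Complex.mul_re, Complex.re_ofNat, Complex.im_ofNat, zero_mul, sub_zero]
    rcases hs with h | h
    · left; linarith
    · right; linarith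
  have h2 : 1 < (2 * s - 1).re ∨ (2 * s - 1).re < 0 := by
    simp only [Complex.sub_re, Complex.one_re, Complex.mul_re, Complex.re_ofNat, Complex.im_ofNat,
      zero_mul, sub_zero]
    rcases hs with h | h
    · left; linarith
    · right; linarith
  exact mul_ne_zero (mul_ne_zero two_ne_zero (completedRiemannZeta_regular h1).2)
    (completedRiemannZeta_regular h2).2

lemma analyticAt_thetaLambda_two_mul (hd : 2 < d) (hG : IsGram G) {s : ℂ}
    (hs : (d : ℝ) < 2 * s.re ∨ 2 * s.re < 0) : AnalyticAt ℂ (fun s => thetaLambda G (2 * s)) s :=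
  AnalyticAt.fun_comp (f := fun s : ℂ => 2 * s) (analyticAt_thetaLambda hd hG (by simpa using hs))
    (by fun_prop)

lemma analyticAt_latticeEisenstein (hd : 2 < d) (hG : IsGram G) {s : ℂ}
    (hs : (d : ℝ) < 2 * s.re ∨ 2 * s.re < 0) : AnalyticAt ℂ (latticeEisenstein G) s := by
  have hd' : (2 : ℝ) < d := by exact_mod_cast hd
  have h1 : 1 < (2 * s).re ∨ (2 * s).re < 0 := by
    simp only [Complex.mul_re, Complex.re_ofNat, Complex.im_ofNat, zero_mul, sub_zero]
    rcases hs with h | h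
    · left; linarith
    · right; linarith
  have h2 : 1 < (2 * s - 1).re ∨ (2 * s - 1).re < 0 := by
    simp only [Complex.sub_re, Complex.one_re, Complex.mul_re, Complex.re_ofNat, Complex.im_ofNat,
      zero_mul, sub_zero]
    rcases hs with h | h
    · left; linarith
    · right; linarith
  have a1 : AnalyticAt ℂ (fun s => completedRiemannZeta (2 * s)) s :=
    AnalyticAt.fun_comp (f := fun s : ℂ => 2 * s) (completedRiemannZeta_regular h1).1 (by fun_prop)
  have a2 : AnalyticAt ℂ (fun s => completedRiemannZeta (2 * s - 1)) s :=
    AnalyticAt.fun_comp (f := fun s : ℂ => 2 * s - 1) (completedRiemannZeta_regular h2).1 (by fun_prop)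
  exact (analyticAt_thetaLambda_two_mul hd hG hs).div ((analyticAt_const.mul a1).mul a2)
    (zeta_mul_zeta_ne_zero hd hs)

lemma le_sq_natCast (hd : 2 < d) : (d : ℝ) ≤ (d : ℝ) ^ 2 := by
  have : (2 : ℝ) < d := by exact_mod_cast hd
  nlinarith

/-- Both sides come from the same Mellin transform, once unfolded into a Dirichlet series and once
split at `1`. -/
theorem tsum_cosetDet_eq (hd : 2 < d) (hG : IsGram G) {s : ℂ} (hs : (d : ℝ) ^ 2 < 2 * s.re) :
    ∑' c : Cosets d 2, (cosetDet hd.le G c : ℂ) ^ (-s) = latticeEisenstein G s := by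
  have hd1 := le_sq_natCast hd
  rw [latticeEisenstein, eq_div_iff (zeta_mul_zeta_ne_zero hd (Or.inl (by linarith))),
    ← (hasMellin_thetaPhi hd hG (w := 2 * s) (by simp; linarith)).2, mellin_thetaPhi hd hG hs]
  ring

theorem meromorphicContinuation_lattice (hd : 2 < d) (hG : IsGram G) {f : ℂ → ℂ}
    (hf : ∀ s : ℂ, (d : ℝ) ^ 2 < 2 * s.re →
      f s = ∑' c : Cosets d 2, (cosetDet hd.le G c : ℂ) ^ (-s)) :
    meromorphicContinuation f = toMeromorphicNFOn (latticeEisenstein G) univ ∧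
      IsMeromorphicContinuation ((d : ℝ) ^ 2) f (meromorphicContinuation f) := by
  have hd1 := le_sq_natCast hd
  have hd2 := two_lt_sq hd
  refine meromorphicContinuation_eq_toMeromorphicNFOn (meromorphicOn_latticeEisenstein hd hG)
    (fun s hs => analyticAt_latticeEisenstein hd hG (Or.inl (by linarith))) fun s hs => ?_
  rw [hf s (by linarith), tsum_cosetDet_eq hd hG (by linarith)]

lemma eisensteinSum_two (hd : 2 < d) (e : SL(d, ℝ)) (s : ℂ) :
    eisensteinSum d 2 e s = ∑' c : Cosets d 2, (cosetDet hd.le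
      ((e : Matrix (Fin d) (Fin d) ℝ) * (e : Matrix (Fin d) (Fin d) ℝ)ᵀ) c : ℂ) ^ (-s) :=
  tsum_congr fun c => eisensteinTerm_eq hd.le e s c

lemma eisensteinSum_sub_two (hd : 2 < d) (e : SL(d, ℝ)) (s : ℂ) :
    eisensteinSum d (d - 2) e s = ∑' c : Cosets d 2, (cosetDet hd.le (dualGram
      ((e : Matrix (Fin d) (Fin d) ℝ) * (e : Matrix (Fin d) (Fin d) ℝ)ᵀ)) c : ℂ) ^ (-s) := by
  have hii : d - 2 + 2 = d := by omega
  rw [← (cosetDual hii).tsum_eq]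
  exact tsum_congr fun c => eisensteinTerm_eq_dual hd.le hii e s c

lemma summable_eisensteinTerm (hd : 2 < d) (e : SL(d, ℝ)) {i : ℕ} (hi : i = 2 ∨ i = d - 2) {s : ℂ}
    (hs : (d : ℝ) ^ 2 < 2 * s.re) : Summable (eisensteinTerm d i e s) := by
  have hG := isGram_mul_transpose e
  rcases hi with rfl | rfl
  · exact (summable_cosetDet_cpow hd hG hs).congr fun c => (eisensteinTerm_eq hd.le e s c).symm
  · have hii : d - 2 + 2 = d := by omega
    refine ((cosetDual hii).summable_iff.2 (summable_cosetDet_cpow hd hG.dualGram hs)).congr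
      fun c => ?_
    exact (eisensteinTerm_eq_dual hd.le hii e s c).symm

lemma latticeSum_eq (hG : IsGram G) (τ : ℍ) (u : ℝ) :
    latticeSum τ (u • G) = (thetaTwo G τ u : ℂ) := by
  have hX : (u • G)ᵀ = u • G := by rw [Matrix.transpose_smul, hG.transpose]
  rw [latticeSum, thetaTwo, Complex.ofReal_tsum]
  exact tsum_congr fun M => latticeTerm_eq hX τ M

lemma summable_latticeTerm (hG : IsGram G) (τ : ℍ) {u : ℝ} (hu : 0 < u) :
    Summable (latticeTerm τ (u • G)) := by
  have hX : (u • G)ᵀ = u • G := by rw [Matrix.transpose_smul, hG.transpose]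
  have h : Summable fun M : RankTwo d => ((latExp τ (u • G) M.1 : ℝ) : ℂ) :=
    Complex.hasSum_ofReal.2 ((summable_latExp hG τ hu).subtype _).hasSum |>.summable
  exact h.congr fun M => (latticeTerm_eq hX τ M).symm

lemma eisensteinSL2_zero (τ : ℍ) : eisensteinSL2 τ 0 = 1 :=
  (eisensteinSL2_continuation τ le_rfl).2

lemma thetaIntegral_zero (hG : IsGram G) (u : ℝ) :
    thetaIntegral 0 (u • G) = (thetaPhi G u : ℂ) := by
  simp only [thetaIntegral, eisensteinSL2_zero, one_mul, latticeSum_eq hG, thetaPhi]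
  exact integral_ofReal

lemma thetaMellin_eq (hG : IsGram G) (s : ℂ) :
    thetaMellin G s = mellin (fun u : ℝ => (thetaPhi G u : ℂ)) (2 * s) := by
  rw [thetaMellin]
  congr 1
  funext u
  exact thetaIntegral_zero hG u

lemma thetaMellin_eq_thetaLambda (hd : 2 < d) (hG : IsGram G) {s : ℂ}
    (hs : (d : ℝ) < 2 * s.re) : thetaMellin G s = thetaLambda G (2 * s) := by
  rw [thetaMellin_eq hG]
  exact (hasMellin_thetaPhi hd hG (by simpa using hs)).2

end Continuation

end NonEpstein

end

/-! ### The theorem. -/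

open NonEpstein in
theorem proposition4p1 (d : ℕ) (hd : 3 ≤ d) :
    ∃ σ : ℝ,
      -- the series `E^{SL(2)}_s(τ)` converges, continues to `ℂ`, and equals `1` at `s = 0`
      (∀ τ : UpperHalfPlane,
        (∀ s : ℂ, σ < s.re → Summable (eisensteinTermSL2 τ s)) ∧
        IsMeromorphicContinuation σ (eisensteinSumSL2 τ) (eisensteinSL2 τ) ∧
        eisensteinSL2 τ 0 = 1) ∧
      ∀ (e : Matrix.SpecialLinearGroup (Fin d) ℝ) (G : Matrix (Fin d) (Fin d) ℝ),
        G = (e : Matrix (Fin d) (Fin d) ℝ) * (e : Matrix (Fin d) (Fin d) ℝ).transpose →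
        -- `I(0, uG)` is given by convergent expressions
        (∀ u : ℝ, 0 < u →
          (∀ τ : UpperHalfPlane, Summable (latticeTerm τ (u • G))) ∧
          MeasureTheory.IntegrableOn
            (fun τ : UpperHalfPlane => eisensteinSL2 τ 0 * latticeSum τ (u • G))
            ModularGroup.fd) ∧
        -- the two `SL(d)` series converge for `Re s` large and continue to `ℂ`
        (∀ i : ℕ, i = 2 ∨ i = d - 2 →
          (∀ s : ℂ, σ < s.re → Summable (eisensteinTerm d i e s)) ∧
          IsMeromorphicContinuation σ (eisensteinSum d i e) (eisenstein d i e)) ∧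
        -- the identities for `Re s` large
        (∀ s : ℂ, σ < s.re →
          MellinConvergent (fun u : ℝ => thetaIntegral 0 (u • G)) (2 * s) ∧
          thetaMellin G s =
            2 * completedRiemannZeta (2 * s) * completedRiemannZeta (2 * s - 1) *
              eisenstein d 2 e s ∧
          thetaMellin G s =
            2 * completedRiemannZeta (d - 2 * s) * completedRiemannZeta (d - 2 * s - 1) *
              eisenstein d (d - 2) e (d / 2 - s)) ∧
        -- the identities on `ℂ`, between meromorphic functions
        IsMeromorphicContinuation σ (thetaMellin G) (meromorphicContinuation (thetaMellin G)) ∧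
        meromorphicContinuation (thetaMellin G) =ᶠ[Filter.codiscrete ℂ]
          (fun s : ℂ => 2 * completedRiemannZeta (2 * s) * completedRiemannZeta (2 * s - 1) *
            eisenstein d 2 e s) ∧
        meromorphicContinuation (thetaMellin G) =ᶠ[Filter.codiscrete ℂ]
          (fun s : ℂ => 2 * completedRiemannZeta (d - 2 * s) *
            completedRiemannZeta (d - 2 * s - 1) * eisenstein d (d - 2) e (d / 2 - s)) := by
  have hd2 : 2 < d := hd
  have hle := le_sq_natCast hd2
  have hsq := two_lt_sq hd2
  -- The value `d²` suffices for all the convergence statements, and it exceeds `d/2`, so that `Re s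
  -- > d²` also places `d/2 - s` in the left half plane.
  refine ⟨(d : ℝ) ^ 2, fun τ => ⟨fun s hs => ?_, eisensteinSL2_continuation τ (by linarith)⟩,
    fun e G hGe => ?_⟩
  · exact (summable_norm_eisensteinTermSL2 τ (by linarith)).of_norm
  have hG : IsGram G := hGe ▸ isGram_mul_transpose e
  have hE := meromorphicContinuation_lattice hd2 hG (f := eisensteinSum d 2 e) fun s _ => by
    rw [eisensteinSum_two hd2, hGe]
  have hE' := meromorphicContinuation_lattice hd2 hG.dualGram (f := eisensteinSum d (d - 2) e)
    fun s _ => by rw [eisensteinSum_sub_two hd2, hGe]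
  have hM := meromorphicContinuation_eq_toMeromorphicNFOn (f := thetaMellin G) (σ := (d : ℝ) ^ 2)
    (meromorphicOn_thetaLambda_two_mul hd2 hG)
    (fun s hs => analyticAt_thetaLambda_two_mul hd2 hG (Or.inl (by linarith)))
    (fun s hs => thetaMellin_eq_thetaLambda hd2 hG (by linarith))
  have id1 : ∀ s : ℂ, (d : ℝ) ^ 2 < s.re → thetaMellin G s =
      2 * completedRiemannZeta (2 * s) * completedRiemannZeta (2 * s - 1) *
        eisenstein d 2 e s := by
    intro s hs
    rw [thetaMellin_eq hG, mellin_thetaPhi hd2 hG (by linarith), eisenstein, hE.2.2 s hs,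
      eisensteinSum_two hd2, hGe]
  have id2 : ∀ s : ℂ, (d : ℝ) ^ 2 < s.re → thetaMellin G s =
      2 * completedRiemannZeta (d - 2 * s) * completedRiemannZeta (d - 2 * s - 1) *
        eisenstein d (d - 2) e (d / 2 - s) := by
    intro s hs
    have h2 : (2 : ℂ) * (d / 2 - s) = d - 2 * s := by ring
    -- At the reflected point the zeta factors are analytic and nonzero, so the continued series has
    -- there the value of the quotient `latticeEisenstein`; `thetaLambda_dual` brings its numerator
    -- back to `s`.
    have hre : (d : ℝ) < 2 * ((d : ℂ) / 2 - s).re ∨ 2 * ((d : ℂ) / 2 - s).re < 0 := by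
      right
      simp
      linarith
    have hne := zeta_mul_zeta_ne_zero hd2 hre
    rw [eisenstein, hE'.1, toMeromorphicNFOn_apply_of_analyticAt
      (meromorphicOn_latticeEisenstein hd2 hG.dualGram)
      (analyticAt_latticeEisenstein hd2 hG.dualGram hre), latticeEisenstein]
    rw [h2] at hne ⊢
    rw [mul_div_cancel₀ _ hne, thetaLambda_dual hG,
      thetaMellin_eq_thetaLambda hd2 hG (by linarith)]
  have mero1 : MeromorphicOn (fun s : ℂ => 2 * completedRiemannZeta (2 * s) *
      completedRiemannZeta (2 * s - 1) * eisenstein d 2 e s) Set.univ :=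
    meromorphicOn_zeta_mul_zeta.mul hE.2.1.meromorphicOn
  have mero2 : MeromorphicOn (fun s : ℂ => 2 * completedRiemannZeta (d - 2 * s) *
      completedRiemannZeta (d - 2 * s - 1) * eisenstein d (d - 2) e (d / 2 - s)) Set.univ := by
    intro s _
    have h := (meromorphicOn_zeta_mul_zeta.mul hE'.2.1.meromorphicOn
      ((d : ℂ) / 2 - s) (Set.mem_univ _)).comp_analyticAt (g := fun s : ℂ => (d : ℂ) / 2 - s)
      (x := s) (by fun_prop)
    refine h.congr (Filter.Eventually.of_forall fun t => ?_)
    have h2 : (2 : ℂ) * (d / 2 - t) = d - 2 * t := by ring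
    simp only [Function.comp, Pi.mul_apply, h2]
    rfl
  refine ⟨fun u hu => ⟨fun τ => summable_latticeTerm hG τ hu, ?_⟩, fun i hi => ⟨fun s hs =>
    summable_eisensteinTerm hd2 e hi (by linarith), ?_⟩, fun s hs => ⟨?_, id1 s hs, id2 s hs⟩,
    hM.2, ?_, ?_⟩
  · simp only [eisensteinSL2_zero, one_mul, latticeSum_eq hG]
    exact (integrableOn_thetaTwo hd2 hG hu).ofReal
  · rcases hi with rfl | rfl
    · exact hE.2
    · exact hE'.2
  · simp only [thetaIntegral_zero hG]
    exact (hasMellin_thetaPhi hd2 hG (by simp; linarith)).1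
  · exact eventuallyEq_codiscrete_of_eqOn_halfPlane hM.2.1.meromorphicOn mero1 fun s hs =>
      (hM.2.2 s hs).trans (id1 s hs)
  · exact eventuallyEq_codiscrete_of_eqOn_halfPlane hM.2.1.meromorphicOn mero2 fun s hs =>
      (hM.2.2 s hs).trans (id2 s hs)
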